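/- **Conventions.** All lcsc (locally compact second countable Hausdorff) groups below are unimodular, with Haar measures $m_G, m_H$. A $(G,H)$-*coupling* is a nonzero Lebesgue (standard Borel) measure space $(\Omega,m)$ with a measurable measure-preserving action of $G\times H$ such that there are finite measure spaces $(X,\mu),(Y,\nu)$ and measure space isomorphisms $i:(G,m_G)\times(Y,\nu)\to(\Omega,m)$ and $j:(H,m_H)\times(X,\mu)\to(\Omega,m)$ with $g\,i(g',y)=i(gg',y)$ and $h\,j(h',x)=j(hh',x)$ a.e.; $G,H$ are *measure equivalent* if a $(G,H)$-coupling exists. The isomorphism $j$ defines a measurable cocycle $\alpha:G\times X\to H$ by $g\,j(h,x)=j(h\alpha(g,x)^{-1},g.x)$, and $i$ similarly defines $\beta:H\times Y\to G$. For $p\in[1,\infty]$ and compactly generated $G,H$, the coupling is $L^p$-*integrable* if $i,j$ can be chosen so that $|\alpha(g,\cdot)|\in L^p(X,\mu)$ for a.e. $g\in G$ and $|\beta(h,\cdot)|\in L^p(Y,\nu)$ for a.e. $h\in H$, where $|\cdot|$ is the word norm of a compact symmetric generating set; $G,H$ are $L^p$-*measure equivalent* if such a coupling exists. Let $\mathcal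 G$ be a Polish group and $\pi:G\to\mathcal G$ a continuous homomorphism. A *tautening map* for a measure space $(\Omega,m)$ with an action of $G\times G$ is a measurable $\Phi:\Omega\to\mathcal G$ with $\Phi((g_1,g_2)\omega)=\pi(g_1)\Phi(\omega)\pi(g_2)^{-1}$ for a.e. $\omega$ and all $g_1,g_2\in G$; the space is *taut relative to* $\pi$ if a tautening map exists and is unique up to null sets, and *taut* if this holds for $\pi=\mathrm{id}_G$. $G$ is *taut* (resp. $p$-*taut*) if every (resp. every $L^p$-integrable) $(G,G)$-coupling is taut. $\mathcal G$ is *strongly ICC relative to* a subgroup $\mathcal G_0$ if $\mathcal G\setminus\{e\}$ carries no Borel probability measure invariant under conjugation by $\mathcal G_0$. For a $(G,H)$-coupling $(\Omega,m)$, $\Omega\times_H\Omega^*$ is the space of orbits $[\omega_1,\omega_2]$ of the diagonal $H$-action on $\Omega\times\Omega$, with the quotient of the measure $m\times m$ and the action $(g_1,g_2)[\omega_1,\omega_2]=[g_1\omega_1,g_2\omega_2]$ of $G\times G$. **Theorem.** Let $G,H$ be unimodular lcsc groups. (1) Suppose that $G$ is taut and $H$ is measure equivalent to $G$, or that, for some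 $p\in[1,\infty]$, $G$ is $p$-taut and $H$ is $L^p$-measure equivalent to $G$. Then there is a short exact sequence with continuous homomorphisms $$1\to K\to H\to\bar H\to 1,$$ where $K$ is compact and $\bar H$ is a closed subgroup of $G$ such that $G/\bar H$ carries a $G$-invariant Borel probability measure. (2) Let $(\Omega,m)$ be a $(G,H)$-coupling, $\mathcal G$ a Polish group and $\pi:G\to\mathcal G$ a continuous homomorphism. Assume that $\mathcal G$ is strongly ICC relative to $\pi(G)$ and that $\Omega\times_H\Omega^*$ is taut relative to $\pi$. Then there are a continuous homomorphism $\rho:H\to\mathcal G$ and a measurable map $\Psi:\Omega\to\mathcal G$ such that for a.e. $\omega\in\Omega$ $$\Psi((g,h)\omega)=\pi(g)\Psi(\omega)\rho(h)^{-1}\qquad(g\in G,\ h\in H),$$ and the unique tautening map $\Phi:\Omega\times_H\Omega^*\to\mathcal G$ is given a.e. by $\Phi([\omega_1,\omega_2])=\Psi(\omega_1)\Psi(\omega_2)^{-1}$. The pair $(\Psi,\rho)$ is unique up to conjugation: if a continuous homomorphism $\rho'$ and a measurable map $\Psi'$ satisfy the same equivariance (for all $g,h$, for a.e. $\omega$),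 then for some $x\in\mathcal G$ one has $\Psi'(\omega)=\Psi(\omega)x^{-1}$ a.e. and $\rho'(h)=x\rho(h)x^{-1}$ for all $h\in H$. (3) If, in addition, $\pi$ has compact kernel and closed image, then so does $\rho$, and there is a Borel measure $\bar m$ on $\mathcal G$ which is invariant under $x\mapsto\pi(g)x\rho(h)$ for all $g\in G$, $h\in H$ and descends to finite measures $\bar\nu$ on $\pi(G)\backslash\mathcal G$ and $\bar\mu$ on $\mathcal G/\rho(H)$, i.e. for all measurable $F\ge 0$ $$\int F\,d\bar m=\int_{\pi(G)\backslash\mathcal G}\int_{\pi(G)}F(ax)\,da\,d\bar\nu(\pi(G)x)=\int_{\mathcal G/\rho(H)}\int_{\rho(H)}F(xb)\,db\,d\bar\mu(x\rho(H)),$$ where $da$, $db$ are the push-forwards of $m_G$, $m_H$. Moreover $\pi(G)$ and $\rho(H)$ are unimodular lcsc groups with Haar measures $da$, $db$; $(\mathcal G,\bar m)$, with the action $(a,b)x=axb^{-1}$, is a $(\pi(G),\rho(H))$-coupling; and it is a quotient of $(\ker\pi\times\ker\rho)\backslash(\Omega,m)$, i.e. there is a measure-preserving map $F$ from this orbit space,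 with the push-forward of $m$, to $(\mathcal G,\bar m)$ such that for a.e. $\omega$, $F([(g,h)\omega])=\pi(g)F([\omega])\rho(h)^{-1}$ for all $g\in G$, $h\in H$. -/

import Mathlib

open MeasureTheory Pointwise
open scoped ENNReal

universe u

/-! ### Measure equivalence couplings -/

section Couplings

variable {G H Ω : Type u} [Group G] [Group H] [MeasurableSpace G] [MeasurableSpace H]
  [MeasurableSpace Ω]

/-- `i` is an isomorphism of measure spaces (modulo null sets, with inverse `i'`) from
`(K, mK) × (Y, ν)` onto `(Ω, m)` that carries the translation action of `K` on the first factor to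
the given action `act` of `K` on `Ω`. -/
structure IsFundamentalIso {K Y Z : Type u} [Group K] [MeasurableSpace K] [MeasurableSpace Y]
    [MeasurableSpace Z] (act : K → Z → Z) (mK : Measure K) (ν : Measure Y) (m : Measure Z)
    (i : K × Y → Z) (i' : Z → K × Y) : Prop where
  measurePreserving : MeasurePreserving i (mK.prod ν) m
  measurable_inv : Measurable i'
  left_inv : ∀ᵐ p ∂(mK.prod ν), i' (i p) = p
  right_inv : ∀ᵐ z ∂m, i (i' z) = z
  equivariant : ∀ k : K, ∀ᵐ p ∂(mK.prod ν), i (k * p.1, p.2) = act k (i p)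

/-- `(Ω, m)`, with its action of `G × H`, is a `(G, H)`-coupling. The measure is required to be
nonzero. -/
structure IsCoupling [act : MulAction (G × H) Ω] (mG : Measure G) (mH : Measure H)
    (m : Measure Ω) : Prop where
  ne_zero : m ≠ 0
  measurable_action : Measurable fun p : (G × H) × Ω => p.1 • p.2
  invariant : ∀ a : G × H, m.map (fun ω => a • ω) = m
  left : ∃ (Y : Type u) (_ : MeasurableSpace Y) (_ : StandardBorelSpace Y) (ν : Measure Y)
    (i : G × Y → Ω) (i' : Ω → G × Y), IsFiniteMeasure ν ∧
      IsFundamentalIso (fun (g : G) (ω : Ω) => (g, (1 : H)) • ω) mG ν m i i'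
  right : ∃ (X : Type u) (_ : MeasurableSpace X) (_ : StandardBorelSpace X) (μ : Measure X)
    (j : H × X → Ω) (j' : Ω → H × X), IsFiniteMeasure μ ∧
      IsFundamentalIso (fun (h : H) (ω : Ω) => ((1 : G), h) • ω) mH μ m j j'

/-- The groups `G` and `H` (with Haar measures `mG`, `mH`) are measure equivalent. -/
def MeasureEquivalent (mG : Measure G) (mH : Measure H) : Prop :=
  ∃ (Ω : Type u) (_ : MeasurableSpace Ω) (_ : StandardBorelSpace Ω) (_ : MulAction (G × H) Ω)
    (m : Measure Ω), IsCoupling mG mH m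

end Couplings

/-! ### Integrability of cocycles and couplings -/

section Integrability

/-- `S` is a compact symmetric generating set of the group `K`. -/
def IsCompactGeneratingSet {K : Type u} [Group K] [TopologicalSpace K] (S : Set K) : Prop :=
  IsCompact S ∧ S⁻¹ = S ∧ Subgroup.closure S = ⊤

/-- The word norm `|k|_S = min {n | k ∈ Sⁿ}`. -/
noncomputable def wordNorm {K : Type u} [Group K] (S : Set K) (k : K) : ℕ :=
  sInf {n : ℕ | k ∈ S ^ n}

/-- `c : A × X → K` is an `L^p`-integrable map (`1 ≤ p ≤ ∞`): for almost every `a`, the function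
`x ↦ |c(a, x)|` has finite `L^p`-norm. Here `|·|` is the word norm of a compact symmetric generating
set of `K` (in particular `K` is compactly generated); any two such norms are equivalent. -/
def IsLpIntegrableCocycle {A K X : Type u} [MeasurableSpace A] [Group K] [TopologicalSpace K]
    [MeasurableSpace X] (p : ℝ≥0∞) (mA : Measure A) (μ : Measure X) (c : A → X → K) : Prop :=
  ∃ S : Set K, IsCompactGeneratingSet S ∧
    ∀ᵐ a ∂mA, eLpNorm (fun x => (wordNorm S (c a x) : ℝ)) p μ < ∞

/-- `c : A × X → K` is the measurable cocycle determined by the fundamental isomorphism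
`j : K × X → Ω` with inverse `j'`, i.e. `a : j(k, x) ↦ j(k c(a, x)⁻¹, a.x)`. -/
def IsMECocycle {A K X Z : Type u} [MeasurableSpace A] [Group K] [MeasurableSpace K]
    [MeasurableSpace X] (actA : A → Z → Z) (mK : Measure K) (μ : Measure X)
    (j : K × X → Z) (j' : Z → K × X) (c : A → X → K) : Prop :=
  Measurable (Function.uncurry c) ∧
    ∀ a : A, ∀ᵐ q ∂(mK.prod μ), (j' (actA a (j q))).1 = q.1 * (c a q.2)⁻¹

variable {G H Ω : Type u} [Group G] [Group H] [MeasurableSpace G] [MeasurableSpace H]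
  [TopologicalSpace G] [TopologicalSpace H] [MeasurableSpace Ω]

/-- `(Ω, m)` is an `L^p`-integrable `(G, H)`-coupling: there are fundamental isomorphisms
`i : G × Y → Ω` and `j : H × X → Ω` whose cocycles `β : H × Y → G` and `α : G × X → H` are both
`L^p`-integrable. -/
structure IsLpCoupling [act : MulAction (G × H) Ω] (p : ℝ≥0∞) (mG : Measure G) (mH : Measure H)
    (m : Measure Ω) : Prop where
  isCoupling : IsCoupling mG mH m
  left : ∃ (Y : Type u) (_ : MeasurableSpace Y) (_ : StandardBorelSpace Y) (ν : Measure Y)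
    (i : G × Y → Ω) (i' : Ω → G × Y) (β : H → Y → G), IsFiniteMeasure ν ∧
      IsFundamentalIso (fun (g : G) (ω : Ω) => (g, (1 : H)) • ω) mG ν m i i' ∧
      IsMECocycle (fun (h : H) (ω : Ω) => ((1 : G), h) • ω) mG ν i i' β ∧
      IsLpIntegrableCocycle p mH ν β
  right : ∃ (X : Type u) (_ : MeasurableSpace X) (_ : StandardBorelSpace X) (μ : Measure X)
    (j : H × X → Ω) (j' : Ω → H × X) (α : G → X → H), IsFiniteMeasure μ ∧
      IsFundamentalIso (fun (h : H) (ω : Ω) => ((1 : G), h) • ω) mH μ m j j' ∧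
      IsMECocycle (fun (g : G) (ω : Ω) => (g, (1 : H)) • ω) mH μ j j' α ∧
      IsLpIntegrableCocycle p mG μ α

/-- The groups `G` and `H` (with Haar measures `mG`, `mH`) are `L^p`-measure equivalent. -/
def LpMeasureEquivalent (p : ℝ≥0∞) (mG : Measure G) (mH : Measure H) : Prop :=
  ∃ (Ω : Type u) (_ : MeasurableSpace Ω) (_ : StandardBorelSpace Ω) (_ : MulAction (G × H) Ω)
    (m : Measure Ω), IsLpCoupling p mG mH m

end Integrability

/-! ### Tautness and the strong ICC property -/

section Taut

/-- `Φ : Ω → 𝒢` is a tautening map relative to `π`. -/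
def IsTauteningMap {G P Ω : Type u} [Group G] [Group P] [MeasurableSpace P] [MeasurableSpace Ω]
    [MulAction (G × G) Ω] (π : G →* P) (m : Measure Ω) (Φ : Ω → P) : Prop :=
  Measurable Φ ∧
    ∀ᵐ ω ∂m, ∀ g₁ g₂ : G, Φ ((g₁, g₂) • ω) = π g₁ * Φ ω * (π g₂)⁻¹

/-- `(Ω, m)` is taut relative to `π`: there is a tautening map, and it is unique up to null sets. -/
def IsTautRelative {G P Ω : Type u} [Group G] [Group P] [MeasurableSpace P] [MeasurableSpace Ω]
    [MulAction (G × G) Ω] (π : G →* P) (m : Measure Ω) : Prop :=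
  (∃ Φ : Ω → P, IsTauteningMap π m Φ) ∧
    ∀ Φ Φ' : Ω → P, IsTauteningMap π m Φ → IsTauteningMap π m Φ' → Φ =ᵐ[m] Φ'

/-- The group `G` is taut: every `(G, G)`-coupling is taut. -/
def IsTautGroup {G : Type u} [Group G] [MeasurableSpace G] (mG : Measure G) : Prop :=
  ∀ (Ω : Type u) [MeasurableSpace Ω] [StandardBorelSpace Ω] [MulAction (G × G) Ω]
    (m : Measure Ω), IsCoupling mG mG m → IsTautRelative (MonoidHom.id G) m

/-- The group `G` is `p`-taut: every `L^p`-integrable `(G, G)`-coupling is taut. -/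
def IsPTautGroup {G : Type u} [Group G] [TopologicalSpace G] [MeasurableSpace G] (p : ℝ≥0∞)
    (mG : Measure G) : Prop :=
  ∀ (Ω : Type u) [MeasurableSpace Ω] [StandardBorelSpace Ω] [MulAction (G × G) Ω]
    (m : Measure Ω), IsLpCoupling p mG mG m → IsTautRelative (MonoidHom.id G) m

/-- `P` is strongly ICC relative to the subgroup `P₀`: no Borel probability measure on `P \ {1}` is
invariant under conjugation by `P₀`. -/
def IsStronglyICCRelative {P : Type u} [Group P] [MeasurableSpace P] (P₀ : Subgroup P) : Prop :=
  ¬ ∃ μ : Measure P, IsProbabilityMeasure μ ∧ μ {1} = 0 ∧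
    ∀ g ∈ P₀, μ.map (fun x => g * x * g⁻¹) = μ

end Taut

/-! ### Quotient measures and the composition of couplings -/

/-- `mbar` is the quotient measure on the orbit space `Z / K` (the quotient by `s`) of the measure
`m` on `Z`, relative to the measure `mK` on `K`:
`∫_Z F dm = ∫_{Z/K} ∫_K F(k z) dmK(k) dmbar([z])` for all measurable `F ≥ 0`. -/
def IsQuotientMeasure {K Z : Type u} [MeasurableSpace K] [MeasurableSpace Z] (s : Setoid Z)
    (act : K → Z → Z) (mK : Measure K) (m : Measure Z) (mbar : Measure (Quotient s)) : Prop :=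
  ∀ F : Z → ℝ≥0∞, Measurable F →
    ∫⁻ z, F z ∂m = ∫⁻ q, ∫⁻ k, F (act k q.out) ∂mK ∂mbar

section Composition

variable (G₁ G₂ H Ω₁ Ω₂ : Type u) [Group G₁] [Group G₂] [Group H]
  [MulAction (G₁ × H) Ω₁] [MulAction (G₂ × H) Ω₂]

variable {H Ω₁ Ω₂} in
/-- The diagonal action of `H` on `Ω₁ × Ω₂`. -/
def diagAct (h : H) (w : Ω₁ × Ω₂) : Ω₁ × Ω₂ :=
  (((1 : G₁), h) • w.1, ((1 : G₂), h) • w.2)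

variable {H Ω₁ Ω₂} in
lemma diagAct_one (w : Ω₁ × Ω₂) : diagAct G₁ G₂ (1 : H) w = w := by
  have h1 : ((1 : G₁), (1 : H)) • w.1 = w.1 := one_smul (G₁ × H) w.1
  have h2 : ((1 : G₂), (1 : H)) • w.2 = w.2 := one_smul (G₂ × H) w.2
  simp [diagAct, h1, h2]

variable {H Ω₁ Ω₂} in
lemma diagAct_mul (h k : H) (w : Ω₁ × Ω₂) :
    diagAct G₁ G₂ (h * k) w = diagAct G₁ G₂ h (diagAct G₁ G₂ k w) := by
  simp [diagAct, smul_smul]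

/-- The orbit equivalence relation of the diagonal action of `H` on `Ω₁ × Ω₂`. -/
def diagSetoid : Setoid (Ω₁ × Ω₂) where
  r w w' := ∃ h : H, diagAct G₁ G₂ h w = w'
  iseqv :=
    { refl := fun w => ⟨1, diagAct_one G₁ G₂ w⟩
      symm := by
        rintro w w' ⟨h, rfl⟩
        exact ⟨h⁻¹, by rw [← diagAct_mul, inv_mul_cancel, diagAct_one]⟩
      trans := by
        rintro w w' w'' ⟨h, rfl⟩ ⟨k, rfl⟩
        exact ⟨k * h, diagAct_mul G₁ G₂ k h w⟩ }

/-- The space `Ω₁ ×_H Ω₂*` of `H`-orbits on `Ω₁ × Ω₂`, with the quotient `σ`-algebra. -/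
abbrev CouplingComp : Type u := Quotient (diagSetoid G₁ G₂ H Ω₁ Ω₂)

variable {Ω₁ Ω₂} in
/-- The class `[ω₁, ω₂]`. -/
def CouplingComp.mk (w : Ω₁ × Ω₂) : CouplingComp G₁ G₂ H Ω₁ Ω₂ :=
  Quotient.mk (diagSetoid G₁ G₂ H Ω₁ Ω₂) w

/-- The action `(g₁, g₂) [ω₁, ω₂] = [g₁ ω₁, g₂ ω₂]` of `G₁ × G₂` on `Ω₁ ×_H Ω₂*`. -/
instance CouplingComp.instMulAction : MulAction (G₁ × G₂) (CouplingComp G₁ G₂ H Ω₁ Ω₂) where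
  smul g := Quotient.map
    (fun w => ((g.1, (1 : H)) • w.1, (g.2, (1 : H)) • w.2)) (by
      rintro w w' ⟨h, rfl⟩
      exact ⟨h, by simp [diagAct, smul_smul]⟩)
  one_smul := by
    rintro ⟨w⟩
    refine congrArg (Quotient.mk _) ?_
    exact diagAct_one G₁ G₂ w
  mul_smul := by
    rintro g g' ⟨w⟩
    refine congrArg (Quotient.mk _) ?_
    simp [smul_smul]

variable {Ω₁ Ω₂} [MeasurableSpace H] [MeasurableSpace Ω₁] [MeasurableSpace Ω₂]

open Classical in
/-- The measure of `Ω₁ ×_H Ω₂*`: the quotient of `m₁ × m₂` by the diagonal action of `H`. It exists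
whenever `Ω₁` and `Ω₂` are couplings, see `exists_isQuotientMeasure_composition`. -/
noncomputable def compositionMeasure (mH : Measure H) (m₁ : Measure Ω₁) (m₂ : Measure Ω₂) :
    Measure (CouplingComp G₁ G₂ H Ω₁ Ω₂) :=
  if h : ∃ mbar, IsQuotientMeasure (diagSetoid G₁ G₂ H Ω₁ Ω₂) (diagAct G₁ G₂) mH (m₁.prod m₂) mbar
  then h.choose else 0

end Composition

/-- A coupling of second countable groups has an s-finite measure. -/
lemma IsCoupling.sFinite {G H Ω : Type u} [Group G] [Group H] [MeasurableSpace G]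
    [MeasurableSpace H] [MeasurableSpace Ω] [MulAction (G × H) Ω] {mG : Measure G} {mH : Measure H}
    {m : Measure Ω} [SFinite mH] (hm : IsCoupling mG mH m) : SFinite m := by
  obtain ⟨X, _, _, μ, j, j', hμ, hj⟩ := hm.right
  rw [← hj.measurePreserving.map_eq]
  infer_instance

theorem exists_isQuotientMeasure_composition {G₁ G₂ H Ω₁ Ω₂ : Type u} [Group G₁] [Group G₂]
    [Group H] [MeasurableSpace G₁] [MeasurableSpace G₂] [TopologicalSpace H]
    [IsTopologicalGroup H] [LocallyCompactSpace H] [SecondCountableTopology H]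
    [MeasurableSpace H] [BorelSpace H] [MeasurableSpace Ω₁] [MeasurableSpace Ω₂]
    [MulAction (G₁ × H) Ω₁] [MulAction (G₂ × H) Ω₂]
    {mG₁ : Measure G₁} {mG₂ : Measure G₂} (mH : Measure H) [mH.IsHaarMeasure]
    [mH.IsMulRightInvariant] {m₁ : Measure Ω₁} {m₂ : Measure Ω₂}
    (h₁ : IsCoupling mG₁ mH m₁) (h₂ : IsCoupling mG₂ mH m₂) :
    ∃ mbar, IsQuotientMeasure (diagSetoid G₁ G₂ H Ω₁ Ω₂) (diagAct G₁ G₂) mH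
      (m₁.prod m₂) mbar := by
  classical
  have := h₁.sFinite
  have := h₂.sFinite
  obtain ⟨X, _, _, μ, j, j', _, hj⟩ := h₁.right
  obtain ⟨B, hB, hB0⟩ : ∃ B : Set H, IsCompact B ∧ mH B ≠ 0 := by
    obtain ⟨K⟩ : Nonempty (TopologicalSpace.PositiveCompacts H) := inferInstance
    exact ⟨K, K.isCompact, (MeasureTheory.Measure.measure_pos_of_nonempty_interior mH K.interior_nonempty).ne'⟩
  have hBtop : mH B ≠ ∞ := hB.measure_lt_top.ne
  have hact₁ : Measurable fun p : H × Ω₁ => ((1 : G₁), p.1) • p.2 :=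
    h₁.measurable_action.comp ((measurable_const.prodMk measurable_fst).prodMk measurable_snd)
  have hact₂ : Measurable fun p : H × Ω₂ => ((1 : G₂), p.1) • p.2 :=
    h₂.measurable_action.comp ((measurable_const.prodMk measurable_fst).prodMk measurable_snd)
  have hdiag : Measurable fun p : (Ω₁ × Ω₂) × H => diagAct G₁ G₂ p.2 p.1 :=
    (hact₁.comp (measurable_snd.prodMk (measurable_fst.comp measurable_fst))).prodMk
      (hact₂.comp (measurable_snd.prodMk (measurable_snd.comp measurable_fst)))
  let q : Ω₁ × Ω₂ → CouplingComp G₁ G₂ H Ω₁ Ω₂ := CouplingComp.mk G₁ G₂ H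
  have hq : Measurable q :=
    @measurable_quotient_mk' _ _ (diagSetoid G₁ G₂ H Ω₁ Ω₂)
  let M : Measure Ω₁ := ((mH.restrict B).prod μ).map j
  have hjm : Measurable j := hj.measurePreserving.measurable
  refine ⟨(mH B)⁻¹ • (M.prod m₂).map q, fun F hF => ?_⟩
  let I : Ω₁ × Ω₂ → ℝ≥0∞ := fun w => ∫⁻ k, F (diagAct G₁ G₂ k w) ∂mH
  have hI : Measurable I := (hF.comp hdiag).lintegral_prod_right'
  have hIinv : ∀ (h : H) w, I (diagAct G₁ G₂ h w) = I w := by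
    intro h w
    simp only [I, ← diagAct_mul]
    exact lintegral_mul_right_eq_self (fun k => F (diagAct G₁ G₂ k w)) h
  have hout : ∀ w, I (q w).out = I w := by
    intro w
    obtain ⟨h, hh⟩ : ∃ h : H, diagAct G₁ G₂ h (q w).out = w :=
      Quotient.exact (Quotient.out_eq (q w))
    conv_rhs => rw [← hh]
    exact (hIinv h _).symm
  have hIq : Measurable fun z : CouplingComp G₁ G₂ H Ω₁ Ω₂ => I z.out := by
    refine measurable_from_quotient.2 ?_
    have : ((fun z : CouplingComp G₁ G₂ H Ω₁ Ω₂ => I z.out) ∘ Quotient.mk _) = I := funext hout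
    rw [this]
    exact hI
  change _ = ∫⁻ z, I z.out ∂((mH B)⁻¹ • (M.prod m₂).map q)
  rw [lintegral_smul_measure, lintegral_map hIq hq]
  simp only [hout]
  -- the diagonal action preserves the second measure and translates the first coordinate
  have key : ∫⁻ w, I w ∂(M.prod m₂) = mH B * ∫⁻ w, F w ∂(m₁.prod m₂) := by
    let E : Ω₁ → ℝ≥0∞ := fun ω => ∫⁻ ω₂, F (ω, ω₂) ∂m₂
    have hE : Measurable E := hF.lintegral_prod_right'
    have hstep : ∀ (k : H) (ω : Ω₁),
        ∫⁻ ω₂, F (diagAct G₁ G₂ k (ω, ω₂)) ∂m₂ = E (((1 : G₁), k) • ω) := by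
      intro k ω
      have hk : Measurable fun ω₂ : Ω₂ => ((1 : G₂), k) • ω₂ :=
        hact₂.comp measurable_prodMk_left
      have := lintegral_map (μ := m₂) (f := fun ω₂ => F (((1 : G₁), k) • ω, ω₂))
        (hF.comp measurable_prodMk_left) hk
      rw [h₂.invariant] at this
      exact this.symm
    have e1 : ∫⁻ w, I w ∂(M.prod m₂) = ∫⁻ ω, ∫⁻ k, E (((1 : G₁), k) • ω) ∂mH ∂M := by
      rw [lintegral_prod _ hI.aemeasurable]
      refine lintegral_congr fun ω => ?_
      simp only [I]
      rw [lintegral_lintegral_swap]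
      · exact lintegral_congr fun k => hstep k ω
      · exact (hF.comp (hdiag.comp
          ((measurable_const.prodMk measurable_fst).prodMk measurable_snd))).aemeasurable
    have hEact : Measurable fun p : Ω₁ × H => E (((1 : G₁), p.2) • p.1) :=
      hE.comp (hact₁.comp (measurable_snd.prodMk measurable_fst))
    have hmul : Measurable fun p : (H × X) × H => (p.2 * p.1.1, p.1.2) :=
      (measurable_snd.mul (measurable_fst.comp measurable_fst)).prodMk
        (measurable_snd.comp measurable_fst)
    have e2 : ∫⁻ ω, ∫⁻ k, E (((1 : G₁), k) • ω) ∂mH ∂M =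
        ∫⁻ k, ∫⁻ p, E (j (k * p.1, p.2)) ∂((mH.restrict B).prod μ) ∂mH := by
      rw [lintegral_map hEact.lintegral_prod_right' hjm, lintegral_lintegral_swap]
      · refine lintegral_congr fun k => ?_
        have hac : (mH.restrict B).prod μ ≪ mH.prod μ :=
          Measure.AbsolutelyContinuous.prod Measure.restrict_le_self.absolutelyContinuous
            Measure.AbsolutelyContinuous.rfl
        refine lintegral_congr_ae ?_
        filter_upwards [hac.ae_le (hj.equivariant k)] with p hp
        rw [hp]
      · exact (hEact.comp ((hjm.comp measurable_fst).prodMk measurable_snd)).aemeasurable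
    have e3 : ∫⁻ k, ∫⁻ p, E (j (k * p.1, p.2)) ∂((mH.restrict B).prod μ) ∂mH =
        ∫⁻ b in B, ∫⁻ ω, E ω ∂m₁ ∂mH := by
      have hEj : Measurable fun r : (H × X) × H => E (j (r.2 * r.1.1, r.1.2)) :=
        (hE.comp hjm).comp hmul
      have hprod := lintegral_prod (μ := mH) (ν := μ) (fun a => E (j a))
        (hE.comp hjm).aemeasurable
      have hEj' : Measurable (Function.uncurry fun (k : H) (p : H × X) =>
          E (j (k * p.1, p.2))) := hEj.comp measurable_swap
      rw [lintegral_lintegral_swap hEj'.aemeasurable,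
        lintegral_prod _ hEj.lintegral_prod_right'.aemeasurable]
      refine lintegral_congr fun b => ?_
      have hb : Measurable fun r : X × H => E (j (r.2 * b, r.1)) :=
        hEj.comp ((measurable_const.prodMk measurable_fst).prodMk measurable_snd)
      rw [lintegral_lintegral_swap hb.aemeasurable, ← hj.measurePreserving.map_eq,
        lintegral_map hE hjm, hprod]
      exact lintegral_mul_right_eq_self (fun k => ∫⁻ x, E (j (k, x)) ∂μ) b
    rw [e1, e2, e3, lintegral_const, Measure.restrict_apply_univ,
      lintegral_prod _ hF.aemeasurable, mul_comm]
  rw [key, smul_eq_mul, ← mul_assoc, ENNReal.inv_mul_cancel hB0 hBtop, one_mul]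

theorem compositionMeasure_spec {G₁ G₂ H Ω₁ Ω₂ : Type u} [Group G₁] [Group G₂]
    [Group H] [MeasurableSpace G₁] [MeasurableSpace G₂] [TopologicalSpace H]
    [IsTopologicalGroup H] [LocallyCompactSpace H] [SecondCountableTopology H]
    [MeasurableSpace H] [BorelSpace H] [MeasurableSpace Ω₁] [MeasurableSpace Ω₂]
    [MulAction (G₁ × H) Ω₁] [MulAction (G₂ × H) Ω₂]
    {mG₁ : Measure G₁} {mG₂ : Measure G₂} (mH : Measure H) [mH.IsHaarMeasure]
    [mH.IsMulRightInvariant] {m₁ : Measure Ω₁} {m₂ : Measure Ω₂}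
    (h₁ : IsCoupling mG₁ mH m₁) (h₂ : IsCoupling mG₂ mH m₂) :
    IsQuotientMeasure (diagSetoid G₁ G₂ H Ω₁ Ω₂) (diagAct G₁ G₂) mH (m₁.prod m₂)
      (compositionMeasure G₁ G₂ H mH m₁ m₂) := by
  have h := exists_isQuotientMeasure_composition mH h₁ h₂
  rw [compositionMeasure, dif_pos h]
  exact h.choose_spec

/-! ### Couplings by left and right translations -/

/-- The action `(a, b) x = a x b⁻¹` of `A × B` on `P`, for subgroups `A`, `B` of `P`. -/
@[reducible] def biMulAction {P : Type u} [Group P] (A B : Subgroup P) : MulAction (A × B) P where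
  smul a x := (a.1 : P) * x * (a.2 : P)⁻¹
  one_smul x := by
    change ((1 : A) : P) * x * ((1 : B) : P)⁻¹ = x
    simp
  mul_smul a b x := by
    change ((a.1 * b.1 : A) : P) * x * ((a.2 * b.2 : B) : P)⁻¹ =
      (a.1 : P) * ((b.1 : P) * x * (b.2 : P)⁻¹) * (a.2 : P)⁻¹
    simp [mul_assoc]

/-- `H` is an extension `1 → K → H → H̄ → 1` with continuous homomorphisms, where `K` is compact and
`H̄` is a closed subgroup of `G` such that `G ⧸ H̄` carries a `G`-invariant Borel probability
measure. -/
def IsCompactExtensionOfFiniteCovolume (G H : Type u) [Group G] [TopologicalSpace G]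
    [MeasurableSpace G] [Group H] [TopologicalSpace H] : Prop :=
  ∃ (Hbar : Subgroup G) (q : H →ₜ* Hbar),
    IsCompact ((q : H →* Hbar).ker : Set H) ∧ Function.Surjective q ∧ IsClosed (Hbar : Set G) ∧
    ∃ μ : Measure (G ⧸ Hbar), IsProbabilityMeasure μ ∧ ∀ g : G, μ.map (fun x => g • x) = μ

/-!
The argument is that of Bader, Furman and Sauer. A tautening map of `Ω ×_H Ω*` is handled through
its pull-back `Φ : Ω × Ω → P`, a *tautening kernel*: a measurable map that is equivariant under
`G × G` and invariant under the diagonal action of `H`, up to null sets.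

Two tautening kernels `Φ`, `Φ'` agree: the function `Φ⁻¹ Φ'` on `Ω × Ω` is invariant under the
diagonal action of `H` and under `G` acting on the first factor, while `G` acting on the second
factor conjugates it by elements of `π(G)`. Pushing forward a finite measure that represents the
quotient of `m × m` by `G × H` therefore gives a measure on `P` that is invariant under
conjugation, and the strong ICC property forces it to be concentrated at `1`
(`ae_eq_one_of_isStronglyICCRelative`, `IsTauteningKernel.ae_eq`). The same principle, applied to
three variables, gives the cocycle identity `Φ (ω₁, ω₂) = Φ (ω₁, ω₃) Φ (ω₂, ω₃)⁻¹`
(`IsTauteningKernel.ae_cocycle`). Freezing `ω₃` splits the kernel as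
`Φ (ω₁, ω₂) = Ψ (ω₁) Ψ (ω₂)⁻¹`, and the invariance of `Φ` under `H` says that `Ψ (h ω)⁻¹ Ψ (ω)`
does not depend on `ω`; this element is `ρ h`. Measurable homomorphisms are continuous, and `Ψ` can
be made strictly equivariant on an invariant conull set (`IsTauteningKernel.exists_hom`,
`IsTauteningKernel.unique_hom`).

If `π` is proper, then the closed subgroup `π(G)` has a measurable equivariant retraction, obtained
from a measurable choice of representatives of its cosets (`exists_measurable_equivariant`). It
turns `Ψ_* m` into the product of Haar measure and a finite measure. In particular `Ψ_* m` is
locally finite, so that elements of `H` with `ρ`-image near `1` move a fixed set of positive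
measure inside a set of finite measure; as `H` acts properly on `Ω`, they stay in a compact set,
and `ρ` is proper (`exists_isCompact_of_equivariant`,
`isCompact_ker_and_isClosed_range_of_coupling`). All statements on the measure `Ψ_* m` then follow
from the two retractions, for `π(G)` and `ρ(H)` (`exists_image_coupling`).

For a taut group `G` two more points are needed. First, `G` is strongly ICC: a conjugation
invariant probability measure `μ` makes `m_G × μ` a coupling with the two tautening maps
`(x, y) ↦ x` and `(x, y) ↦ x y` (`ConjProd.measure_singleton_one_ne_zero`). Second, tautness
concerns couplings on standard Borel spaces, while `Ω ×_H Ω*` is an abstract orbit space. A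
standard Borel `G × G`-space that represents it is found among the continuous functions on `G × G`,
by smoothing the orbit maps (`exists_equivariant_model`, `IsCoupling.exists_composition_model`).
Its cocycle is `(g, (y, x)) ↦ β (α (g, x), y)`, and it is `L^p`-integrable because the `L^p`-norm
of `β (h, ·)` grows at most linearly in the word norm of `h` (`exists_le_mul_wordNorm`).
-/

open Topology

set_option linter.unusedSectionVars false

/-! ### Unimodular groups -/

section Unimodular

variable {G : Type*} [Group G] [TopologicalSpace G] [LocallyCompactSpace G]

/-- There is a measurable function of Haar integral one. -/
theorem exists_measurable_lintegral_eq_one [MeasurableSpace G] [BorelSpace G] (μ : Measure G)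
    [μ.IsHaarMeasure] : ∃ κ : G → ℝ≥0∞, Measurable κ ∧ ∫⁻ g, κ g ∂μ = 1 := by
  obtain ⟨K⟩ : Nonempty (TopologicalSpace.PositiveCompacts G) := inferInstance
  have h0 : μ (interior K) ≠ 0 :=
    (isOpen_interior.measure_pos μ K.interior_nonempty).ne'
  have ht : μ (interior K) ≠ ∞ :=
    ((measure_mono interior_subset).trans_lt K.isCompact.measure_lt_top).ne
  refine ⟨(interior (K : Set G)).indicator fun _ => (μ (interior K))⁻¹,
    measurable_const.indicator isOpen_interior.measurableSet, ?_⟩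
  rw [lintegral_indicator_const isOpen_interior.measurableSet, ENNReal.inv_mul_cancel h0 ht]

variable [IsTopologicalGroup G] [SecondCountableTopology G]

/-- A measurable homomorphism from a locally compact group to a second countable group is
continuous: countably many translates of a small neighbourhood cover the target, so one of their
preimages has positive measure, and its difference set is a neighbourhood of the identity. -/
theorem MonoidHom.continuous_of_measurable_of_secondCountable [MeasurableSpace G] [BorelSpace G]
    {P : Type*} [Group P] [TopologicalSpace P] [IsTopologicalGroup P] [SecondCountableTopology P]
    [MeasurableSpace P] [BorelSpace P] (f : G →* P) (hf : Measurable f) : Continuous f := by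
  refine continuous_of_continuousAt_one f ?_
  rw [ContinuousAt, map_one]
  intro V hV
  obtain ⟨V', hV'o, hV'1, hV'V⟩ := exists_open_nhds_one_mul_subset hV
  let μ : Measure G := Measure.haar
  let N : Set P := V' ∩ V'⁻¹
  have hNo : IsOpen N := hV'o.inter hV'o.inv
  have hN1 : (1 : P) ∈ N := ⟨hV'1, by simpa using hV'1⟩
  obtain ⟨s, hs, hcov⟩ := TopologicalSpace.countable_cover_nhds (f := fun p : P => (· * p⁻¹) ⁻¹' N)
    fun p => (hNo.preimage (continuous_mul_const p⁻¹)).mem_nhds (by simpa using hN1)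
  obtain ⟨p, hp⟩ : ∃ p, 0 < μ (f ⁻¹' ((· * p⁻¹) ⁻¹' N)) := by
    by_contra! h
    have h0 : μ (⋃ p ∈ s, f ⁻¹' ((· * p⁻¹) ⁻¹' N)) = 0 :=
      (measure_biUnion_null_iff hs).2 fun p _ => nonpos_iff_eq_zero.1 (h p)
    rw [← Set.preimage_iUnion₂, hcov, Set.preimage_univ] at h0
    exact (NeZero.ne μ) (Measure.measure_univ_eq_zero.1 h0)
  have hE : MeasurableSet (f ⁻¹' ((· * p⁻¹) ⁻¹' N)) :=
    hf (hNo.preimage (continuous_mul_const p⁻¹)).measurableSet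
  refine Filter.mem_map.2
    (Filter.mem_of_superset (Measure.div_mem_nhds_one_of_haar_pos μ _ hE hp) ?_)
  rintro _ ⟨g, hg, k, hk, rfl⟩
  refine hV'V ⟨f g * p⁻¹, hg.1, (f k * p⁻¹)⁻¹, hk.2, ?_⟩
  simp [div_eq_mul_inv]

/-- A bi-invariant Haar measure is invariant under inversion: `μ.inv` is a multiple `c • μ` of `μ`
by uniqueness, and `c ^ 2 = 1`. -/
theorem isInvInvariant_of_isMulRightInvariant [MeasurableSpace G] [BorelSpace G] (μ : Measure G)
    [μ.IsHaarMeasure] [μ.IsMulRightInvariant] : μ.IsInvInvariant := by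
  constructor
  have : IsFiniteMeasureOnCompacts μ.inv := by
    constructor
    intro K hK
    rw [Measure.inv_apply]
    exact hK.inv.measure_lt_top
  have hc : μ.inv = μ.inv.haarScalarFactor μ • μ := Measure.isMulLeftInvariant_eq_smul μ.inv μ
  set c := μ.inv.haarScalarFactor μ
  have h2 : μ = (c * c) • μ := by
    have h : (μ.inv).inv = μ := by
      rw [Measure.inv_def, Measure.inv_def, Measure.map_map measurable_inv measurable_inv]
      simp
    conv_lhs => rw [← h]
    rw [hc, Measure.inv_def, Measure.map_smul, ← Measure.inv_def, hc, smul_smul]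
  obtain ⟨K⟩ : Nonempty (TopologicalSpace.PositiveCompacts G) := inferInstance
  have h0 : μ K ≠ 0 := (Measure.measure_pos_of_nonempty_interior μ K.interior_nonempty).ne'
  have ht : μ K ≠ ∞ := K.isCompact.measure_lt_top.ne
  have h3 : μ K = ((c * c : NNReal) : ℝ≥0∞) * μ K := by
    conv_lhs => rw [h2]
    rfl
  have h4 : ((c * c : NNReal) : ℝ≥0∞) = 1 := by
    refine (ENNReal.mul_left_inj h0 ht).1 ?_
    rw [← h3, one_mul]
  have h5 : c * c = 1 := by exact_mod_cast h4
  have h6 : c = 1 := by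
    rcases mul_self_eq_one_iff.1 (show (c : ℝ) * c = 1 by exact_mod_cast h5) with h | h
    · exact_mod_cast h
    · have := c.2
      rw [show c.1 = (c : ℝ) from rfl, h] at this
      norm_num at this
  rw [hc, h6, one_smul]

/-- A locally compact second countable Hausdorff group is Polish: its right uniform structure is
countably generated and complete. -/
theorem polishSpace_of_locallyCompact [T2Space G] : PolishSpace G := by
  let := IsTopologicalGroup.rightUniformSpace G
  have : IsRightUniformGroup G := ⟨rfl⟩
  have : (uniformity G).IsCountablyGenerated := by
    rw [IsRightUniformGroup.uniformity_eq]
    exact Filter.comap.isCountablyGenerated _ _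
  have : CompleteSpace G := IsRightUniformGroup.completeSpace_of_weaklyLocallyCompactSpace
  infer_instance

end Unimodular

/-! ### Making almost equivariant maps equivariant -/

/-- The almost sure value of a function of two variables that is almost surely constant in the
second one depends measurably on the first one, and the set where it exists is measurable. -/
theorem exists_measurable_ae_eq_const {V T E : Type*} [MeasurableSpace V] [MeasurableSpace T]
    [MeasurableSpace E] [StandardBorelSpace E] [Nonempty E] (μ : Measure T) [SFinite μ]
    (hμ : μ ≠ 0) {F : V × T → E} (hF : Measurable F) :
    ∃ (c : V → E) (D : Set V), Measurable c ∧ MeasurableSet D ∧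
      (∀ v ∈ D, ∀ᵐ t ∂μ, F (v, t) = c v) ∧
      ∀ v x, (∀ᵐ t ∂μ, F (v, t) = x) → v ∈ D ∧ c v = x := by
  have : NeZero μ := ⟨hμ⟩
  let e : E → ℝ := fun x => Real.arctan (embeddingReal E x)
  have hem : Measurable e := Real.measurable_arctan.comp (measurableEmbedding_embeddingReal E).measurable
  have he : MeasurableEmbedding e := hem.measurableEmbedding
    (Real.arctan_injective.comp (measurableEmbedding_embeddingReal E).injective)
  obtain ⟨g, hg, hge⟩ := he.exists_measurable_extend (g := id) measurable_id (fun _ => inferInstance)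
  have hge' : ∀ x, g (e x) = x := fun x => congrFun hge x
  let I : V → ℝ := fun v => ∫ t, e (F (v, t)) ∂μ.toFinite
  have hI : Measurable I :=
    ((hem.comp hF).stronglyMeasurable.integral_prod_right').measurable
  let B : Set (V × T) := {p | e (F p) ≠ I p.1}
  have hB : MeasurableSet B :=
    (measurableSet_eq_fun (hem.comp hF) (hI.comp measurable_fst)).compl
  refine ⟨fun v => g (I v), {v | μ (Prod.mk v ⁻¹' B) = 0}, hg.comp hI,
    measurable_measure_prodMk_left hB (measurableSet_singleton 0), ?_, ?_⟩
  · intro v hv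
    have hv' : ∀ᵐ t ∂μ, e (F (v, t)) = I v := by
      rw [ae_iff]
      exact hv
    filter_upwards [hv'] with t ht
    rw [← ht, hge']
  · intro v x hx
    have hx' : ∀ᵐ t ∂μ, e (F (v, t)) = e x := hx.mono fun t ht => by rw [ht]
    have hIv : I v = e x := by
      have : ∀ᵐ t ∂μ.toFinite, e (F (v, t)) = e x := by
        rwa [ae_toFinite]
      simp only [I]
      rw [integral_congr_ae this]
      simp
    refine ⟨?_, by simp only [hIv, hge']⟩
    change μ (Prod.mk v ⁻¹' B) = 0
    have := ae_iff.1 hx'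
    rw [← hIv] at this
    exact this

/-- `act` is a measurable action of the group `K` on `W`. Actions are unbundled here because the
same space is acted upon by several groups and by several factors of a product. -/
structure IsMeasurableAction {K W : Type*} [Group K] [MeasurableSpace K] [MeasurableSpace W]
    (act : K → W → W) : Prop where
  one : ∀ w, act 1 w = w
  mul : ∀ k l w, act (k * l) w = act k (act l w)
  measurable : Measurable fun p : K × W => act p.1 p.2

namespace IsMeasurableAction

variable {K W : Type*} [Group K] [MeasurableSpace K] [MeasurableSpace W] {act : K → W → W}

theorem inv_act (h : IsMeasurableAction act) (k : K) (w : W) : act k⁻¹ (act k w) = w := by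
  rw [← h.mul, inv_mul_cancel, h.one]

theorem act_inv (h : IsMeasurableAction act) (k : K) (w : W) : act k (act k⁻¹ w) = w := by
  rw [← h.mul, mul_inv_cancel, h.one]

theorem measurable_act (h : IsMeasurableAction act) (k : K) : Measurable (act k) :=
  h.measurable.comp (measurable_const.prodMk measurable_id)

end IsMeasurableAction

/-- A map which, for each group element, is equivariant almost everywhere agrees almost everywhere
with a map which is equivariant for all group elements on an invariant conull set, and constant
off that set. -/
theorem exists_equivariant_of_ae_equivariant {L W E : Type*} [Group L] [MeasurableSpace L]
    [MeasurableMul₂ L] [MeasurableInv L] [MeasurableSpace W] [MeasurableSpace E]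
    [StandardBorelSpace E] (mL : Measure L) [SFinite mL] [mL.IsMulRightInvariant] (hmL : mL ≠ 0)
    {act : L → W → W} (hact : IsMeasurableAction act) {U : L → E → E} (hU : IsMeasurableAction U)
    (m : Measure W) [SFinite m] {F : W → E} (hF : Measurable F)
    (hFe : ∀ l, ∀ᵐ w ∂m, F (act l w) = U l (F w)) (e₀ : E) :
    ∃ (F' : W → E) (D : Set W), Measurable F' ∧ MeasurableSet D ∧ (∀ᵐ w ∂m, w ∈ D) ∧
      (∀ l w, act l w ∈ D ↔ w ∈ D) ∧ (∀ w ∈ D, ∀ l, F' (act l w) = U l (F' w)) ∧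
      (∀ w, w ∉ D → F' w = e₀) ∧ ∀ᵐ w ∂m, F' w = F w := by
  classical
  have : Nonempty E := ⟨e₀⟩
  have hFact : Measurable fun p : W × L => F (act p.2 p.1) :=
    hF.comp (hact.measurable.comp measurable_swap)
  have hmeas : Measurable fun p : W × L => U p.2⁻¹ (F (act p.2 p.1)) :=
    hU.measurable.comp ((measurable_inv.comp measurable_snd).prodMk hFact)
  obtain ⟨c, D, hc, hD, hDc, hcD⟩ := exists_measurable_ae_eq_const mL hmL hmeas
  simp only at hDc hcD
  have key : ∀ w ∈ D, ∀ l, act l w ∈ D ∧ c (act l w) = U l (c w) := by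
    intro w hw l
    refine hcD _ _ ?_
    have h1 := (measurePreserving_mul_right mL l).quasiMeasurePreserving.ae (hDc w hw)
    filter_upwards [h1] with k hk
    rw [← hact.mul, ← hk, ← hU.mul]
    congr 1
    group
  have hcon : ∀ᵐ w ∂m, w ∈ D ∧ c w = F w := by
    have h1 : ∀ᵐ p ∂(m.prod mL), U p.2⁻¹ (F (act p.2 p.1)) = F p.1 := by
      have hms : MeasurableSet {p : W × L | U p.2⁻¹ (F (act p.2 p.1)) = F p.1} :=
        measurableSet_eq_fun hmeas (hF.comp measurable_fst)
      have h2 : ∀ᵐ q ∂(mL.prod m), U q.1⁻¹ (F (act q.1 q.2)) = F q.2 := by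
        refine (Measure.ae_prod_iff_ae_ae (measurable_swap hms)).2 ?_
        refine Filter.Eventually.of_forall fun l => ?_
        filter_upwards [hFe l] with w hw
        change U l⁻¹ (F (act l w)) = F w
        rw [hw, hU.inv_act]
      exact (Measure.measurePreserving_swap (μ := m) (ν := mL)).quasiMeasurePreserving.ae h2
    filter_upwards [Measure.ae_ae_of_ae_prod h1] with w hw
    exact hcD w _ hw
  refine ⟨fun w => if w ∈ D then c w else e₀, D, Measurable.ite hD hc measurable_const, hD,
    hcon.mono fun w hw => hw.1, ?_, ?_, ?_, ?_⟩
  · refine fun l w => ⟨fun h => ?_, fun h => (key w h l).1⟩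
    have := (key _ h l⁻¹).1
    rwa [hact.inv_act] at this
  · intro w hw l
    simp only [(key w hw l).1, hw, if_true, (key w hw l).2]
  · intro w hw
    simp [hw]
  · filter_upwards [hcon] with w hw
    simp [hw.1, hw.2]

/-! ### Weights -/

/-- A weight for an action of `K` on `(W, m)`: a nonnegative function whose integral over almost
every orbit is one. It plays the role of a fundamental domain. -/
structure IsWeight {K W : Type*} [MeasurableSpace K] [MeasurableSpace W] (act : K → W → W)
    (mK : Measure K) (m : Measure W) (w : W → ℝ≥0∞) : Prop where
  measurable : Measurable w
  lintegral_eq_one : ∀ᵐ x ∂m, ∫⁻ k, w (act k x) ∂mK = 1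

section Weights

variable {K W : Type*} [Group K] [MeasurableSpace K] [MeasurableInv K] [MeasurableSpace W]
  {act : K → W → W} {mK : Measure K} [SFinite mK] {m : Measure W} [SFinite m]

/-- Unfolding of an integral along the orbits. -/
theorem lintegral_eq_lintegral_weight (hact : IsMeasurableAction act)
    (hinv : ∀ k, MeasurePreserving (act k) m m) {v : W → ℝ≥0∞} (hv : IsWeight act mK m v)
    {F : W → ℝ≥0∞} (hF : Measurable F) :
    ∫⁻ x, F x ∂m = ∫⁻ x, v x * ∫⁻ k, F (act k⁻¹ x) ∂mK ∂m := by
  have hm2 : Measurable fun p : K × W => F (act p.1⁻¹ p.2) :=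
    hF.comp (hact.measurable.comp ((measurable_inv.comp measurable_fst).prodMk measurable_snd))
  have hm1 : Measurable fun p : W × K => v (act p.2 p.1) :=
    hv.measurable.comp (hact.measurable.comp measurable_swap)
  calc ∫⁻ x, F x ∂m = ∫⁻ x, F x * ∫⁻ k, v (act k x) ∂mK ∂m := by
        refine lintegral_congr_ae ?_
        filter_upwards [hv.lintegral_eq_one] with x hx
        rw [hx, mul_one]
    _ = ∫⁻ x, ∫⁻ k, F x * v (act k x) ∂mK ∂m := by
        refine lintegral_congr fun x => ?_
        rw [lintegral_const_mul]
        exact hm1.comp measurable_prodMk_left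
    _ = ∫⁻ k, ∫⁻ x, F x * v (act k x) ∂m ∂mK := by
        rw [lintegral_lintegral_swap]
        exact ((hF.comp measurable_fst).mul hm1).aemeasurable
    _ = ∫⁻ k, ∫⁻ x, v x * F (act k⁻¹ x) ∂m ∂mK := by
        refine lintegral_congr fun k => ?_
        rw [← (hinv k).lintegral_comp (f := fun x => v x * F (act k⁻¹ x))
          (hv.measurable.mul (hm2.comp measurable_prodMk_left))]
        refine lintegral_congr fun x => ?_
        rw [hact.inv_act, mul_comm]
    _ = ∫⁻ x, ∫⁻ k, v x * F (act k⁻¹ x) ∂mK ∂m := by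
        rw [lintegral_lintegral_swap]
        exact ((hv.measurable.comp measurable_snd).mul hm2).aemeasurable
    _ = ∫⁻ x, v x * ∫⁻ k, F (act k⁻¹ x) ∂mK ∂m := by
        refine lintegral_congr fun x => ?_
        rw [lintegral_const_mul]
        exact hm2.comp measurable_prodMk_right

/-- The integral of an invariant function does not depend on the weight. -/
theorem IsWeight.lintegral_mul_eq [mK.IsInvInvariant] (hact : IsMeasurableAction act)
    (hinv : ∀ k, MeasurePreserving (act k) m m) {v w : W → ℝ≥0∞} (hv : IsWeight act mK m v)
    (hw : IsWeight act mK m w) {F : W → ℝ≥0∞} (hF : Measurable F)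
    (hFinv : ∀ k, ∀ᵐ x ∂m, F (act k x) = F x) :
    ∫⁻ x, F x * w x ∂m = ∫⁻ x, F x * v x ∂m := by
  rw [lintegral_eq_lintegral_weight hact hinv hv (F := fun x => F x * w x) (hF.mul hw.measurable)]
  have hFact : Measurable fun p : K × W => F (act p.1⁻¹ p.2) :=
    hF.comp (hact.measurable.comp ((measurable_inv.comp measurable_fst).prodMk measurable_snd))
  have h1 : ∀ᵐ x ∂m, ∀ᵐ k ∂mK, F (act k⁻¹ x) = F x := by
    have hms : MeasurableSet {p : K × W | F (act p.1⁻¹ p.2) = F p.2} :=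
      measurableSet_eq_fun hFact (hF.comp measurable_snd)
    have : ∀ᵐ p ∂(mK.prod m), F (act p.1⁻¹ p.2) = F p.2 :=
      (Measure.ae_prod_iff_ae_ae hms).2 (Filter.Eventually.of_forall fun k => hFinv k⁻¹)
    exact Measure.ae_ae_of_ae_prod
      ((Measure.measurePreserving_swap (μ := m) (ν := mK)).quasiMeasurePreserving.ae this)
  refine lintegral_congr_ae ?_
  filter_upwards [h1, hw.lintegral_eq_one] with x hx hwx
  have h2 : ∫⁻ k, F (act k⁻¹ x) * w (act k⁻¹ x) ∂mK = ∫⁻ k, F x * w (act k⁻¹ x) ∂mK := by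
    refine lintegral_congr_ae ?_
    filter_upwards [hx] with k hk
    rw [hk]
  rw [h2, lintegral_const_mul, lintegral_inv_eq_self (fun k => w (act k x)), hwx, mul_one, mul_comm]
  exact hw.measurable.comp (hact.measurable.comp (measurable_inv.prodMk measurable_const))

/-- An invariant function whose integral against a weight vanishes is null. -/
theorem IsWeight.lintegral_eq_zero (hact : IsMeasurableAction act)
    (hinv : ∀ k, MeasurePreserving (act k) m m) {v : W → ℝ≥0∞} (hv : IsWeight act mK m v)
    {F : W → ℝ≥0∞} (hF : Measurable F) (hFinv : ∀ k, ∀ᵐ x ∂m, F (act k x) = F x)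
    (h0 : ∫⁻ x, F x * v x ∂m = 0) : ∫⁻ x, F x ∂m = 0 := by
  have hm2 : Measurable fun p : K × W => F (act p.1⁻¹ p.2) :=
    hF.comp (hact.measurable.comp ((measurable_inv.comp measurable_fst).prodMk measurable_snd))
  rw [lintegral_eq_lintegral_weight hact hinv hv hF]
  have : ∀ x, v x * ∫⁻ k, F (act k⁻¹ x) ∂mK = ∫⁻ k, v x * F (act k⁻¹ x) ∂mK := fun x => by
    rw [lintegral_const_mul]
    exact hm2.comp measurable_prodMk_right
  simp only [this]
  rw [lintegral_lintegral_swap]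
  · rw [lintegral_eq_zero_iff']
    · refine Filter.Eventually.of_forall fun k => ?_
      change ∫⁻ x, v x * F (act k⁻¹ x) ∂m = 0
      rw [← h0]
      refine lintegral_congr_ae ?_
      filter_upwards [hFinv k⁻¹] with x hx
      rw [hx, mul_comm]
    · exact (((hv.measurable.comp measurable_snd).mul hm2).lintegral_prod_right').aemeasurable
  · exact ((hv.measurable.comp measurable_fst).mul (hm2.comp measurable_swap)).aemeasurable

/-- A map `Ξ` into a strongly ICC group which is invariant under an action with a weight of finite
total mass, and is moved by conjugations under commuting transformations, is trivial: the image of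
the weight measure is a finite conjugation invariant measure, hence carried by the identity. -/
theorem ae_eq_one_of_isStronglyICCRelative [mK.IsInvInvariant] {P : Type*} [Group P]
    [MeasurableSpace P] [MeasurableMul P] [MeasurableSingletonClass P] {P₀ : Subgroup P}
    (hICC : IsStronglyICCRelative P₀) (hact : IsMeasurableAction act)
    (hinv : ∀ k, MeasurePreserving (act k) m m) {v : W → ℝ≥0∞} (hv : IsWeight act mK m v)
    (hvfin : ∫⁻ x, v x ∂m ≠ ∞) {Ξ : W → P} (hΞ : Measurable Ξ)
    (hΞinv : ∀ k, ∀ᵐ x ∂m, Ξ (act k x) = Ξ x)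
    (hconj : ∀ p ∈ P₀, ∃ S : W → W, MeasurePreserving S m m ∧
      (∀ k x, S (act k x) = act k (S x)) ∧ ∀ᵐ x ∂m, Ξ (S x) = p * Ξ x * p⁻¹) :
    ∀ᵐ x ∂m, Ξ x = 1 := by
  let τ : Measure P := (m.withDensity v).map Ξ
  have hτ : ∀ E, MeasurableSet E → τ E = ∫⁻ x, E.indicator 1 (Ξ x) * v x ∂m := by
    intro E hE
    rw [Measure.map_apply hΞ hE, withDensity_apply _ (hΞ hE), ← lintegral_indicator (hΞ hE)]
    refine lintegral_congr fun x => ?_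
    by_cases hx : Ξ x ∈ E
    · simp [hx]
    · simp [hx]
  have hτfin : IsFiniteMeasure τ := by
    have : IsFiniteMeasure (m.withDensity v) := isFiniteMeasure_withDensity hvfin
    infer_instance
  have hcm : ∀ p : P, Measurable fun x : P => p * x * p⁻¹ := fun p =>
    (measurable_mul_const p⁻¹).comp (measurable_const_mul p)
  have hτinv : ∀ p ∈ P₀, τ.map (fun x => p * x * p⁻¹) = τ := by
    intro p hp
    obtain ⟨S, hS, hScomm, hSΞ⟩ := hconj p hp
    ext E hE
    rw [Measure.map_apply (hcm p) hE, hτ _ (hcm p hE), hτ _ hE]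
    have hEm : Measurable fun x => E.indicator (1 : P → ℝ≥0∞) (Ξ x) :=
      (measurable_one.indicator hE).comp hΞ
    have e1 : ∫⁻ x, ((fun x => p * x * p⁻¹) ⁻¹' E).indicator 1 (Ξ x) * v x ∂m =
        ∫⁻ x, E.indicator 1 (Ξ (S x)) * v x ∂m := by
      refine lintegral_congr_ae ?_
      filter_upwards [hSΞ] with x hx
      rw [hx]
      rfl
    rw [e1, ← hS.lintegral_comp (f := fun x => E.indicator 1 (Ξ x) * v x) (hEm.mul hv.measurable)]
    have hvS : IsWeight act mK m fun x => v (S x) := by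
      refine ⟨hv.measurable.comp hS.measurable, ?_⟩
      filter_upwards [hS.quasiMeasurePreserving.ae hv.lintegral_eq_one] with x hx
      simpa only [hScomm] using hx
    refine hvS.lintegral_mul_eq hact hinv hv (hEm.comp hS.measurable) fun k => ?_
    filter_upwards [hS.quasiMeasurePreserving.ae (hΞinv k)] with x hx
    simp only [hScomm, hx]
  have h1 : τ {1}ᶜ = 0 := by
    by_contra hne
    refine hICC ⟨(τ {1}ᶜ)⁻¹ • τ.restrict {1}ᶜ, ⟨?_⟩, ?_, fun p hp => ?_⟩
    · simp [ENNReal.inv_mul_cancel hne (measure_ne_top τ _)]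
    · simp [Measure.restrict_apply (measurableSet_singleton (1 : P))]
    · rw [Measure.map_smul]
      congr 1
      have : ({1}ᶜ : Set P) = (fun x => p * x * p⁻¹) ⁻¹' {1}ᶜ := by
        ext x
        simp [mul_inv_eq_one]
      conv_lhs => rw [this]
      rw [← Measure.restrict_map (hcm p) (measurableSet_singleton (1 : P)).compl, hτinv p hp]
  rw [hτ _ (measurableSet_singleton (1 : P)).compl] at h1
  have h2 := hv.lintegral_eq_zero hact hinv
    ((measurable_one.indicator (measurableSet_singleton (1 : P)).compl).comp hΞ)
    (fun k => (hΞinv k).mono fun x hx => by simp only [Function.comp, hx]) h1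
  rw [lintegral_eq_zero_iff
    ((measurable_one.indicator (measurableSet_singleton (1 : P)).compl).comp hΞ)] at h2
  filter_upwards [h2] with x hx
  by_contra hne
  simp [hne] at hx

end Weights

/-! ### Fundamental isomorphisms -/

section Fundamental

variable {K W : Type*} [Group K] [MeasurableSpace K] [MeasurableSpace W]
  {act : K → W → W} {mK : Measure K} {m : Measure W} [SFinite m]

theorem IsMeasurableAction.quasiMeasurePreserving_uncurry (hact : IsMeasurableAction act)
    (hinv : ∀ k, MeasurePreserving (act k) m m) :
    Measure.QuasiMeasurePreserving (fun p : K × W => act p.1 p.2) (mK.prod m) m := by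
  refine ⟨hact.measurable, Measure.AbsolutelyContinuous.mk fun s hs h0 => ?_⟩
  rw [Measure.map_apply hact.measurable hs, Measure.prod_apply (hact.measurable hs)]
  refine (lintegral_congr fun k => ?_).trans lintegral_zero
  exact ((hinv k).measure_preimage hs.nullMeasurableSet).trans h0

theorem IsMeasurableAction.ae_ae_act [SFinite mK] (hact : IsMeasurableAction act)
    (hinv : ∀ k, MeasurePreserving (act k) m m) {p : W → Prop} (hp : ∀ᵐ x ∂m, p x) :
    ∀ᵐ x ∂m, ∀ᵐ k ∂mK, p (act k x) := by
  have h := (hact.quasiMeasurePreserving_uncurry (mK := mK) hinv).ae hp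
  exact Measure.ae_ae_of_ae_prod
    ((Measure.measurePreserving_swap (μ := m) (ν := mK)).quasiMeasurePreserving.ae h)

end Fundamental

namespace IsFundamentalIso

variable {K Y Z : Type u} [Group K] [MeasurableSpace K] [MeasurableSpace Y] [MeasurableSpace Z]
  {act : K → Z → Z} {mK : Measure K} {ν : Measure Y} {m : Measure Z}
  {i : K × Y → Z} {i' : Z → K × Y}

theorem measurePreserving_inv (hi : IsFundamentalIso act mK ν m i i') :
    MeasurePreserving i' m (mK.prod ν) := by
  refine ⟨hi.measurable_inv, ?_⟩
  rw [← hi.measurePreserving.map_eq,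
    Measure.map_map hi.measurable_inv hi.measurePreserving.measurable,
    Measure.map_congr (f := i' ∘ i) (g := id) hi.left_inv, Measure.map_id]

theorem congr (hi : IsFundamentalIso act mK ν m i i') {i₂ : K × Y → Z} (hi₂ : Measurable i₂)
    (h : ∀ᵐ p ∂(mK.prod ν), i₂ p = i p)
    (he : ∀ k : K, ∀ᵐ p ∂(mK.prod ν), i₂ (k * p.1, p.2) = act k (i₂ p)) :
    IsFundamentalIso act mK ν m i₂ i' where
  measurePreserving := ⟨hi₂, by rw [Measure.map_congr h, hi.measurePreserving.map_eq]⟩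
  measurable_inv := hi.measurable_inv
  left_inv := by
    filter_upwards [h, hi.left_inv] with p hp hp'
    rw [hp, hp']
  right_inv := by
    filter_upwards [hi.measurePreserving_inv.quasiMeasurePreserving.ae h, hi.right_inv]
      with z hz hz'
    rw [hz, hz']
  equivariant := he

variable [MeasurableMul K] [SFinite mK] [SFinite ν]

/-- The inverse of a fundamental isomorphism is almost everywhere equivariant. -/
theorem ae_inv_act [mK.IsMulLeftInvariant] (hi : IsFundamentalIso act mK ν m i i') (k : K) :
    ∀ᵐ z ∂m, i' (act k z) = (k * (i' z).1, (i' z).2) := by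
  have h1 := ((measurePreserving_mul_left mK k).prod (MeasurePreserving.id ν)).quasiMeasurePreserving.ae
    hi.left_inv
  have h2 := hi.equivariant k
  filter_upwards [hi.measurePreserving_inv.quasiMeasurePreserving.ae (h1.and h2), hi.right_inv]
    with z hz hz'
  rw [hz'] at hz
  rw [← hz.2]
  exact hz.1

theorem lintegral_weight (hi : IsFundamentalIso act mK ν m i i') {κ : K → ℝ≥0∞}
    (hκ : Measurable κ) (hκ1 : ∫⁻ k, κ k ∂mK = 1) {F : Y → ℝ≥0∞} (hF : Measurable F) :
    ∫⁻ z, F (i' z).2 * κ (i' z).1 ∂m = ∫⁻ y, F y ∂ν := by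
  rw [hi.measurePreserving_inv.lintegral_comp (f := fun p : K × Y => F p.2 * κ p.1)
    ((hF.comp measurable_snd).mul (hκ.comp measurable_fst)),
    lintegral_prod_symm' (fun p : K × Y => F p.2 * κ p.1)
      ((hF.comp measurable_snd).mul (hκ.comp measurable_fst))]
  refine lintegral_congr fun y => ?_
  simp only
  rw [lintegral_const_mul _ hκ, hκ1, mul_one]

theorem isWeight [mK.IsMulLeftInvariant] [mK.IsMulRightInvariant] [SFinite m]
    [MeasurableMul₂ K] [StandardBorelSpace K] (hi : IsFundamentalIso act mK ν m i i')
    (hact : IsMeasurableAction act) {κ : K → ℝ≥0∞}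
    (hκ : Measurable κ) (hκ1 : ∫⁻ k, κ k ∂mK = 1) :
    IsWeight act mK m fun z => κ (i' z).1 := by
  refine ⟨hκ.comp (measurable_fst.comp hi.measurable_inv), ?_⟩
  have hms : MeasurableSet {p : K × Z | (i' (act p.1 p.2)).1 = p.1 * (i' p.2).1} :=
    measurableSet_eq_fun (measurable_fst.comp (hi.measurable_inv.comp hact.measurable))
      (measurable_fst.mul (measurable_fst.comp (hi.measurable_inv.comp measurable_snd)))
  have h1 : ∀ᵐ p ∂(mK.prod m), (i' (act p.1 p.2)).1 = p.1 * (i' p.2).1 :=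
    (Measure.ae_prod_iff_ae_ae hms).2 (Filter.Eventually.of_forall fun k => by
      filter_upwards [hi.ae_inv_act k] with z hz
      rw [hz])
  have h2 := Measure.ae_ae_of_ae_prod
    ((Measure.measurePreserving_swap (μ := m) (ν := mK)).quasiMeasurePreserving.ae h1)
  filter_upwards [h2] with z hz
  have : ∫⁻ k, κ (i' (act k z)).1 ∂mK = ∫⁻ k, κ (k * (i' z).1) ∂mK := by
    refine lintegral_congr_ae ?_
    filter_upwards [hz] with k hk
    exact congrArg κ hk
  rw [this, lintegral_mul_right_eq_self κ, hκ1]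

/-- A fundamental isomorphism can be normalised to be of the form `(k, y) ↦ k • t(y)`. -/
theorem exists_section (hi : IsFundamentalIso act mK ν m i i') [mK.IsMulRightInvariant]
    [MeasurableMul₂ K] [StandardBorelSpace Z] (hact : IsMeasurableAction act)
    (hmK : mK ≠ 0) : ∃ t : Y → Z, Measurable t ∧
      (∀ᵐ p ∂(mK.prod ν), act p.1 (t p.2) = i p) ∧
      IsFundamentalIso act mK ν m (fun p => act p.1 (t p.2)) i' := by
  have : NeZero mK := ⟨hmK⟩
  have him := hi.measurePreserving.measurable
  let Q : Set ((K × K) × Y) := {q | i (q.1.1 * q.1.2, q.2) = act q.1.1 (i (q.1.2, q.2))}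
  have hQ : MeasurableSet Q := measurableSet_eq_fun
    (him.comp ((measurable_fst.fst.mul measurable_fst.snd).prodMk measurable_snd))
    (hact.measurable.comp (measurable_fst.fst.prodMk
      (him.comp (measurable_fst.snd.prodMk measurable_snd))))
  have h1 : ∀ᵐ k ∂mK, ∀ᵐ h ∂mK, ∀ᵐ y ∂ν, ((k, h), y) ∈ Q :=
    Filter.Eventually.of_forall fun k => Measure.ae_ae_of_ae_prod (hi.equivariant k)
  have h2 : ∀ᵐ h ∂mK, ∀ᵐ k ∂mK, ∀ᵐ y ∂ν, ((k, h), y) ∈ Q := by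
    refine (Measure.ae_ae_comm ?_).1 h1
    have : {x : K × K | ∀ᵐ y ∂ν, ((x.1, x.2), y) ∈ Q} = {x | ν (Prod.mk x ⁻¹' Qᶜ) = 0} := by
      ext x
      exact ae_iff
    rw [this]
    exact measurable_measure_prodMk_left hQ.compl (measurableSet_singleton 0)
  obtain ⟨h, hh⟩ := h2.exists
  have ht : Measurable fun y => act h⁻¹ (i (h, y)) :=
    (hact.measurable_act h⁻¹).comp (him.comp (measurable_const.prodMk measurable_id))
  have h3 : ∀ᵐ p ∂(mK.prod ν), ((p.1, h), p.2) ∈ Q :=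
    (Measure.ae_prod_iff_ae_ae (hQ.preimage
      ((measurable_fst.prodMk measurable_const).prodMk measurable_snd))).2 hh
  have h4 := ((measurePreserving_mul_right mK h⁻¹).prod
    (MeasurePreserving.id ν)).quasiMeasurePreserving.ae h3
  have h5 : ∀ᵐ p ∂(mK.prod ν), act p.1 (act h⁻¹ (i (h, p.2))) = i p := by
    filter_upwards [h4] with p hp
    simp only [Q, Prod.map, Set.mem_ofPred_eq, id, inv_mul_cancel_right] at hp
    rw [hp, hact.mul]
  refine ⟨_, ht, h5, hi.congr (hact.measurable.comp (measurable_fst.prodMk (ht.comp measurable_snd)))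
    h5 fun k => Filter.Eventually.of_forall fun p => ?_⟩
  simp only [hact.mul]

end IsFundamentalIso

/-! ### The two actions on a coupling -/

namespace IsCoupling

variable {G H Ω : Type u} [Group G] [Group H] [MeasurableSpace G] [MeasurableSpace H]
  [MeasurableSpace Ω] [MulAction (G × H) Ω] {mG : Measure G} {mH : Measure H} {m : Measure Ω}

theorem isMeasurableAction (hm : IsCoupling mG mH m) :
    IsMeasurableAction fun (a : G × H) (ω : Ω) => a • ω :=
  ⟨one_smul _, mul_smul, hm.measurable_action⟩

theorem isMeasurableAction_left (hm : IsCoupling mG mH m) :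
    IsMeasurableAction fun (g : G) (ω : Ω) => (g, (1 : H)) • ω where
  one := one_smul (G × H)
  mul g g' ω := by simp [smul_smul]
  measurable := hm.measurable_action.comp
    ((measurable_fst.prodMk measurable_const).prodMk measurable_snd)

theorem isMeasurableAction_right (hm : IsCoupling mG mH m) :
    IsMeasurableAction fun (h : H) (ω : Ω) => ((1 : G), h) • ω where
  one := one_smul (G × H)
  mul g g' ω := by simp [smul_smul]
  measurable := hm.measurable_action.comp
    ((measurable_const.prodMk measurable_fst).prodMk measurable_snd)

theorem nonempty (hm : IsCoupling mG mH m) : Nonempty Ω := by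
  by_contra hcon
  rw [not_nonempty_iff] at hcon
  exact hm.ne_zero (Measure.eq_zero_of_isEmpty m)

theorem measurePreserving_smul (hm : IsCoupling mG mH m) (a : G × H) :
    MeasurePreserving (fun ω : Ω => a • ω) m m :=
  ⟨hm.isMeasurableAction.measurable_act a, hm.invariant a⟩

end IsCoupling

/-- Data extracted from a coupling: weights of finite total mass for both actions, and an almost
everywhere equivariant map to the second group. -/
theorem IsCoupling.exists_weights {G H Ω : Type u}
    [Group G] [TopologicalSpace G] [IsTopologicalGroup G] [LocallyCompactSpace G]
    [SecondCountableTopology G] [T2Space G] [MeasurableSpace G] [BorelSpace G]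
    [Group H] [TopologicalSpace H] [IsTopologicalGroup H] [LocallyCompactSpace H]
    [SecondCountableTopology H] [T2Space H] [MeasurableSpace H] [BorelSpace H]
    [MeasurableSpace Ω] [MulAction (G × H) Ω]
    {mG : Measure G} [mG.IsHaarMeasure] [mG.IsMulRightInvariant]
    {mH : Measure H} [mH.IsHaarMeasure] [mH.IsMulRightInvariant] {m : Measure Ω}
    (hm : IsCoupling mG mH m) :
    (∃ a : Ω → ℝ≥0∞, IsWeight (fun (g : G) (ω : Ω) => (g, (1 : H)) • ω) mG m a ∧
      ∫⁻ ω, a ω ∂m ≠ ∞) ∧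
    ∃ (b : Ω → ℝ≥0∞) (f : Ω → H), IsWeight (fun (h : H) (ω : Ω) => ((1 : G), h) • ω) mH m b ∧
      ∫⁻ ω, b ω ∂m ≠ ∞ ∧ Measurable f ∧ ∀ h : H, ∀ᵐ ω ∂m, f (((1 : G), h) • ω) = h * f ω := by
  have := hm.sFinite
  have := polishSpace_of_locallyCompact (G := G)
  have := polishSpace_of_locallyCompact (G := H)
  obtain ⟨κG, hκG, hκG1⟩ := exists_measurable_lintegral_eq_one mG
  obtain ⟨κH, hκH, hκH1⟩ := exists_measurable_lintegral_eq_one mH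
  obtain ⟨Y, _, _, ν, i, i', hν, hi⟩ := hm.left
  obtain ⟨X, _, _, μ, j, j', hμ, hj⟩ := hm.right
  refine ⟨⟨_, hi.isWeight hm.isMeasurableAction_left hκG hκG1, ?_⟩, _, fun ω => (j' ω).1,
    hj.isWeight hm.isMeasurableAction_right hκH hκH1, ?_,
    measurable_fst.comp hj.measurable_inv, fun h => ?_⟩
  · have := hi.lintegral_weight hκG hκG1 (F := fun _ => 1) measurable_const
    simp only [one_mul] at this
    rw [this]
    simp
  · have := hj.lintegral_weight hκH hκH1 (F := fun _ => 1) measurable_const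
    simp only [one_mul] at this
    rw [this]
    simp
  · filter_upwards [hj.ae_inv_act h] with ω hω
    rw [hω]

/-! ### Kernels on a coupling with values in a strongly ICC group -/

section Kernels

variable {G H Ω P : Type u} [Group G] [Group H] [MeasurableSpace Ω] [MulAction (G × H) Ω]
  [Group P] [MeasurableSpace P]

/-- A measurable map on `Ω × Ω` which is almost everywhere equivariant under `G × G` (via `π`) and
invariant under the diagonal action of `H`: a tautening map of `Ω ×_H Ω*`, seen on `Ω × Ω`. -/
structure IsTauteningKernel (π : G →* P) (m : Measure Ω) (Φ : Ω × Ω → P) : Prop where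
  measurable : Measurable Φ
  equivariant : ∀ (g₁ g₂ : G) (h : H), ∀ᵐ w ∂(m.prod m),
    Φ ((g₁, h) • w.1, (g₂, h) • w.2) = π g₁ * Φ w * (π g₂)⁻¹

omit [MeasurableSpace Ω] in
theorem smul_left_mul_right (g : G) (h : H) (ω : Ω) :
    (g, h) • ω = (g, (1 : H)) • ((1 : G), h) • ω := by
  simp [smul_smul]

end Kernels


section Core

variable {G H Ω P : Type u}
  [Group G] [TopologicalSpace G] [IsTopologicalGroup G] [LocallyCompactSpace G]
  [SecondCountableTopology G] [T2Space G] [MeasurableSpace G] [BorelSpace G]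
  [Group H] [TopologicalSpace H] [IsTopologicalGroup H] [LocallyCompactSpace H]
  [SecondCountableTopology H] [T2Space H] [MeasurableSpace H] [BorelSpace H]
  [MeasurableSpace Ω] [MulAction (G × H) Ω]
  {mG : Measure G} [mG.IsHaarMeasure] [mG.IsMulRightInvariant]
  {mH : Measure H} [mH.IsHaarMeasure] [mH.IsMulRightInvariant] {m : Measure Ω}
  [Group P] [TopologicalSpace P] [IsTopologicalGroup P] [PolishSpace P]
  [MeasurableSpace P] [BorelSpace P]

/-- The product of a `G`-weight in the first variable and an `H`-weight in the second one is a
weight for the action of `G × H` on `Ω × Ω`, in which `H` acts diagonally. -/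
theorem IsCoupling.isWeight_prod (hm : IsCoupling mG mH m) {a b : Ω → ℝ≥0∞}
    (ha : IsWeight (fun (g : G) (ω : Ω) => (g, (1 : H)) • ω) mG m a)
    (hb : IsWeight (fun (h : H) (ω : Ω) => ((1 : G), h) • ω) mH m b) :
    IsWeight (fun (k : G × H) (w : Ω × Ω) => ((k.1, k.2) • w.1, ((1 : G), k.2) • w.2))
      (mG.prod mH) (m.prod m) fun w => a w.1 * b w.2 := by
  have := hm.sFinite
  refine ⟨(ha.measurable.comp measurable_fst).mul (hb.measurable.comp measurable_snd), ?_⟩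
  have h1 := hm.isMeasurableAction_right.ae_ae_act (mK := mH)
    (fun h => hm.measurePreserving_smul (1, h)) ha.lintegral_eq_one
  filter_upwards [Measure.quasiMeasurePreserving_fst.ae h1,
    Measure.quasiMeasurePreserving_snd.ae hb.lintegral_eq_one] with w hw1 hw2
  have hma : Measurable fun k : G × H => a ((k.1, k.2) • w.1) :=
    ha.measurable.comp (hm.measurable_action.comp (measurable_id.prodMk measurable_const))
  have hmb : Measurable fun h : H => b (((1 : G), h) • w.2) :=
    hb.measurable.comp (hm.isMeasurableAction_right.measurable.comp
      (measurable_id.prodMk measurable_const))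
  rw [lintegral_prod_symm' (fun k : G × H => a ((k.1, k.2) • w.1) * b (((1 : G), k.2) • w.2))
    (hma.mul (hmb.comp measurable_snd)), ← hw2]
  refine lintegral_congr_ae ?_
  filter_upwards [hw1] with h hh
  have hmh : Measurable fun g : G => a ((g, h) • w.1) := hma.comp measurable_prodMk_right
  rw [lintegral_mul_const _ hmh,
    lintegral_congr fun g => congrArg a (smul_left_mul_right g h w.1), hh, one_mul]

/-- Tautening kernels are unique when the target is strongly ICC. -/
theorem IsTauteningKernel.ae_eq (hm : IsCoupling mG mH m) {π : G →* P}
    (hICC : IsStronglyICCRelative π.range) {Φ Φ' : Ω × Ω → P}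
    (hΦ : IsTauteningKernel (H := H) π m Φ) (hΦ' : IsTauteningKernel (H := H) π m Φ') :
    ∀ᵐ w ∂(m.prod m), Φ w = Φ' w := by
  have := hm.sFinite
  have := isInvInvariant_of_isMulRightInvariant (mG.prod mH)
  obtain ⟨⟨a, ha, hafin⟩, b, f, hb, hbfin, -, -⟩ := hm.exists_weights
  let act : G × H → Ω × Ω → Ω × Ω := fun k w => ((k.1, k.2) • w.1, ((1 : G), k.2) • w.2)
  have hact : IsMeasurableAction act :=
    { one := fun w => Prod.ext (one_smul (G × H) w.1) (one_smul (G × H) w.2)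
      mul := fun k l w => by simp [act, smul_smul]
      measurable := (hm.measurable_action.comp (measurable_fst.prodMk measurable_snd.fst)).prodMk
        (hm.isMeasurableAction_right.measurable.comp
          (measurable_fst.snd.prodMk measurable_snd.snd)) }
  have hinv : ∀ k, MeasurePreserving (act k) (m.prod m) (m.prod m) := fun k =>
    (hm.measurePreserving_smul k).prod (hm.measurePreserving_smul (1, k.2))
  have hone := ae_eq_one_of_isStronglyICCRelative (mK := mG.prod mH) hICC hact hinv
    (hm.isWeight_prod ha hb) (Ξ := fun w => (Φ w)⁻¹ * Φ' w) ?_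
    (hΦ.measurable.inv.mul hΦ'.measurable)
    ?_ ?_
  · filter_upwards [hone] with w hw
    exact inv_mul_eq_one.1 hw
  · rw [lintegral_prod_mul ha.measurable.aemeasurable hb.measurable.aemeasurable]
    exact ENNReal.mul_ne_top hafin hbfin
  · intro k
    filter_upwards [hΦ.equivariant k.1 1 k.2, hΦ'.equivariant k.1 1 k.2] with w hw hw'
    simp only [act, hw, hw']
    simp [mul_assoc]
  · rintro _ ⟨g, rfl⟩
    refine ⟨fun w => (((1 : G), (1 : H)) • w.1, (g, (1 : H)) • w.2),
      (hm.measurePreserving_smul (1, 1)).prod (hm.measurePreserving_smul (g, 1)), ?_, ?_⟩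
    · intro k w
      obtain ⟨k₁, k₂⟩ := k
      simp only [act, smul_smul, Prod.mk_mul_mk, one_mul, mul_one]
    · filter_upwards [hΦ.equivariant 1 g 1, hΦ'.equivariant 1 g 1] with w hw hw'
      simp only [hw, hw']
      simp [mul_assoc]

/-- A tautening kernel with values in a strongly ICC group is a coboundary: the defect
`Φ(ω₁, ω₂)⁻¹ Φ(ω₁, ω₃) Φ(ω₂, ω₃)⁻¹` is invariant under `G` acting on `ω₁` or on `ω₃` and under the
diagonal action of `H`, while `G` acting on `ω₂` conjugates it. -/
theorem IsTauteningKernel.ae_cocycle (hm : IsCoupling mG mH m) {π : G →* P}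
    (hICC : IsStronglyICCRelative π.range) {Φ : Ω × Ω → P}
    (hΦ : IsTauteningKernel (H := H) π m Φ) :
    ∀ᵐ w ∂(m.prod (m.prod m)), Φ (w.1, w.2.1) = Φ (w.1, w.2.2) * (Φ (w.2.1, w.2.2))⁻¹ := by
  have := hm.sFinite
  have := isInvInvariant_of_isMulRightInvariant (mG.prod (mH.prod mG))
  obtain ⟨⟨a, ha, hafin⟩, b, f, hb, hbfin, -, -⟩ := hm.exists_weights
  let act : G × H × G → Ω × Ω × Ω → Ω × Ω × Ω := fun k w =>
    ((k.1, k.2.1) • w.1, ((1 : G), k.2.1) • w.2.1, (k.2.2, k.2.1) • w.2.2)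
  have hA := hm.measurable_action
  have hact : IsMeasurableAction act :=
    { one := fun w => Prod.ext (one_smul (G × H) w.1)
        (Prod.ext (one_smul (G × H) w.2.1) (one_smul (G × H) w.2.2))
      mul := fun k l w => by simp [act, smul_smul]
      measurable := (hA.comp ((measurable_fst.fst.prodMk measurable_fst.snd.fst).prodMk
        measurable_snd.fst)).prodMk
        ((hA.comp ((measurable_const.prodMk measurable_fst.snd.fst).prodMk
          measurable_snd.snd.fst)).prodMk
        (hA.comp ((measurable_fst.snd.snd.prodMk measurable_fst.snd.fst).prodMk
          measurable_snd.snd.snd))) }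
  have hinv : ∀ k, MeasurePreserving (act k) (m.prod (m.prod m)) (m.prod (m.prod m)) := fun k =>
    (hm.measurePreserving_smul _).prod
      ((hm.measurePreserving_smul _).prod (hm.measurePreserving_smul _))
  -- the three coordinate pairs
  have q12 : Measure.QuasiMeasurePreserving (fun w : Ω × Ω × Ω => (w.1, w.2.1))
      (m.prod (m.prod m)) (m.prod m) :=
    QuasiMeasurePreserving.prodMap (.id m) Measure.quasiMeasurePreserving_fst
  have q13 : Measure.QuasiMeasurePreserving (fun w : Ω × Ω × Ω => (w.1, w.2.2))
      (m.prod (m.prod m)) (m.prod m) :=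
    QuasiMeasurePreserving.prodMap (.id m) Measure.quasiMeasurePreserving_snd
  have q23 : Measure.QuasiMeasurePreserving (fun w : Ω × Ω × Ω => (w.2.1, w.2.2))
      (m.prod (m.prod m)) (m.prod m) := Measure.quasiMeasurePreserving_snd
  have hv : IsWeight act (mG.prod (mH.prod mG)) (m.prod (m.prod m))
      fun w => a w.1 * (b w.2.1 * a w.2.2) := by
    refine ⟨(ha.measurable.comp measurable_fst).mul ((hb.measurable.comp measurable_snd.fst).mul
      (ha.measurable.comp measurable_snd.snd)), ?_⟩
    have h1 := hm.isMeasurableAction_right.ae_ae_act (mK := mH)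
      (fun h => hm.measurePreserving_smul (1, h)) ha.lintegral_eq_one
    filter_upwards [Measure.quasiMeasurePreserving_fst.ae h1,
      (Measure.quasiMeasurePreserving_fst.comp Measure.quasiMeasurePreserving_snd).ae
        hb.lintegral_eq_one,
      (Measure.quasiMeasurePreserving_snd.comp Measure.quasiMeasurePreserving_snd).ae h1]
      with w hw1 hw2 hw3
    have hma : ∀ ω : Ω, Measurable fun k : G × H => a ((k.1, k.2) • ω) := fun ω =>
      ha.measurable.comp (hA.comp (measurable_id.prodMk measurable_const))
    have hmb : Measurable fun h : H => b (((1 : G), h) • w.2.1) :=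
      hb.measurable.comp (hm.isMeasurableAction_right.measurable.comp
        (measurable_id.prodMk measurable_const))
    have hmc : Measurable fun k : H × G => a ((k.2, k.1) • w.2.2) :=
      (hma w.2.2).comp measurable_swap
    change ∫⁻ k : G × H × G, a ((k.1, k.2.1) • w.1) * (b (((1 : G), k.2.1) • w.2.1) *
      a ((k.2.2, k.2.1) • w.2.2)) ∂(mG.prod (mH.prod mG)) = 1
    rw [lintegral_prod_symm' (fun k : G × H × G => a ((k.1, k.2.1) • w.1) *
      (b (((1 : G), k.2.1) • w.2.1) * a ((k.2.2, k.2.1) • w.2.2)))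
      (((hma w.1).comp (measurable_fst.prodMk measurable_snd.fst)).mul
      ((hmb.comp measurable_snd.fst).mul (hmc.comp measurable_snd)))]
    have e1 : ∀ k : H × G, ∫⁻ g, a ((g, k.1) • w.1) * (b (((1 : G), k.1) • w.2.1) *
        a ((k.2, k.1) • w.2.2)) ∂mG = (∫⁻ g, a ((g, k.1) • w.1) ∂mG) *
        (b (((1 : G), k.1) • w.2.1) * a ((k.2, k.1) • w.2.2)) := fun k =>
      lintegral_mul_const _ ((hma w.1).comp measurable_prodMk_right)
    simp only [e1]
    rw [lintegral_prod (fun k : H × G => (∫⁻ g, a ((g, k.1) • w.1) ∂mG) *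
      (b (((1 : G), k.1) • w.2.1) * a ((k.2, k.1) • w.2.2)))
      ((((hma w.1).lintegral_prod_left').comp measurable_fst).mul
      ((hmb.comp measurable_fst).mul hmc)).aemeasurable]
    have e2 : ∀ h : H, ∫⁻ g', (∫⁻ g, a ((g, h) • w.1) ∂mG) *
        (b (((1 : G), h) • w.2.1) * a ((g', h) • w.2.2)) ∂mG = (∫⁻ g, a ((g, h) • w.1) ∂mG) *
        (b (((1 : G), h) • w.2.1) * ∫⁻ g', a ((g', h) • w.2.2) ∂mG) := fun h => by
      rw [lintegral_const_mul, lintegral_const_mul]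
      · exact hmc.comp measurable_prodMk_left
      · exact measurable_const.mul (hmc.comp measurable_prodMk_left)
    simp only [e2]
    change ∫⁻ h, b (((1 : G), h) • w.2.1) ∂mH = 1 at hw2
    rw [← hw2]
    refine lintegral_congr_ae ?_
    filter_upwards [hw1, hw3] with h hh1 hh3
    simp only [Function.comp] at hh3
    rw [lintegral_congr fun g => congrArg a (smul_left_mul_right g h w.1),
      lintegral_congr fun g => congrArg a (smul_left_mul_right g h w.2.2), hh1, hh3, one_mul,
      mul_one]
  have hone := ae_eq_one_of_isStronglyICCRelative hICC hact hinv hv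
    (Ξ := fun w => (Φ (w.1, w.2.1))⁻¹ * Φ (w.1, w.2.2) * (Φ (w.2.1, w.2.2))⁻¹) ?_
    (((hΦ.measurable.comp (measurable_fst.prodMk measurable_snd.fst)).inv.mul
      (hΦ.measurable.comp (measurable_fst.prodMk measurable_snd.snd))).mul
      (hΦ.measurable.comp measurable_snd).inv) ?_ ?_
  · filter_upwards [hone] with w hw
    rw [mul_assoc] at hw
    exact inv_mul_eq_one.1 hw
  · rw [lintegral_prod_mul ha.measurable.aemeasurable (g := fun w : Ω × Ω => b w.1 * a w.2)
      ((hb.measurable.comp measurable_fst).mul (ha.measurable.comp measurable_snd)).aemeasurable,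
      lintegral_prod_mul hb.measurable.aemeasurable ha.measurable.aemeasurable]
    exact ENNReal.mul_ne_top hafin (ENNReal.mul_ne_top hbfin hafin)
  · intro k
    filter_upwards [q12.ae (hΦ.equivariant k.1 1 k.2.1), q13.ae (hΦ.equivariant k.1 k.2.2 k.2.1),
      q23.ae (hΦ.equivariant 1 k.2.2 k.2.1)] with w h12 h13 h23
    simp only [act, h12, h13, h23]
    simp [mul_assoc]
  · rintro _ ⟨g, rfl⟩
    refine ⟨fun w => (((1 : G), (1 : H)) • w.1, (g, (1 : H)) • w.2.1, ((1 : G), (1 : H)) • w.2.2),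
      (hm.measurePreserving_smul (1, 1)).prod ((hm.measurePreserving_smul (g, 1)).prod
        (hm.measurePreserving_smul (1, 1))), ?_, ?_⟩
    · intro k w
      obtain ⟨k₁, k₂⟩ := k
      simp only [act, smul_smul, Prod.mk_mul_mk, one_mul, mul_one]
    · filter_upwards [q12.ae (hΦ.equivariant 1 g 1), q13.ae (hΦ.equivariant 1 1 1),
        q23.ae (hΦ.equivariant g 1 1)] with w h12 h13 h23
      simp only [h12, h13, h23]
      simp [mul_assoc]

/-- A tautening kernel with values in a strongly ICC group is of the form `Ψ(ω₁) Ψ(ω₂)⁻¹`, where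
`Ψ` is equivariant with respect to a continuous homomorphism `ρ` on `H`. -/
theorem IsTauteningKernel.exists_hom [StandardBorelSpace Ω] (hm : IsCoupling mG mH m)
    {π : G →ₜ* P} (hICC : IsStronglyICCRelative (π : G →* P).range) {Φ : Ω × Ω → P}
    (hΦ : IsTauteningKernel (H := H) (π : G →* P) m Φ) :
    ∃ (ρ : H →ₜ* P) (Ψ : Ω → P) (D : Set Ω), Measurable Ψ ∧ MeasurableSet D ∧
      (∀ᵐ ω ∂m, ω ∈ D) ∧ (∀ (a : G × H) (ω : Ω), a • ω ∈ D ↔ ω ∈ D) ∧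
      (∀ ω ∈ D, ∀ (g : G) (h : H), Ψ ((g, h) • ω) = π g * Ψ ω * (ρ h)⁻¹) ∧
      (∀ ω ∉ D, Ψ ω = 1) ∧ ∀ᵐ w ∂(m.prod m), Φ w = Ψ w.1 * (Ψ w.2)⁻¹ := by
  have := hm.sFinite
  have : NeZero m := ⟨hm.ne_zero⟩
  have hA := hm.measurable_action
  -- fix a generic last variable
  obtain ⟨ω₀, hω₀⟩ : ∃ ω₀, ∀ᵐ w ∂(m.prod m), Φ w = Φ (w.1, ω₀) * (Φ (w.2, ω₀))⁻¹ := by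
    have h1 := hΦ.ae_cocycle hm hICC
    have h2 : ∀ᵐ q ∂((m.prod m).prod m), Φ q.1 = Φ (q.1.1, q.2) * (Φ (q.1.2, q.2))⁻¹ :=
      (measurePreserving_prodAssoc m m m).quasiMeasurePreserving.ae h1
    have h3 := Measure.ae_ae_of_ae_prod
      ((Measure.measurePreserving_swap (μ := m) (ν := m.prod m)).quasiMeasurePreserving.ae h2)
    exact h3.exists
  let Ψ₀ : Ω → P := fun ω => Φ (ω, ω₀)
  have hΨ₀ : Measurable Ψ₀ := hΦ.measurable.comp measurable_prodMk_right
  have hrel : ∀ (g : G) (h : H), ∀ᵐ w ∂(m.prod m),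
      Ψ₀ ((g, h) • w.1) * (Ψ₀ (((1 : G), h) • w.2))⁻¹ = π g * (Ψ₀ w.1 * (Ψ₀ w.2)⁻¹) := by
    intro g h
    filter_upwards [hω₀, ((hm.measurePreserving_smul (g, h)).prod
      (hm.measurePreserving_smul (1, h))).quasiMeasurePreserving.ae hω₀,
      hΦ.equivariant g 1 h] with w h1 h2 h3
    simp only [Prod.map] at h2
    simp only [Ψ₀]
    rw [← h2, h3, h1]
    simp
  have hg : ∀ g : G, ∀ᵐ ω ∂m, Ψ₀ ((g, (1 : H)) • ω) = π g * Ψ₀ ω := by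
    intro g
    have h1 := Measure.ae_ae_of_ae_prod (hrel g 1)
    filter_upwards [h1] with ω hω
    obtain ⟨ω', hω'⟩ := hω.exists
    rw [show ((1 : G), (1 : H)) • ω' = ω' from one_smul (G × H) ω', ← mul_assoc] at hω'
    exact mul_right_cancel hω'
  have hconst : ∀ h : H, ∃ x : P, ∀ᵐ ω ∂m, (Ψ₀ (((1 : G), h) • ω))⁻¹ * Ψ₀ ω = x := by
    intro h
    obtain ⟨ω, hω⟩ := (Measure.ae_ae_of_ae_prod (hrel 1 h)).exists
    refine ⟨(Ψ₀ (((1 : G), h) • ω))⁻¹ * Ψ₀ ω, ?_⟩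
    filter_upwards [hω] with ω' hω'
    rw [map_one, one_mul] at hω'
    have : (Ψ₀ (((1 : G), h) • ω')) = Ψ₀ ω' * (Ψ₀ ω)⁻¹ * Ψ₀ (((1 : G), h) • ω) := by
      rw [← inv_inj]
      simp only [mul_inv_rev, inv_inv]
      rw [eq_comm, inv_mul_eq_iff_eq_mul, hω']
    rw [this]
    simp [mul_assoc]
  have hFm : Measurable fun p : H × Ω => (Ψ₀ (((1 : G), p.1) • p.2))⁻¹ * Ψ₀ p.2 :=
    (hΨ₀.comp hm.isMeasurableAction_right.measurable).inv.mul (hΨ₀.comp measurable_snd)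
  obtain ⟨ρ₀, D₀, hρ₀, -, -, hρ₀c⟩ := exists_measurable_ae_eq_const m hm.ne_zero hFm
  have hρ₀e : ∀ h : H, ∀ᵐ ω ∂m, Ψ₀ (((1 : G), h) • ω) = Ψ₀ ω * (ρ₀ h)⁻¹ := by
    intro h
    obtain ⟨x, hx⟩ := hconst h
    rw [(hρ₀c h x hx).2]
    filter_upwards [hx] with ω hω
    rw [← hω]
    simp
  have hρmul : ∀ h k : H, ρ₀ (h * k) = ρ₀ h * ρ₀ k := by
    intro h k
    obtain ⟨ω, h1, h2, h3⟩ := ((hρ₀e (h * k)).and ((hρ₀e k).and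
      ((hm.measurePreserving_smul (1, k)).quasiMeasurePreserving.ae (hρ₀e h)))).exists
    rw [hm.isMeasurableAction_right.mul, h3, h2] at h1
    rw [← inv_inj, ← mul_left_cancel_iff (a := Ψ₀ ω), ← h1]
    simp [mul_assoc]
  let ρ₁ : H →* P := MonoidHom.mk' ρ₀ hρmul
  let ρ : H →ₜ* P := ⟨ρ₁, ρ₁.continuous_of_measurable_of_secondCountable hρ₀⟩
  have hU : IsMeasurableAction fun (a : G × H) (x : P) => π a.1 * x * (ρ a.2)⁻¹ :=
    { one := fun x => by simp
      mul := fun a b x => by simp [mul_assoc]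
      measurable := (((π.continuous_toFun.measurable.comp measurable_fst.fst).mul
        measurable_snd).mul (ρ.continuous_toFun.measurable.comp measurable_fst.snd).inv) }
  have hΨ₀e : ∀ a : G × H, ∀ᵐ ω ∂m, Ψ₀ (a • ω) = π a.1 * Ψ₀ ω * (ρ a.2)⁻¹ := by
    intro a
    filter_upwards [hρ₀e a.2, (hm.measurePreserving_smul (1, a.2)).quasiMeasurePreserving.ae
      (hg a.1)] with ω h1 h2
    rw [← smul_left_mul_right] at h2
    rw [h2, h1, ← mul_assoc]
    rfl
  obtain ⟨Ψ, D, hΨ, hD, hDae, hDinv, hΨD, hΨ1, hΨΨ₀⟩ :=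
    exists_equivariant_of_ae_equivariant (mG.prod mH) (NeZero.ne _) hm.isMeasurableAction hU m hΨ₀
      hΨ₀e 1
  refine ⟨ρ, Ψ, D, hΨ, hD, hDae, hDinv, fun ω hω g h => hΨD ω hω (g, h), hΨ1, ?_⟩
  filter_upwards [hω₀, Measure.quasiMeasurePreserving_fst.ae hΨΨ₀,
    Measure.quasiMeasurePreserving_snd.ae hΨΨ₀] with w h1 h2 h3
  rw [h1, h2, h3]

/-- The pair `(Ψ, ρ)` is unique up to conjugation when the target is strongly ICC. -/
theorem IsTauteningKernel.unique_hom (hm : IsCoupling mG mH m) {π : G →* P}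
    (hICC : IsStronglyICCRelative π.range) {ρ ρ' : H →* P} {Ψ Ψ' : Ω → P}
    (hΨ : Measurable Ψ) (hΨ' : Measurable Ψ')
    (he : ∀ (g : G) (h : H), ∀ᵐ ω ∂m, Ψ ((g, h) • ω) = π g * Ψ ω * (ρ h)⁻¹)
    (he' : ∀ (g : G) (h : H), ∀ᵐ ω ∂m, Ψ' ((g, h) • ω) = π g * Ψ' ω * (ρ' h)⁻¹) :
    ∃ x : P, (∀ᵐ ω ∂m, Ψ' ω = Ψ ω * x⁻¹) ∧ ∀ h : H, ρ' h = x * ρ h * x⁻¹ := by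
  have := hm.sFinite
  have : NeZero m := ⟨hm.ne_zero⟩
  have hker : ∀ {σ : H →* P} {Θ : Ω → P}, Measurable Θ →
      (∀ (g : G) (h : H), ∀ᵐ ω ∂m, Θ ((g, h) • ω) = π g * Θ ω * (σ h)⁻¹) →
      IsTauteningKernel (H := H) π m fun w => Θ w.1 * (Θ w.2)⁻¹ := by
    intro σ Θ hΘ hΘe
    refine ⟨(hΘ.comp measurable_fst).mul (hΘ.comp measurable_snd).inv, fun g₁ g₂ h => ?_⟩
    filter_upwards [Measure.quasiMeasurePreserving_fst.ae (hΘe g₁ h),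
      Measure.quasiMeasurePreserving_snd.ae (hΘe g₂ h)] with w h1 h2
    rw [h1, h2]
    simp [mul_assoc]
  have hae := (hker hΨ he).ae_eq hm hICC (hker hΨ' he')
  obtain ⟨x, hx⟩ : ∃ x : P, ∀ᵐ ω ∂m, Ψ' ω = Ψ ω * x⁻¹ := by
    have h1 := Measure.ae_ae_of_ae_prod
      ((Measure.measurePreserving_swap (μ := m) (ν := m)).quasiMeasurePreserving.ae hae)
    obtain ⟨ω, hω⟩ := h1.exists
    refine ⟨(Ψ' ω)⁻¹ * Ψ ω, ?_⟩
    filter_upwards [hω] with ω' hω'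
    simp only [Prod.fst_swap, Prod.snd_swap] at hω'
    rw [mul_inv_rev, inv_inv, ← mul_assoc, hω']
    simp
  refine ⟨x, hx, fun h => ?_⟩
  obtain ⟨ω, h1, h2, h3, h4⟩ := (hx.and ((he 1 h).and ((he' 1 h).and
    ((hm.measurePreserving_smul (1, h)).quasiMeasurePreserving.ae hx)))).exists
  rw [h3, h2, h1, map_one, one_mul, one_mul] at h4
  rw [← inv_inj, ← mul_left_cancel_iff (a := Ψ ω * x⁻¹), h4]
  simp [mul_assoc]

/-- A null set of `Ω ×_H Ω*` has a null preimage in `Ω × Ω`. -/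
theorem IsCoupling.quasiMeasurePreserving_mk (hm : IsCoupling mG mH m) :
    Measure.QuasiMeasurePreserving (CouplingComp.mk G G H) (m.prod m)
      (compositionMeasure G G H mH m m) := by
  have hmk : Measurable (CouplingComp.mk G G H (Ω₁ := Ω) (Ω₂ := Ω)) :=
    @measurable_quotient_mk' _ _ (diagSetoid G G H Ω Ω)
  refine ⟨hmk, Measure.AbsolutelyContinuous.mk fun s hs h0 => ?_⟩
  rw [Measure.map_apply hmk hs, ← lintegral_indicator_one (hmk hs),
    compositionMeasure_spec mH hm hm _ (measurable_one.indicator (hmk hs))]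
  have h1 : ∀ᵐ q ∂(compositionMeasure G G H mH m m), q ∉ s := measure_eq_zero_iff_ae_notMem.1 h0
  refine (lintegral_congr_ae (g := fun _ => 0) ?_).trans lintegral_zero
  filter_upwards [h1] with q hq
  refine (lintegral_congr fun h => ?_).trans lintegral_zero
  refine Set.indicator_of_notMem (fun hh => hq ?_) _
  have : CouplingComp.mk G G H (diagAct G G h q.out) = q :=
    (Quotient.sound (s := diagSetoid G G H Ω Ω) ⟨h⁻¹, by
      rw [← diagAct_mul, inv_mul_cancel, diagAct_one]⟩).trans (Quotient.out_eq q)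
  rwa [Set.mem_preimage, this] at hh

/-- A tautening map of `Ω ×_H Ω*` lifts to a tautening kernel. -/
theorem IsTauteningMap.isTauteningKernel (hm : IsCoupling mG mH m) {π : G →* P}
    {Φ : CouplingComp G G H Ω Ω → P}
    (hΦ : IsTauteningMap π (compositionMeasure G G H mH m m) Φ) :
    IsTauteningKernel (H := H) π m fun w => Φ (CouplingComp.mk G G H w) := by
  refine ⟨hΦ.1.comp hm.quasiMeasurePreserving_mk.measurable, fun g₁ g₂ h => ?_⟩
  filter_upwards [hm.quasiMeasurePreserving_mk.ae hΦ.2] with w hw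
  rw [← hw g₁ g₂]
  congr 1
  refine Quotient.sound (s := diagSetoid G G H Ω Ω) ⟨h⁻¹, ?_⟩
  simp [diagAct, smul_smul]

end Core

/-! ### Measurable selections and closed subgroups -/

/-- The Kuratowski–Ryll-Nardzewski selection theorem, with a selection that only depends on the
closed set `O x`. -/
theorem exists_measurable_selection {X W : Type*} [MeasurableSpace X] [TopologicalSpace W]
    [PolishSpace W] [MeasurableSpace W] [BorelSpace W] (O : X → Set W)
    (hclosed : ∀ x, IsClosed (O x)) (hne : ∀ x, (O x).Nonempty)
    (hmeas : ∀ U : Set W, IsOpen U → MeasurableSet {x | (O x ∩ U).Nonempty}) :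
    ∃ s : X → W, Measurable s ∧ (∀ x, s x ∈ O x) ∧ ∀ x y, O x = O y → s x = s y := by
  classical
  rcases isEmpty_or_nonempty X with hX | ⟨⟨x₀⟩⟩
  · exact ⟨fun x => (hX.false x).elim, measurable_of_empty _, fun x => (hX.false x).elim,
      fun x => (hX.false x).elim⟩
  let := TopologicalSpace.upgradeIsCompletelyMetrizable W
  have : Nonempty W := ⟨(hne x₀).some⟩
  let d : ℕ → W := TopologicalSpace.denseSeq W
  have hd : ∀ (w : W) (r : ℝ), 0 < r → ∃ k, dist w (d k) < r := fun w r hr =>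
    (TopologicalSpace.denseRange_denseSeq W).exists_dist_lt w hr
  let r : ℕ → ℝ := fun n => (1 / 2) ^ n
  have hr : ∀ n, 0 < r n := fun n => by positivity
  let Q : ℕ → (X → ℕ) → Prop := fun n c => Measurable c ∧ (∀ x y, O x = O y → c x = c y) ∧
    ∀ x, (O x ∩ Metric.ball (d (c x)) (r n)).Nonempty
  have step : ∀ n c, Q n c → ∃ c', Q (n + 1) c' ∧
      ∀ x, dist (d (c x)) (d (c' x)) ≤ 2 * (1 / 2) ^ n := by
    rintro n c ⟨hc, hcinv, hcO⟩
    let p : X → ℕ → Prop := fun x k =>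
      (O x ∩ (Metric.ball (d (c x)) (r n) ∩ Metric.ball (d k) (r (n + 1)))).Nonempty
    have hp : ∀ x, ∃ k, p x k := by
      intro x
      obtain ⟨w, hw, hwb⟩ := hcO x
      obtain ⟨k, hk⟩ := hd w (r (n + 1)) (hr _)
      exact ⟨k, w, hw, hwb, hk⟩
    have hpm : ∀ k, MeasurableSet {x | p x k} := by
      intro k
      have : {x | p x k} = ⋃ j, (c ⁻¹' {j} ∩
          {x | (O x ∩ (Metric.ball (d j) (r n) ∩ Metric.ball (d k) (r (n + 1)))).Nonempty}) := by
        ext x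
        simp [p]
      rw [this]
      exact MeasurableSet.iUnion fun j => (hc (measurableSet_singleton j)).inter
        (hmeas _ (Metric.isOpen_ball.inter Metric.isOpen_ball))
    refine ⟨fun x => Nat.find (hp x), ⟨measurable_find hp hpm, fun x y hxy => ?_, fun x => ?_⟩,
      fun x => ?_⟩
    · have : p x = p y := by
        funext k
        simp only [p, hxy, hcinv x y hxy]
      simp only [this]
    · obtain ⟨w, hw, -, hwk⟩ := Nat.find_spec (hp x)
      exact ⟨w, hw, hwk⟩
    · obtain ⟨w, -, hw1, hw2⟩ := Nat.find_spec (hp x)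
      have h1 : r (n + 1) ≤ r n := pow_le_pow_of_le_one (by norm_num) (by norm_num) (Nat.le_succ n)
      rw [Metric.mem_ball] at hw1 hw2
      have h2 := dist_triangle_left (d (c x)) (d (Nat.find (hp x))) w
      change _ ≤ 2 * r n
      linarith
  have start : ∃ c, Q 0 c := by
    have hp : ∀ x, ∃ k, (O x ∩ Metric.ball (d k) (r 0)).Nonempty := by
      intro x
      obtain ⟨w, hw⟩ := hne x
      obtain ⟨k, hk⟩ := hd w (r 0) (hr _)
      exact ⟨k, w, hw, hk⟩
    refine ⟨fun x => Nat.find (hp x), measurable_find hp fun k => hmeas _ Metric.isOpen_ball,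
      fun x y hxy => ?_, fun x => Nat.find_spec (hp x)⟩
    simp only [hxy]
  obtain ⟨c₀, hc₀⟩ := start
  choose! next hnext using step
  let C : ℕ → X → ℕ := fun n => Nat.rec c₀ (fun n c => next n c) n
  have hC : ∀ n, Q n (C n) := fun n => by
    induction n with
    | zero => exact hc₀
    | succ n ih => exact (hnext n _ ih).1
  have hCd : ∀ n x, dist (d (C n x)) (d (C (n + 1) x)) ≤ 2 * (1 / 2) ^ n := fun n x =>
    (hnext n _ (hC n)).2 x
  have hlim : ∀ x, ∃ w, Filter.Tendsto (fun n => d (C n x)) Filter.atTop (𝓝 w) := fun x =>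
    cauchySeq_tendsto_of_complete
      (cauchySeq_of_le_geometric (1 / 2) 2 (by norm_num) fun n => hCd n x)
  choose s hs using hlim
  refine ⟨s, ?_, fun x => ?_, fun x y hxy => ?_⟩
  · refine measurable_of_tendsto_metrizable (f := fun n x => d (C n x)) (fun n => ?_)
      (tendsto_pi_nhds.2 hs)
    exact (measurable_from_nat (f := d)).comp (hC n).1
  · have h1 : ∀ n, ∃ w ∈ O x, dist w (d (C n x)) < r n := fun n => by
      obtain ⟨w, hw, hwb⟩ := (hC n).2.2 x
      exact ⟨w, hw, hwb⟩
    choose w hw hwd using h1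
    have h2 : Filter.Tendsto w Filter.atTop (𝓝 (s x)) := by
      refine tendsto_iff_dist_tendsto_zero.2 ?_
      have h3 : Filter.Tendsto (fun n => r n + dist (d (C n x)) (s x)) Filter.atTop (𝓝 (0 + 0)) :=
        (tendsto_pow_atTop_nhds_zero_of_lt_one (by norm_num) (by norm_num)).add
          (tendsto_iff_dist_tendsto_zero.1 (hs x))
      rw [add_zero] at h3
      refine squeeze_zero (fun n => dist_nonneg) (fun n => ?_) h3
      exact (dist_triangle _ (d (C n x)) _).trans (by gcongr; exact (hwd n).le)
    exact (hclosed x).mem_of_tendsto h2 (Filter.Eventually.of_forall hw)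
  · have : (fun n => d (C n x)) = fun n => d (C n y) := by
      funext n
      rw [(hC n).2.1 x y hxy]
    have h1 := hs x
    rw [this] at h1
    exact tendsto_nhds_unique h1 (hs y)

section ClosedSubgroup

variable {P : Type*} [Group P] [TopologicalSpace P] [IsTopologicalGroup P] [PolishSpace P]
  [MeasurableSpace P] [BorelSpace P]

/-- A closed subgroup of a Polish group admits a measurable equivariant retraction, or,
equivalently, a measurable section of the quotient map. -/
theorem exists_measurable_equivariant (A : Subgroup P) (hA : IsClosed (A : Set P)) :
    ∃ f : P → A, Measurable f ∧ ∀ (a : A) (x : P), f (a * x) = a * f x := by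
  let O : P → Set P := fun x => (· * x⁻¹) ⁻¹' A
  have hOmul : ∀ (a : A) (x : P), O (a * x) = O x := by
    intro a x
    ext y
    simp only [O, Set.mem_preimage, mul_inv_rev, ← mul_assoc, SetLike.mem_coe]
    exact A.mul_mem_cancel_right (A.inv_mem a.2)
  obtain ⟨s, hs, hsO, hsinv⟩ := exists_measurable_selection O
    (fun x => hA.preimage (continuous_mul_const _)) (fun x => ⟨x, by simp [O, A.one_mem]⟩) (by
      intro U hU
      have : {x | (O x ∩ U).Nonempty} = ⋃ a : A, ((a : P) * ·) ⁻¹' U := by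
        ext x
        simp only [Set.mem_iUnion, Set.mem_preimage]
        constructor
        · rintro ⟨y, hy, hyU⟩
          exact ⟨⟨y * x⁻¹, hy⟩, by simpa using hyU⟩
        · rintro ⟨a, ha⟩
          exact ⟨a * x, by simp [O], ha⟩
      rw [this]
      exact (isOpen_iUnion fun a : A => hU.preimage (continuous_const_mul (a : P))).measurableSet)
  have hmem : ∀ x, x * (s x)⁻¹ ∈ A := fun x => by
    have := A.inv_mem (hsO x)
    simpa using this
  refine ⟨fun x => ⟨x * (s x)⁻¹, hmem x⟩, (measurable_id.mul hs.inv).subtype_mk, fun a x => ?_⟩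
  ext
  simp only [Subgroup.coe_mul]
  rw [hsinv _ _ (hOmul a x), mul_assoc]

variable {G : Type*} [Group G] [TopologicalSpace G] [IsTopologicalGroup G] [LocallyCompactSpace G]
  [SecondCountableTopology G]

theorem ContinuousMonoidHom.isOpenMap_rangeRestrict (π : G →ₜ* P)
    (hr : IsClosed ((π : G →* P).range : Set P)) : IsOpenMap (π : G →* P).rangeRestrict := by
  have : PolishSpace (π : G →* P).range := hr.polishSpace
  let := TopologicalSpace.upgradeIsCompletelyMetrizable (π : G →* P).range
  exact MonoidHom.isOpenMap_of_sigmaCompact _ (π : G →* P).rangeRestrict_surjective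
    (π.continuous_toFun.subtype_mk _)

/-- The image of a locally compact group is locally compact when it is closed: the corestriction
to the image is open. -/
theorem ContinuousMonoidHom.locallyCompactSpace_range (π : G →ₜ* P)
    (hr : IsClosed ((π : G →* P).range : Set P)) : LocallyCompactSpace (π : G →* P).range :=
  IsOpenQuotientMap.locallyCompactSpace (f := (π : G →* P).rangeRestrict)
    ⟨(π : G →* P).rangeRestrict_surjective, π.continuous_toFun.subtype_mk _,
      π.isOpenMap_rangeRestrict hr⟩

/-- A homomorphism with compact kernel and closed image is proper onto its image. -/
theorem ContinuousMonoidHom.tendsto_cocompact_rangeRestrict (π : G →ₜ* P)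
    (hk : IsCompact ((π : G →* P).ker : Set G)) (hr : IsClosed ((π : G →* P).range : Set P)) :
    Filter.Tendsto (π : G →* P).rangeRestrict (Filter.cocompact G)
      (Filter.cocompact (π : G →* P).range) := by
  have hcont : Continuous (π : G →* P).rangeRestrict := π.continuous_toFun.subtype_mk _
  rw [Filter.Tendsto, Filter.le_def]
  intro s hs
  obtain ⟨C, hC, hCs⟩ := Filter.mem_cocompact.1 hs
  have hex : ∀ x : (π : G →* P).range, ∃ K : Set G, IsCompact K ∧
      (π : G →* P).rangeRestrict '' K ∈ 𝓝 x := by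
    intro x
    obtain ⟨g, rfl⟩ := (π : G →* P).rangeRestrict_surjective x
    obtain ⟨K, hK, hKg⟩ := exists_compact_mem_nhds g
    exact ⟨K, hK, (π.isOpenMap_rangeRestrict hr).image_mem_nhds hKg⟩
  choose K hK hKn using hex
  obtain ⟨t, -, ht⟩ := hC.elim_nhds_subcover _ fun x _ => hKn x
  have hK' : IsCompact (⋃ x ∈ t, K x) := t.isCompact_biUnion fun x _ => hK x
  refine Filter.mem_map.2 (Filter.mem_cocompact.2 ⟨_, hK'.mul hk, fun g hg => ?_⟩)
  by_contra hgs
  have hgC : (π : G →* P).rangeRestrict g ∈ C := by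
    by_contra h
    exact hgs (hCs h)
  obtain ⟨x, hx, k, hkK, hkg⟩ := Set.mem_iUnion₂.1 (ht hgC)
  refine hg ⟨k, Set.mem_iUnion₂.2 ⟨x, hx, hkK⟩, k⁻¹ * g, ?_, by simp⟩
  have := congrArg Subtype.val hkg
  simp only [MonoidHom.coe_rangeRestrict] at this
  change k⁻¹ * g ∈ (π : G →* P).ker
  rw [MonoidHom.mem_ker, map_mul, map_inv, this, inv_mul_cancel]

variable [MeasurableSpace G] [BorelSpace G] (mG : Measure G) [mG.IsHaarMeasure]

theorem ContinuousMonoidHom.isHaarMeasure_map_rangeRestrict (π : G →ₜ* P)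
    (hk : IsCompact ((π : G →* P).ker : Set G)) (hr : IsClosed ((π : G →* P).range : Set P)) :
    (mG.map (π : G →* P).rangeRestrict).IsHaarMeasure :=
  Measure.isHaarMeasure_map mG _ (π.continuous_toFun.subtype_mk _)
    (π : G →* P).rangeRestrict_surjective (π.tendsto_cocompact_rangeRestrict hk hr)

theorem ContinuousMonoidHom.isMulRightInvariant_map_rangeRestrict [mG.IsMulRightInvariant]
    (π : G →ₜ* P) : (mG.map (π : G →* P).rangeRestrict).IsMulRightInvariant := by
  have hm : Measurable (π : G →* P).rangeRestrict :=
    (π.continuous_toFun.subtype_mk (fun x => ⟨x, rfl⟩) : Continuous (π : G →* P).rangeRestrict).measurable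
  constructor
  intro a
  obtain ⟨g, rfl⟩ := (π : G →* P).rangeRestrict_surjective a
  rw [Measure.map_map (measurable_mul_const _) hm]
  conv_rhs => rw [← map_mul_right_eq_self mG g]
  rw [Measure.map_map hm (measurable_mul_const _)]
  congr 1
  funext k
  simp

end ClosedSubgroup

/-! ### Actions with an equivariant map to the group -/

section Retraction

variable {K W : Type u} [Group K] [MeasurableSpace K] [MeasurableMul₂ K] [MeasurableInv K]
  [MeasurableSingletonClass K] [MeasurableSpace W] {act : K → W → W} {mK : Measure K}
  [SFinite mK] [mK.IsMulRightInvariant]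
  {m : Measure W} [SFinite m] {f : W → K} {κ : K → ℝ≥0∞}

theorem isWeight_of_equivariant (hf : Measurable f) (hfe : ∀ k w, f (act k w) = k * f w)
    (hκ : Measurable κ) (hκ1 : ∫⁻ k, κ k ∂mK = 1) : IsWeight act mK m fun w => κ (f w) := by
  refine ⟨hκ.comp hf, Filter.Eventually.of_forall fun w => ?_⟩
  simp only [hfe]
  rw [lintegral_mul_right_eq_self κ, hκ1]

/-- An equivariant map `f : W → K` trivialises an invariant measure: `W` is isomorphic to the
product of `K` with the section `{f = 1}`. -/
theorem isFundamentalIso_of_equivariant [mK.IsInvInvariant] (hact : IsMeasurableAction act)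
    (hinv : ∀ k, MeasurePreserving (act k) m m)
    (hf : Measurable f) (hfe : ∀ k w, f (act k w) = k * f w)
    (hκ : Measurable κ) (hκ1 : ∫⁻ k, κ k ∂mK = 1) (hfin : ∫⁻ w, κ (f w) ∂m ≠ ∞) :
    ∃ ν : Measure W, IsFiniteMeasure ν ∧ IsFundamentalIso act mK ν m (fun p => act p.1 p.2)
      fun w => (f w, act (f w)⁻¹ w) := by
  have hsm : Measurable fun w => act (f w)⁻¹ w := hact.measurable.comp (hf.inv.prodMk measurable_id)
  have hfinite : IsFiniteMeasure (m.withDensity fun w => κ (f w)) := isFiniteMeasure_withDensity hfin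
  let ν : Measure W := (m.withDensity fun w => κ (f w)).map fun w => act (f w)⁻¹ w
  have hfs : ∀ w, f (act (f w)⁻¹ w) = 1 := fun w => by rw [hfe, inv_mul_cancel]
  have hνfin : IsFiniteMeasure ν := Measure.isFiniteMeasure_map _ _
  have hone : ∀ᵐ p ∂(mK.prod ν), f p.2 = 1 :=
    Measure.quasiMeasurePreserving_snd.ae
      ((ae_map_iff hsm.aemeasurable (hf (measurableSet_singleton 1))).2
        (Filter.Eventually.of_forall hfs))
  refine ⟨ν, hνfin,
    { measurePreserving := ⟨hact.measurable, ?_⟩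
      measurable_inv := hf.prodMk hsm
      left_inv := ?_
      right_inv := Filter.Eventually.of_forall fun w => hact.act_inv _ _
      equivariant := fun k => Filter.Eventually.of_forall fun p => hact.mul _ _ _ }⟩
  · ext E hE
    have hEm : Measurable (E.indicator (1 : W → ℝ≥0∞)) := measurable_one.indicator hE
    rw [Measure.map_apply hact.measurable hE, ← lintegral_indicator_one (hact.measurable hE),
      lintegral_prod_symm' _ (measurable_one.indicator (hact.measurable hE)),
      ← lintegral_indicator_one hE,
      lintegral_eq_lintegral_weight hact hinv (isWeight_of_equivariant hf hfe hκ hκ1) hEm]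
    have hI : Measurable fun y => ∫⁻ k, E.indicator 1 (act k y) ∂mK :=
      ((hEm.comp hact.measurable).comp measurable_swap).lintegral_prod_right'
    change ∫⁻ y, ∫⁻ k, E.indicator 1 (act k y) ∂mK ∂ν = _
    rw [lintegral_map hI hsm,
      lintegral_withDensity_eq_lintegral_mul m (f := fun w => κ (f w)) (hκ.comp hf)
        (g := fun w => ∫⁻ k, E.indicator 1 (act k (act (f w)⁻¹ w)) ∂mK) (hI.comp hsm)]
    refine lintegral_congr fun w => ?_
    simp only [Pi.mul_apply, ← hact.mul]
    rw [lintegral_mul_right_eq_self (fun k => E.indicator 1 (act k w)),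
      lintegral_inv_eq_self (fun k => E.indicator 1 (act k w))]
  · filter_upwards [hone] with p hp
    have : f (act p.1 p.2) = p.1 := by rw [hfe, hp, mul_one]
    rw [this, hact.inv_act]

/-- A weight of finite total mass gives a finite quotient measure on the orbit space. -/
theorem isQuotientMeasure_map_mk [mK.IsInvInvariant] (hact : IsMeasurableAction act)
    (hinv : ∀ k, MeasurePreserving (act k) m m) {v : W → ℝ≥0∞} (hv : IsWeight act mK m v)
    (s : Setoid W) (hs : ∀ w w', s.r w w' ↔ ∃ k, act k w = w') :
    IsQuotientMeasure s act mK m ((m.withDensity v).map (Quotient.mk s)) := by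
  intro F hF
  have hFm : Measurable fun p : W × K => F (act p.2 p.1) :=
    hF.comp (hact.measurable.comp measurable_swap)
  let I : W → ℝ≥0∞ := fun w => ∫⁻ k, F (act k w) ∂mK
  have hI : Measurable I := hFm.lintegral_prod_right'
  have hout : ∀ w, I (Quotient.mk s w).out = I w := by
    intro w
    obtain ⟨k, hk⟩ := (hs _ _).1 (Quotient.exact (Quotient.out_eq (Quotient.mk s w)))
    conv_rhs => rw [← hk]
    simp only [I, ← hact.mul]
    exact (lintegral_mul_right_eq_self (fun l => F (act l _)) k).symm
  have hIq : Measurable fun q : Quotient s => I q.out := by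
    refine measurable_from_quotient.2 ?_
    have : ((fun q : Quotient s => I q.out) ∘ Quotient.mk _) = I := funext hout
    rw [this]
    exact hI
  change _ = ∫⁻ q, I q.out ∂((m.withDensity v).map (Quotient.mk s))
  have hmk : Measurable (Quotient.mk s) := @measurable_quotient_mk' _ _ s
  rw [lintegral_map hIq hmk]
  simp only [hout]
  rw [lintegral_withDensity_eq_lintegral_mul _ hv.measurable hI,
    lintegral_eq_lintegral_weight hact hinv hv hF]
  refine lintegral_congr fun w => ?_
  simp only [Pi.mul_apply, I]
  rw [lintegral_inv_eq_self (fun k => F (act k w))]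

end Retraction

/-- A quotient measure is determined by any function which integrates to one over each orbit. -/
theorem IsQuotientMeasure.apply_eq {K W : Type u} [MeasurableSpace K] [MeasurableSpace W]
    {s : Setoid W} {act : K → W → W} {mK : Measure K} {m : Measure W}
    {mbar : Measure (Quotient s)} (h : IsQuotientMeasure s act mK m mbar)
    (hs : ∀ k w, Quotient.mk s (act k w) = Quotient.mk s w) {v : W → ℝ≥0∞} (hv : Measurable v)
    (hv1 : ∀ w, ∫⁻ k, v (act k w) ∂mK = 1) {E : Set (Quotient s)} (hE : MeasurableSet E) :
    mbar E = ∫⁻ w, E.indicator 1 (Quotient.mk s w) * v w ∂m := by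
  have hmk : Measurable (Quotient.mk s) := @measurable_quotient_mk' _ _ s
  rw [h (fun w => E.indicator 1 (Quotient.mk s w) * v w)
    (((measurable_one.indicator hE).comp hmk).mul hv), ← lintegral_indicator_one hE]
  refine lintegral_congr fun q => ?_
  simp only [hs, Quotient.out_eq]
  by_cases hq : q ∈ E
  · simp [hq, hv1]
  · simp [hq]

/-! ### The image of a coupling in the target group -/

/-- Weights pull back along equivariant maps, so they have the same total mass. -/
theorem lintegral_map_weight {L K Ω W : Type*} [Group L] [MeasurableSpace L] [MeasurableInv L]
    [MeasurableSpace K] [MeasurableSpace Ω] [MeasurableSpace W] [StandardBorelSpace W]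
    {act : L → Ω → Ω} {mL : Measure L}
    [SFinite mL] [mL.IsInvInvariant] {m : Measure Ω} [SFinite m] (hact : IsMeasurableAction act)
    (hinv : ∀ l, MeasurePreserving (act l) m m) {u : Ω → ℝ≥0∞} (hu : IsWeight act mL m u)
    {φ : L → K} (hφ : Measurable φ) {actK : K → W → W}
    (hactK : Measurable fun p : K × W => actK p.1 p.2) {Ψ : Ω → W}
    (hΨ : Measurable Ψ) (he : ∀ l, ∀ᵐ ω ∂m, Ψ (act l ω) = actK (φ l) (Ψ ω))
    {v : W → ℝ≥0∞} (hv : Measurable v) (hv1 : ∀ w, ∫⁻ k, v (actK k w) ∂(mL.map φ) = 1) :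
    ∫⁻ w, v w ∂(m.map Ψ) = ∫⁻ ω, u ω ∂m := by
  have hvw : IsWeight act mL m fun ω => v (Ψ ω) := by
    refine ⟨hv.comp hΨ, ?_⟩
    have hms : MeasurableSet {p : L × Ω | Ψ (act p.1 p.2) = actK (φ p.1) (Ψ p.2)} :=
      measurableSet_eq_fun (hΨ.comp hact.measurable)
        (hactK.comp ((hφ.comp measurable_fst).prodMk (hΨ.comp measurable_snd)))
    have h1 : ∀ᵐ p ∂(mL.prod m), Ψ (act p.1 p.2) = actK (φ p.1) (Ψ p.2) :=
      (Measure.ae_prod_iff_ae_ae hms).2 (Filter.Eventually.of_forall he)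
    have h2 := Measure.ae_ae_of_ae_prod
      ((Measure.measurePreserving_swap (μ := m) (ν := mL)).quasiMeasurePreserving.ae h1)
    filter_upwards [h2] with ω hω
    rw [← hv1 (Ψ ω), lintegral_map (f := fun k => v (actK k (Ψ ω)))
      (hv.comp (hactK.comp measurable_prodMk_right)) hφ]
    refine lintegral_congr_ae ?_
    filter_upwards [hω] with l hl
    exact congrArg v hl
  have := hu.lintegral_mul_eq hact hinv hvw (F := fun _ => 1) measurable_const
    fun _ => Filter.Eventually.of_forall fun _ => rfl
  simp only [one_mul] at this
  rw [lintegral_map hv hΨ, this]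

section LocallyFinite

variable {P : Type u} [Group P] [TopologicalSpace P] [IsTopologicalGroup P] [PolishSpace P]
  [MeasurableSpace P] [BorelSpace P]

theorem isMeasurableAction_mul_left (A : Subgroup P) :
    IsMeasurableAction fun (a : A) (x : P) => (a : P) * x where
  one x := one_mul x
  mul _ _ _ := mul_assoc _ _ _
  measurable := (measurable_subtype_coe.comp measurable_fst).mul measurable_snd

theorem isMeasurableAction_mul_right (A : Subgroup P) :
    IsMeasurableAction fun (a : A) (x : P) => x * (a : P)⁻¹ where
  one x := by simp
  mul a b x := by simp [mul_assoc]
  measurable := measurable_snd.mul (measurable_subtype_coe.comp measurable_fst).inv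

/-- A measure which is invariant under a locally compact subgroup `A` and has finite quotient by
`A` is locally finite: if `U` is small enough, then each orbit meets it in a set of bounded
measure. -/
theorem exists_nhds_measure_lt_top (A : Subgroup P) [LocallyCompactSpace A] (mA : Measure A)
    [mA.IsHaarMeasure] [mA.IsMulRightInvariant] {mbar : Measure P} [SFinite mbar]
    (hinv : ∀ a : A, MeasurePreserving (fun x => (a : P) * x) mbar mbar) {v : P → ℝ≥0∞}
    (hv : IsWeight (fun (a : A) (x : P) => (a : P) * x) mA mbar v) (hvfin : ∫⁻ x, v x ∂mbar ≠ ∞)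
    (x : P) : ∃ U : Set P, IsOpen U ∧ x ∈ U ∧ mbar U < ∞ := by
  have : SecondCountableTopology A := TopologicalSpace.Subtype.secondCountableTopology _
  have := isInvInvariant_of_isMulRightInvariant mA
  obtain ⟨C, hC, hC1⟩ := exists_compact_mem_nhds (1 : A)
  obtain ⟨V, hV, hVC⟩ := (mem_nhds_subtype _ _ _).1 hC1
  obtain ⟨W, hWo, hW1, hWV⟩ := exists_open_nhds_one_mul_subset hV
  let N : Set P := W ∩ W⁻¹
  have hNo : IsOpen N := hWo.inter hWo.inv
  refine ⟨(· * x⁻¹) ⁻¹' N, hNo.preimage (continuous_mul_const _), by simp [N, hW1], ?_⟩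
  have hUm : MeasurableSet ((· * x⁻¹) ⁻¹' N) := (hNo.preimage (continuous_mul_const _)).measurableSet
  have hbound : ∀ y : P, mA {a : A | (a : P) * y ∈ (· * x⁻¹) ⁻¹' N} ≤ mA C := by
    intro y
    rcases Set.eq_empty_or_nonempty {a : A | (a : P) * y ∈ (· * x⁻¹) ⁻¹' N} with h | ⟨b, hb⟩
    · rw [h]
      simp
    · have hsub : {a : A | (a : P) * y ∈ (· * x⁻¹) ⁻¹' N} ⊆ (· * b⁻¹) ⁻¹' C := by
        intro a ha
        refine hVC (hWV ⟨a * y * x⁻¹, ha.1, (b * y * x⁻¹)⁻¹, hb.2, ?_⟩)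
        simp [mul_assoc]
      refine (measure_mono hsub).trans_eq ?_
      exact measure_preimage_mul_right mA b⁻¹ C
  rw [← lintegral_indicator_one hUm, lintegral_eq_lintegral_weight (isMeasurableAction_mul_left A)
    hinv hv (measurable_one.indicator hUm)]
  refine lt_of_le_of_lt (lintegral_mono (g := fun y => v y * mA C) fun y => ?_) ?_
  · refine mul_le_mul' le_rfl ?_
    rw [lintegral_inv_eq_self (fun a : A => ((· * x⁻¹) ⁻¹' N).indicator (1 : P → ℝ≥0∞) (a * y))]
    refine le_trans (le_of_eq ?_) (hbound y)
    have hm : MeasurableSet {a : A | (a : P) * y ∈ (· * x⁻¹) ⁻¹' N} :=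
      hUm.preimage (measurable_subtype_coe.mul_const y)
    rw [← lintegral_indicator_one hm]
    rfl
  · rw [lintegral_mul_const _ hv.measurable]
    exact ENNReal.mul_lt_top hvfin.lt_top hC.measure_lt_top

end LocallyFinite

section Proper

variable {H Ω P : Type*} [Group H] [TopologicalSpace H] [IsTopologicalGroup H]
  [LocallyCompactSpace H] [SecondCountableTopology H] [T2Space H] [MeasurableSpace H]
  [BorelSpace H] [MeasurableSpace Ω]
  [Group P] [TopologicalSpace P] [IsTopologicalGroup P] [PolishSpace P]
  [MeasurableSpace P] [BorelSpace P]

/-- If `H` acts properly on `(Ω, m)`, and `Ψ` is equivariant through a homomorphism `ρ` and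
has locally finite image measure, then elements of `H` with `ρ`-image close to the identity stay in
a compact set: they move a fixed set of positive measure inside a set of finite measure. -/
theorem exists_isCompact_of_equivariant {act : H → Ω → Ω} {m : Measure Ω} (hm0 : m ≠ 0)
    (hinv : ∀ h, MeasurePreserving (act h) m m) {f : Ω → H} (hf : Measurable f)
    (hfe : ∀ h, ∀ᵐ ω ∂m, f (act h ω) = h * f ω) {ρ : H → P} {Ψ : Ω → P} (hΨ : Measurable Ψ)
    (he : ∀ h, ∀ᵐ ω ∂m, Ψ (act h ω) = Ψ ω * (ρ h)⁻¹)
    (hfin : ∀ x : P, ∃ U : Set P, IsOpen U ∧ x ∈ U ∧ m.map Ψ U < ∞) :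
    ∃ V ∈ 𝓝 (1 : P), ∃ C : Set H, IsCompact C ∧ ρ ⁻¹' V ⊆ C := by
  have hne : m.map Ψ Set.univ ≠ 0 := by
    rw [Measure.map_apply hΨ MeasurableSet.univ]
    simpa using hm0
  obtain ⟨x, -, hx⟩ := exists_mem_forall_mem_nhdsWithin_pos_measure hne
  obtain ⟨U, hUo, hxU, hUfin⟩ := hfin x
  have hcont : Filter.Tendsto (fun p : P × P => p.1 * p.2⁻¹) (𝓝 x ×ˢ 𝓝 1) (𝓝 x) := by
    have : Continuous fun p : P × P => p.1 * p.2⁻¹ := continuous_fst.mul continuous_snd.inv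
    have h := this.tendsto (x, 1)
    rwa [nhds_prod_eq, inv_one, mul_one] at h
  obtain ⟨U₁, hU₁, V, hV, hUV⟩ := Filter.mem_prod_iff.1 (hcont (hUo.mem_nhds hxU))
  obtain ⟨U₂, hU₂₁, hU₂o, hxU₂⟩ := mem_nhds_iff.1 hU₁
  let E : Set Ω := Ψ ⁻¹' U
  let E₁ : Set Ω := Ψ ⁻¹' U₂
  have hE : MeasurableSet E := hΨ hUo.measurableSet
  have hE₁ : MeasurableSet E₁ := hΨ hU₂o.measurableSet
  have hEfin : m E ≠ ∞ := by
    rw [← Measure.map_apply hΨ hUo.measurableSet]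
    exact hUfin.ne
  have hE₁pos : m E₁ ≠ 0 := by
    rw [← Measure.map_apply hΨ hU₂o.measurableSet]
    exact (hx U₂ (mem_nhdsWithin_of_mem_nhds (hU₂o.mem_nhds hxU₂))).ne'
  let K := compactCovering H
  have hKm : ∀ n, MeasurableSet (f ⁻¹' K n) := fun n =>
    hf (isCompact_compactCovering H n).isClosed.measurableSet
  have hKu : ⋃ n, f ⁻¹' K n = Set.univ := by
    rw [← Set.preimage_iUnion, iUnion_compactCovering, Set.preimage_univ]
  obtain ⟨n, hn⟩ : ∃ n, m (E₁ ∩ f ⁻¹' K n) ≠ 0 := by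
    by_contra! h
    refine hE₁pos ?_
    rw [← Set.inter_univ E₁, ← hKu, Set.inter_iUnion]
    exact measure_iUnion_null h
  obtain ⟨n', hn'⟩ : ∃ n', m (E \ f ⁻¹' K n') < m (E₁ ∩ f ⁻¹' K n) := by
    have hanti : Antitone fun k => E \ f ⁻¹' K k := fun k l hkl =>
      Set.sdiff_subset_sdiff_right (Set.preimage_mono (compactCovering_subset H hkl))
    have hlim := tendsto_measure_iInter_atTop (μ := m)
      (fun k => (hE.diff (hKm k)).nullMeasurableSet) hanti
      ⟨0, ((measure_mono Set.sdiff_subset).trans_lt hEfin.lt_top).ne⟩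
    rw [← Set.sdiff_iUnion, hKu, Set.sdiff_univ, measure_empty] at hlim
    exact (hlim.eventually_lt_const hn.bot_lt).exists
  refine ⟨V, hV, K n' * (K n)⁻¹,
    (isCompact_compactCovering H n').mul (isCompact_compactCovering H n).inv, fun h hh => ?_⟩
  by_contra hcon
  have hsub : ∀ᵐ ω ∂m, ω ∈ E₁ ∩ f ⁻¹' K n → ω ∈ act h ⁻¹' (E \ f ⁻¹' K n') := by
    filter_upwards [hfe h, he h] with ω h1 h2 hω
    refine ⟨?_, fun h3 => hcon ⟨h * f ω, ?_, (f ω)⁻¹, ?_, by simp⟩⟩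
    · change Ψ (act h ω) ∈ U
      rw [h2]
      exact hUV (Set.mk_mem_prod (hU₂₁ hω.1) hh)
    · rw [← h1]
      exact h3
    · simpa using hω.2
  have h4 : m (E₁ ∩ f ⁻¹' K n) ≤ m (act h ⁻¹' (E \ f ⁻¹' K n')) := measure_mono_ae hsub
  rw [(hinv h).measure_preimage (hE.diff (hKm n')).nullMeasurableSet] at h4
  exact absurd hn' (not_lt.2 h4)

/-- A continuous homomorphism is proper as soon as some neighbourhood of the identity has relatively
compact preimage. -/
theorem isCompact_ker_and_isClosed_range (ρ : H →ₜ* P) {V : Set P} (hV : V ∈ 𝓝 1) {C : Set H}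
    (hC : IsCompact C) (hVC : ρ ⁻¹' V ⊆ C) :
    IsCompact ((ρ : H →* P).ker : Set H) ∧ IsClosed ((ρ : H →* P).range : Set P) := by
  have hcont : Continuous ρ := ρ.continuous_toFun
  constructor
  · have hcl : IsClosed ((ρ : H →* P).ker : Set H) := isClosed_singleton.preimage hcont
    refine hC.of_isClosed_subset hcl fun h hh => hVC ?_
    have : ρ h = 1 := hh
    rw [Set.mem_preimage, this]
    exact mem_of_mem_nhds hV
  · refine isClosed_of_closure_subset fun x hx => ?_
    obtain ⟨V', hV'V, hV'o, hV'1⟩ := mem_nhds_iff.1 hV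
    have hN : (fun y => y⁻¹ * x) ⁻¹' V' ∈ 𝓝 x :=
      (hV'o.preimage (continuous_inv.mul continuous_const)).mem_nhds (by simpa using hV'1)
    obtain ⟨_, hyV, h, rfl⟩ := mem_closure_iff_nhds.1 hx _ hN
    have h1 : (ρ h)⁻¹ * x ∈ closure (V' ∩ (ρ : H →* P).range) := by
      refine hV'o.inter_closure ⟨hyV, ?_⟩
      have h2 : (ρ h)⁻¹ * x ∈ (ρ : H →* P).range.topologicalClosure :=
        mul_mem (inv_mem (Subgroup.le_topologicalClosure _ ⟨h, rfl⟩)) hx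
      exact h2
    have h3 : V' ∩ (ρ : H →* P).range ⊆ ρ '' C := by
      rintro _ ⟨hkV, k, rfl⟩
      exact ⟨k, hVC (hV'V hkV), rfl⟩
    obtain ⟨k, -, hk⟩ := closure_minimal h3 (hC.image hcont).isClosed h1
    refine ⟨h * k, ?_⟩
    change ρ (h * k) = x
    rw [map_mul, hk, mul_inv_cancel_left]

end Proper

section Image

variable {G H Ω P : Type u}
  [Group G] [TopologicalSpace G] [IsTopologicalGroup G] [LocallyCompactSpace G]
  [SecondCountableTopology G] [T2Space G] [MeasurableSpace G] [BorelSpace G]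
  [Group H] [TopologicalSpace H] [IsTopologicalGroup H] [LocallyCompactSpace H]
  [SecondCountableTopology H] [T2Space H] [MeasurableSpace H] [BorelSpace H]
  [MeasurableSpace Ω] [MulAction (G × H) Ω]
  {mG : Measure G} [mG.IsHaarMeasure] [mG.IsMulRightInvariant]
  {mH : Measure H} [mH.IsHaarMeasure] [mH.IsMulRightInvariant] {m : Measure Ω}
  [Group P] [TopologicalSpace P] [IsTopologicalGroup P] [PolishSpace P]
  [MeasurableSpace P] [BorelSpace P]

/-- A weight of finite total mass for left translations by the image of `π`. -/
theorem exists_weight_mul_left (hm : IsCoupling mG mH m) {π : G →ₜ* P}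
    (hk : IsCompact ((π : G →* P).ker : Set G)) (hr : IsClosed ((π : G →* P).range : Set P))
    {Ψ : Ω → P} (hΨ : Measurable Ψ) (he : ∀ g : G, ∀ᵐ ω ∂m, Ψ ((g, (1 : H)) • ω) = π g * Ψ ω) :
    ∃ (f : P → (π : G →* P).range) (κ : (π : G →* P).range → ℝ≥0∞), Measurable f ∧
      (∀ (a : (π : G →* P).range) (x : P), f (a * x) = a * f x) ∧ Measurable κ ∧
      ∫⁻ a, κ a ∂(mG.map (π : G →* P).rangeRestrict) = 1 ∧ ∫⁻ x, κ (f x) ∂(m.map Ψ) ≠ ∞ := by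
  have := hm.sFinite
  have := π.locallyCompactSpace_range hr
  have := π.isHaarMeasure_map_rangeRestrict mG hk hr
  have := π.isMulRightInvariant_map_rangeRestrict mG
  have := isInvInvariant_of_isMulRightInvariant mG
  obtain ⟨⟨a, ha, hafin⟩, -⟩ := hm.exists_weights
  obtain ⟨f, hf, hfe⟩ := exists_measurable_equivariant _ hr
  obtain ⟨κ, hκ, hκ1⟩ :=
    exists_measurable_lintegral_eq_one (mG.map (π : G →* P).rangeRestrict)
  refine ⟨f, κ, hf, hfe, hκ, hκ1, ?_⟩
  have hcont : Continuous (π : G →* P).rangeRestrict := π.continuous_toFun.subtype_mk _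
  have := lintegral_map_weight (φ := (π : G →* P).rangeRestrict)
    (actK := fun (a : (π : G →* P).range) (x : P) => (a : P) * x) hm.isMeasurableAction_left
    (fun g => hm.measurePreserving_smul (g, 1)) ha hcont.measurable
    (isMeasurableAction_mul_left (π : G →* P).range).measurable hΨ he (v := fun x => κ (f x))
    (hκ.comp hf) fun x => by
      simp only [hfe]
      rw [lintegral_mul_right_eq_self κ, hκ1]
  rwa [this]

/-- A weight of finite total mass for right translations by the image of `ρ`. -/
theorem exists_weight_mul_right (hm : IsCoupling mG mH m) {ρ : H →ₜ* P}
    (hk : IsCompact ((ρ : H →* P).ker : Set H)) (hr : IsClosed ((ρ : H →* P).range : Set P))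
    {Ψ : Ω → P} (hΨ : Measurable Ψ)
    (he : ∀ h : H, ∀ᵐ ω ∂m, Ψ (((1 : G), h) • ω) = Ψ ω * (ρ h)⁻¹) :
    ∃ (f : P → (ρ : H →* P).range) (κ : (ρ : H →* P).range → ℝ≥0∞), Measurable f ∧
      (∀ (b : (ρ : H →* P).range) (x : P), f (x * (b : P)⁻¹) = b * f x) ∧ Measurable κ ∧
      ∫⁻ b, κ b ∂(mH.map (ρ : H →* P).rangeRestrict) = 1 ∧ ∫⁻ x, κ (f x) ∂(m.map Ψ) ≠ ∞ := by
  have := hm.sFinite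
  have := ρ.locallyCompactSpace_range hr
  have := ρ.isHaarMeasure_map_rangeRestrict mH hk hr
  have := ρ.isMulRightInvariant_map_rangeRestrict mH
  have := isInvInvariant_of_isMulRightInvariant mH
  obtain ⟨-, b, -, hb, hbfin, -, -⟩ := hm.exists_weights
  obtain ⟨f, hf, hfe⟩ := exists_measurable_equivariant _ hr
  have hfe' : ∀ (b : (ρ : H →* P).range) (x : P), f (x * (b : P)⁻¹)⁻¹ = b * f x⁻¹ := fun b x => by
    rw [mul_inv_rev, inv_inv, hfe]
  obtain ⟨κ, hκ, hκ1⟩ :=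
    exists_measurable_lintegral_eq_one (mH.map (ρ : H →* P).rangeRestrict)
  refine ⟨fun x => f x⁻¹, κ, hf.comp measurable_inv, hfe', hκ, hκ1, ?_⟩
  have hcont : Continuous (ρ : H →* P).rangeRestrict := ρ.continuous_toFun.subtype_mk _
  have := lintegral_map_weight (φ := (ρ : H →* P).rangeRestrict)
    (actK := fun (b : (ρ : H →* P).range) (x : P) => x * (b : P)⁻¹) hm.isMeasurableAction_right
    (fun h => hm.measurePreserving_smul (1, h)) hb hcont.measurable
    (isMeasurableAction_mul_right (ρ : H →* P).range).measurable hΨ he (v := fun x => κ (f x⁻¹))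
    (hκ.comp (hf.comp measurable_inv)) fun x => by
      simp only [hfe']
      rw [lintegral_mul_right_eq_self κ, hκ1]
  rwa [this]

/-- If `π` has compact kernel and closed image, then so does `ρ`. -/
theorem isCompact_ker_and_isClosed_range_of_coupling (hm : IsCoupling mG mH m) {π : G →ₜ* P}
    {ρ : H →ₜ* P} {Ψ : Ω → P} (hΨ : Measurable Ψ)
    (he : ∀ (g : G) (h : H), ∀ᵐ ω ∂m, Ψ ((g, h) • ω) = π g * Ψ ω * (ρ h)⁻¹)
    (hk : IsCompact ((π : G →* P).ker : Set G)) (hr : IsClosed ((π : G →* P).range : Set P)) :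
    IsCompact ((ρ : H →* P).ker : Set H) ∧ IsClosed ((ρ : H →* P).range : Set P) := by
  have := hm.sFinite
  have := π.locallyCompactSpace_range hr
  have := π.isHaarMeasure_map_rangeRestrict mG hk hr
  have := π.isMulRightInvariant_map_rangeRestrict mG
  have heG : ∀ g : G, ∀ᵐ ω ∂m, Ψ ((g, (1 : H)) • ω) = π g * Ψ ω := fun g => by
    filter_upwards [he g 1] with ω hω
    rw [hω, map_one, inv_one, mul_one]
  have heH : ∀ h : H, ∀ᵐ ω ∂m, Ψ (((1 : G), h) • ω) = Ψ ω * (ρ h)⁻¹ := fun h => by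
    filter_upwards [he 1 h] with ω hω
    rw [hω, map_one, one_mul]
  obtain ⟨f, κ, hf, hfe, hκ, hκ1, hfin⟩ := exists_weight_mul_left hm hk hr hΨ heG
  obtain ⟨-, -, f', -, -, hf', hfe'⟩ := hm.exists_weights
  have hinv : ∀ a : (π : G →* P).range,
      MeasurePreserving (fun x => (a : P) * x) (m.map Ψ) (m.map Ψ) := by
    rintro ⟨_, g, rfl⟩
    refine ⟨measurable_const_mul _, ?_⟩
    rw [Measure.map_map (measurable_const_mul _) hΨ]
    have h1 : (fun x => π g * x) ∘ Ψ =ᵐ[m] Ψ ∘ fun ω => (g, (1 : H)) • ω :=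
      (heG g).mono fun ω hω => hω.symm
    change m.map ((fun x => π g * x) ∘ Ψ) = _
    rw [Measure.map_congr h1, ← Measure.map_map hΨ (hm.measurePreserving_smul (g, 1)).measurable,
      (hm.measurePreserving_smul (g, 1)).map_eq]
  have : SecondCountableTopology (π : G →* P).range :=
    TopologicalSpace.Subtype.secondCountableTopology _
  obtain ⟨V, hV, C, hC, hVC⟩ := exists_isCompact_of_equivariant hm.ne_zero
    (fun h => hm.measurePreserving_smul (1, h)) hf' hfe' hΨ heH
    (exists_nhds_measure_lt_top _ (mG.map (π : G →* P).rangeRestrict) hinv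
      (isWeight_of_equivariant hf hfe hκ hκ1) hfin)
  exact isCompact_ker_and_isClosed_range ρ hV hC hVC

/-- The image measure `Ψ_* m` makes the target group a coupling of the images of `π` and `ρ`. -/
theorem exists_image_coupling (hm : IsCoupling mG mH m) {π : G →ₜ* P}
    {ρ : H →ₜ* P} {Ψ : Ω → P} (hΨ : Measurable Ψ)
    (he : ∀ (g : G) (h : H), ∀ᵐ ω ∂m, Ψ ((g, h) • ω) = π g * Ψ ω * (ρ h)⁻¹)
    (hπk : IsCompact ((π : G →* P).ker : Set G)) (hπr : IsClosed ((π : G →* P).range : Set P))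
    (hρk : IsCompact ((ρ : H →* P).ker : Set H)) (hρr : IsClosed ((ρ : H →* P).range : Set P)) :
    (∀ (g : G) (h : H), (m.map Ψ).map (fun x => π g * x * ρ h) = m.map Ψ) ∧
      (∃ ν : Measure (Quotient (QuotientGroup.rightRel (π : G →* P).range)),
        IsFiniteMeasure ν ∧ IsQuotientMeasure (QuotientGroup.rightRel (π : G →* P).range)
          (fun (k : (π : G →* P).range) (x : P) => (k : P) * x)
          (mG.map (π : G →* P).rangeRestrict) (m.map Ψ) ν) ∧
      (∃ μ : Measure (Quotient (QuotientGroup.leftRel (ρ : H →* P).range)),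
        IsFiniteMeasure μ ∧ IsQuotientMeasure (QuotientGroup.leftRel (ρ : H →* P).range)
          (fun (k : (ρ : H →* P).range) (x : P) => x * (k : P))
          (mH.map (ρ : H →* P).rangeRestrict) (m.map Ψ) μ) ∧
      IsCoupling (act := biMulAction (π : G →* P).range (ρ : H →* P).range)
        (mG.map (π : G →* P).rangeRestrict) (mH.map (ρ : H →* P).rangeRestrict) (m.map Ψ) := by
  have := hm.sFinite
  have := π.locallyCompactSpace_range hπr
  have := π.isHaarMeasure_map_rangeRestrict mG hπk hπr
  have := π.isMulRightInvariant_map_rangeRestrict mG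
  have := ρ.locallyCompactSpace_range hρr
  have := ρ.isHaarMeasure_map_rangeRestrict mH hρk hρr
  have := ρ.isMulRightInvariant_map_rangeRestrict mH
  set mA := mG.map (π : G →* P).rangeRestrict
  set mB := mH.map (ρ : H →* P).rangeRestrict
  have : SecondCountableTopology (π : G →* P).range :=
    TopologicalSpace.Subtype.secondCountableTopology _
  have : SecondCountableTopology (ρ : H →* P).range :=
    TopologicalSpace.Subtype.secondCountableTopology _
  have := isInvInvariant_of_isMulRightInvariant mA
  have := isInvInvariant_of_isMulRightInvariant mB
  have hinv : ∀ (g : G) (h : H), (m.map Ψ).map (fun x => π g * x * ρ h) = m.map Ψ := by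
    intro g h
    have hmeas : Measurable fun x : P => π g * x * ρ h :=
      (measurable_const_mul _).mul_const _
    rw [Measure.map_map hmeas hΨ]
    have h1 : (fun x => π g * x * ρ h) ∘ Ψ =ᵐ[m] Ψ ∘ fun ω => (g, h⁻¹) • ω :=
      (he g h⁻¹).mono fun ω hω => by simp [hω]
    rw [Measure.map_congr h1, ← Measure.map_map hΨ (hm.measurePreserving_smul _).measurable,
      (hm.measurePreserving_smul _).map_eq]
  have hinvA : ∀ a : (π : G →* P).range,
      MeasurePreserving (fun x => (a : P) * x) (m.map Ψ) (m.map Ψ) := by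
    rintro ⟨_, g, rfl⟩
    refine ⟨measurable_const_mul _, ?_⟩
    simpa using hinv g 1
  have hinvB : ∀ b : (ρ : H →* P).range,
      MeasurePreserving (fun x => x * (b : P)⁻¹) (m.map Ψ) (m.map Ψ) := by
    rintro ⟨_, h, rfl⟩
    refine ⟨measurable_mul_const _, ?_⟩
    simpa using hinv 1 h⁻¹
  obtain ⟨f, κ, hf, hfe, hκ, hκ1, hfin⟩ := exists_weight_mul_left hm hπk hπr hΨ fun g => by
    filter_upwards [he g 1] with ω hω
    rw [hω, map_one, inv_one, mul_one]
  obtain ⟨f', κ', hf', hfe', hκ', hκ1', hfin'⟩ :=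
    exists_weight_mul_right hm hρk hρr hΨ fun h => by
      filter_upwards [he 1 h] with ω hω
      rw [hω, map_one, one_mul]
  have hactA := isMeasurableAction_mul_left (π : G →* P).range
  have hactB := isMeasurableAction_mul_right (ρ : H →* P).range
  have hfinite : IsFiniteMeasure ((m.map Ψ).withDensity fun x => κ (f x)) :=
    isFiniteMeasure_withDensity hfin
  have hfinite' : IsFiniteMeasure ((m.map Ψ).withDensity fun x => κ' (f' x)) :=
    isFiniteMeasure_withDensity hfin'
  refine ⟨hinv, ⟨((m.map Ψ).withDensity fun x => κ (f x)).map (Quotient.mk _),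
    Measure.isFiniteMeasure_map _ _, isQuotientMeasure_map_mk hactA hinvA
    (isWeight_of_equivariant hf hfe hκ hκ1) _ fun x y => ?_⟩,
    ⟨((m.map Ψ).withDensity fun x => κ' (f' x)).map (Quotient.mk _),
    Measure.isFiniteMeasure_map _ _, fun F hF => (isQuotientMeasure_map_mk hactB hinvB
    (isWeight_of_equivariant hf' hfe' hκ' hκ1')
      (QuotientGroup.leftRel (ρ : H →* P).range) (fun x y => ?_) F hF).trans ?_⟩, ?_⟩
  · rw [QuotientGroup.rightRel_apply]
    exact ⟨fun h => ⟨⟨_, h⟩, by simp⟩, by rintro ⟨a, rfl⟩; simp⟩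
  · rw [QuotientGroup.leftRel_apply]
    refine ⟨fun h => ⟨⟨_, h⟩⁻¹, by simp⟩, ?_⟩
    rintro ⟨a, rfl⟩
    simp
  · refine lintegral_congr fun q => ?_
    exact lintegral_inv_eq_self (μ := mB) fun k : (ρ : H →* P).range => F (q.out * (k : P))
  · let := biMulAction (π : G →* P).range (ρ : H →* P).range
    have hl : (fun (a : (π : G →* P).range) (x : P) => (a, (1 : (ρ : H →* P).range)) • x) =
        fun (a : (π : G →* P).range) (x : P) => (a : P) * x := by
      funext a x
      change (a : P) * x * ((1 : (ρ : H →* P).range) : P)⁻¹ = _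
      simp
    have hr : (fun (b : (ρ : H →* P).range) (x : P) => ((1 : (π : G →* P).range), b) • x) =
        fun (b : (ρ : H →* P).range) (x : P) => x * (b : P)⁻¹ := by
      funext b x
      change ((1 : (π : G →* P).range) : P) * x * (b : P)⁻¹ = _
      simp
    refine ⟨?_, ?_, ?_, ?_, ?_⟩
    · rw [Ne, Measure.map_eq_zero_iff hΨ.aemeasurable]
      exact hm.ne_zero
    · exact ((measurable_subtype_coe.comp measurable_fst.fst).mul measurable_snd).mul
        (measurable_subtype_coe.comp measurable_fst.snd).inv
    · rintro ⟨⟨_, g, rfl⟩, ⟨_, h, rfl⟩⟩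
      change (m.map Ψ).map (fun x => π g * x * (ρ h)⁻¹) = _
      rw [← map_inv]
      exact hinv g h⁻¹
    · rw [hl]
      obtain ⟨ν, hν, hiso⟩ := isFundamentalIso_of_equivariant hactA hinvA hf hfe hκ hκ1 hfin
      exact ⟨P, _, inferInstance, ν, _, _, hν, hiso⟩
    · rw [hr]
      obtain ⟨ν, hν, hiso⟩ := isFundamentalIso_of_equivariant hactB hinvB hf' hfe' hκ' hκ1' hfin'
      exact ⟨P, _, inferInstance, ν, _, _, hν, hiso⟩

/-- A strictly equivariant map, set to `1` off an invariant conull set, is constant on the orbits of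
`ker π × ker ρ`, so that it factors through the space of these orbits. -/
theorem exists_factor_map {π : G →ₜ* P} {ρ : H →ₜ* P} {Ψ : Ω → P} {D : Set Ω} (hΨ : Measurable Ψ)
    (hD : ∀ᵐ ω ∂m, ω ∈ D) (hDinv : ∀ (a : G × H) (ω : Ω), a • ω ∈ D ↔ ω ∈ D)
    (he : ∀ ω ∈ D, ∀ g h, Ψ ((g, h) • ω) = π g * Ψ ω * (ρ h)⁻¹) (hΨ1 : ∀ ω ∉ D, Ψ ω = 1) :
    ∃ F : Quotient (MulAction.orbitRel ((π : G →* P).ker.prod (ρ : H →* P).ker) Ω) → P,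
      MeasurePreserving F (m.map (Quotient.mk _)) (m.map Ψ) ∧
      ∀ᵐ ω ∂m, ∀ (g : G) (h : H),
        F (Quotient.mk _ ((g, h) • ω)) = π g * F (Quotient.mk _ ω) * (ρ h)⁻¹ := by
  let F : Quotient (MulAction.orbitRel ((π : G →* P).ker.prod (ρ : H →* P).ker) Ω) → P :=
    Quotient.lift Ψ (by
      rintro _ ω ⟨⟨⟨g, h⟩, hgh⟩, rfl⟩
      obtain ⟨hg, hh⟩ := Subgroup.mem_prod.1 hgh
      have hg' : π g = 1 := hg
      have hh' : ρ h = 1 := hh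
      change Ψ ((g, h) • ω) = Ψ ω
      by_cases hω : ω ∈ D
      · rw [he ω hω, hg', hh']
        simp
      · rw [hΨ1 ω hω, hΨ1 _ (mt (hDinv _ _).1 hω)])
  have hF : Measurable F := measurable_from_quotient.2 hΨ
  refine ⟨F, ⟨hF, ?_⟩, ?_⟩
  · rw [Measure.map_map hF measurable_quotient_mk'']
    rfl
  · filter_upwards [hD] with ω hω g h using he ω hω g h

end Image

/-! ### The extension attached to a tautening kernel -/

section Extension

variable {G H Ω : Type u}
  [Group G] [TopologicalSpace G] [IsTopologicalGroup G] [LocallyCompactSpace G]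
  [SecondCountableTopology G] [T2Space G] [MeasurableSpace G] [BorelSpace G]
  [Group H] [TopologicalSpace H] [IsTopologicalGroup H] [LocallyCompactSpace H]
  [SecondCountableTopology H] [T2Space H] [MeasurableSpace H] [BorelSpace H]
  [MeasurableSpace Ω] [StandardBorelSpace Ω] [MulAction (G × H) Ω]
  {mG : Measure G} [mG.IsHaarMeasure] [mG.IsMulRightInvariant]
  {mH : Measure H} [mH.IsHaarMeasure] [mH.IsMulRightInvariant] {m : Measure Ω}

/-- The quotient measure on `G ⧸ B` of a left invariant measure on `G` is invariant. -/
theorem IsQuotientMeasure.map_smul {B : Subgroup G} (hB : IsClosed (B : Set G))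
    {mB : Measure B} [SFinite mB] [mB.IsInvInvariant] [mB.IsMulRightInvariant] {κ : B → ℝ≥0∞}
    (hκ : Measurable κ) (hκ1 : ∫⁻ b, κ b ∂mB = 1) {mbar : Measure G} [SFinite mbar]
    (hinv : ∀ g : G, mbar.map (fun x => g * x) = mbar)
    {μ : Measure (Quotient (QuotientGroup.leftRel B))}
    (hμ : IsQuotientMeasure (QuotientGroup.leftRel B) (fun (b : B) (x : G) => x * (b : G))
      mB mbar μ) (g : G) :
    μ.map (fun q : G ⧸ B => g • q) = μ := by
  have : PolishSpace G := polishSpace_of_locallyCompact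
  obtain ⟨f, hf, hfe⟩ := exists_measurable_equivariant B hB
  have hg : Measurable fun q : G ⧸ B => g • q :=
    measurable_from_quotient.2 ((measurable_quotient_mk'' (s := QuotientGroup.leftRel B)).comp
      (measurable_const_mul g))
  have hmk : ∀ (b : B) (x : G), Quotient.mk (QuotientGroup.leftRel B) (x * (b : G)) =
      Quotient.mk (QuotientGroup.leftRel B) x := fun b x =>
    Quotient.sound (QuotientGroup.leftRel_apply.2 (by simp))
  have hv : ∀ y : G, Measurable fun x : G => κ (f (x⁻¹ * y)) := fun y =>
    hκ.comp (hf.comp (measurable_inv.mul_const y))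
  have hv1 : ∀ y x : G, ∫⁻ b : B, κ (f ((x * (b : G))⁻¹ * y)) ∂mB = 1 := by
    intro y x
    have h1 : ∀ b : B, κ (f ((x * (b : G))⁻¹ * y)) = κ (b⁻¹ * f (x⁻¹ * y)) := fun b => by
      rw [← hfe]
      simp [mul_assoc]
    simp_rw [h1]
    rw [lintegral_inv_eq_self (μ := mB) fun b => κ (b * f (x⁻¹ * y)),
      lintegral_mul_right_eq_self, hκ1]
  ext E hE
  rw [Measure.map_apply hg hE, hμ.apply_eq hmk (hv g⁻¹) (hv1 g⁻¹) (hg hE),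
    hμ.apply_eq hmk (hv 1) (hv1 1) hE]
  conv_rhs => rw [← hinv g]
  have hmeas : Measurable fun x : G =>
      E.indicator (1 : G ⧸ B → ℝ≥0∞) (Quotient.mk (QuotientGroup.leftRel B) x) *
        κ (f (x⁻¹ * 1)) :=
    ((measurable_one.indicator hE).comp measurable_quotient_mk'').mul (hv 1)
  rw [lintegral_map hmeas (measurable_const_mul g)]
  refine lintegral_congr fun x => ?_
  simp only [mul_inv_rev, mul_one]
  rfl

/-- A tautening kernel for the identity of `G` exhibits `H` as an extension, by a compact group, of
a closed subgroup of finite covolume of `G`. -/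
theorem IsTauteningKernel.isCompactExtensionOfFiniteCovolume (hm : IsCoupling mG mH m)
    (hICC : IsStronglyICCRelative (MonoidHom.id G).range) {Φ : Ω × Ω → G}
    (hΦ : IsTauteningKernel (H := H) (MonoidHom.id G) m Φ) :
    IsCompactExtensionOfFiniteCovolume G H := by
  have : PolishSpace G := polishSpace_of_locallyCompact
  have hsf := hm.sFinite
  let π : G →ₜ* G := ContinuousMonoidHom.id G
  have hπid : (π : G →* G) = MonoidHom.id G := rfl
  obtain ⟨ρ, Ψ, D, hΨ, -, hD, -, hΨe, -, -⟩ := hΦ.exists_hom (π := π) hm hICC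
  have he : ∀ (g : G) (h : H), ∀ᵐ ω ∂m, Ψ ((g, h) • ω) = π g * Ψ ω * (ρ h)⁻¹ := fun g h => by
    filter_upwards [hD] with ω hω using hΨe ω hω g h
  have hπk : IsCompact ((π : G →* G).ker : Set G) := by
    rw [hπid, MonoidHom.ker_id]
    exact isCompact_singleton
  have hπr : IsClosed ((π : G →* G).range : Set G) := by
    have : ((π : G →* G).range : Set G) = Set.univ := Set.range_id
    rw [this]
    exact isClosed_univ
  obtain ⟨hρk, hρr⟩ := isCompact_ker_and_isClosed_range_of_coupling hm hΨ he hπk hπr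
  obtain ⟨hinv, -, ⟨μ, hμfin, hμ⟩, -⟩ := exists_image_coupling hm hΨ he hπk hπr hρk hρr
  have := ρ.locallyCompactSpace_range hρr
  have := ρ.isHaarMeasure_map_rangeRestrict mH hρk hρr
  have := ρ.isMulRightInvariant_map_rangeRestrict mH
  have : SecondCountableTopology (ρ : H →* G).range :=
    TopologicalSpace.Subtype.secondCountableTopology _
  have := isInvInvariant_of_isMulRightInvariant (mH.map (ρ : H →* G).rangeRestrict)
  obtain ⟨κ, hκ, hκ1⟩ :=
    exists_measurable_lintegral_eq_one (mH.map (ρ : H →* G).rangeRestrict)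
  have hμinv := hμ.map_smul hρr hκ hκ1 (fun g => by
    have h1 := hinv g 1
    simp only [map_one, mul_one] at h1
    exact h1)
  have hμ0 : μ ≠ 0 := by
    rintro rfl
    have h1 := hμ (fun _ => 1) measurable_const
    rw [lintegral_zero_measure, lintegral_const, one_mul, Measure.measure_univ_eq_zero] at h1
    exact hm.ne_zero ((Measure.map_eq_zero_iff hΨ.aemeasurable).1 h1)
  have hμ1 : μ Set.univ ≠ 0 := by rwa [Ne, Measure.measure_univ_eq_zero]
  refine ⟨(ρ : H →* G).range,
    ⟨(ρ : H →* G).rangeRestrict, ρ.continuous_toFun.subtype_mk _⟩, ?_,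
    MonoidHom.rangeRestrict_surjective _, hρr, (μ Set.univ)⁻¹ • μ, ⟨?_⟩, fun g => ?_⟩
  · have : ((ρ : H →* G).rangeRestrict).ker = (ρ : H →* G).ker := MonoidHom.ker_rangeRestrict _
    change IsCompact (((ρ : H →* G).rangeRestrict).ker : Set H)
    rw [this]
    exact hρk
  · rw [Measure.smul_apply, smul_eq_mul, ENNReal.inv_mul_cancel hμ1 (measure_ne_top _ _)]
  · rw [Measure.map_smul, hμinv g]

end Extension

/-! ### Taut groups are strongly ICC -/

/-- The product `G × G`, made into a separate type in order to carry the action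
`(g₁, g₂) (x, y) = (g₁ x g₂⁻¹, g₂ y g₂⁻¹)` of `G × G`. -/
def ConjProd (G : Type u) : Type u := G × G

namespace ConjProd

variable {G : Type u} [Group G]

instance [MeasurableSpace G] : MeasurableSpace (ConjProd G) :=
  inferInstanceAs (MeasurableSpace (G × G))

instance [MeasurableSpace G] [StandardBorelSpace G] : StandardBorelSpace (ConjProd G) :=
  inferInstanceAs (StandardBorelSpace (G × G))

instance : MulAction (G × G) (ConjProd G) where
  smul a w := (a.1 * w.1 * a.2⁻¹, a.2 * w.2 * a.2⁻¹)
  one_smul w := by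
    change ((1 : G) * w.1 * (1 : G)⁻¹, (1 : G) * w.2 * (1 : G)⁻¹) = ((w.1, w.2) : G × G)
    simp
  mul_smul a b w := by
    change ((a.1 * b.1) * w.1 * (a.2 * b.2)⁻¹, (a.2 * b.2) * w.2 * (a.2 * b.2)⁻¹) =
      (a.1 * (b.1 * w.1 * b.2⁻¹) * a.2⁻¹, a.2 * (b.2 * w.2 * b.2⁻¹) * a.2⁻¹)
    simp [mul_assoc]

theorem smul_def (a : G × G) (w : ConjProd G) :
    a • w = ((a.1 * w.1 * a.2⁻¹, a.2 * w.2 * a.2⁻¹) : G × G) := rfl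

/-- The fundamental isomorphism for the action of the second factor of `G × G` on `ConjProd G`. -/
def rightIso (p : G × G) : ConjProd G := (p.1⁻¹, p.1 * p.2 * p.1⁻¹)

/-- The inverse of `ConjProd.rightIso`. -/
def rightIsoInv (w : ConjProd G) : G × G := (w.1⁻¹, w.1 * w.2 * w.1⁻¹)

variable [TopologicalSpace G] [IsTopologicalGroup G] [LocallyCompactSpace G]
  [SecondCountableTopology G] [T2Space G] [MeasurableSpace G] [BorelSpace G]
  {mG : Measure G} [mG.IsHaarMeasure] [mG.IsMulRightInvariant]
  {μ : Measure G} [IsProbabilityMeasure μ]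

theorem isFundamentalIso_left :
    IsFundamentalIso (fun (g : G) (w : ConjProd G) => (g, (1 : G)) • w) mG μ
      (mG.prod μ : Measure (G × G)) (fun p : G × G => p) (fun w => w) where
  measurePreserving := .id _
  measurable_inv := measurable_id
  left_inv := .of_forall fun _ => rfl
  right_inv := .of_forall fun _ => rfl
  equivariant k := .of_forall fun p => by
    change ((k * p.1, p.2) : G × G) = (k * p.1 * 1⁻¹, 1 * p.2 * 1⁻¹)
    simp

theorem isFundamentalIso_right (hμ : ∀ g : G, μ.map (fun x => g * x * g⁻¹) = μ) :
    IsFundamentalIso (fun (g : G) (w : ConjProd G) => ((1 : G), g) • w) mG μ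
      (mG.prod μ : Measure (G × G)) rightIso rightIsoInv where
  measurePreserving := by
    have := isInvInvariant_of_isMulRightInvariant mG
    have h1 : MeasurePreserving (fun p : G × G => (p.1⁻¹, p.1 * p.2 * p.1⁻¹))
        (mG.prod μ) (mG.prod μ) :=
      (Measure.measurePreserving_inv mG).skew_product
        (g := fun g x => g * x * g⁻¹)
        ((measurable_fst.mul measurable_snd).mul measurable_fst.inv)
        (.of_forall hμ)
    exact h1
  measurable_inv := by
    have h1 : Measurable fun p : G × G => (p.1⁻¹, p.1 * p.2 * p.1⁻¹) :=
      measurable_fst.inv.prodMk ((measurable_fst.mul measurable_snd).mul measurable_fst.inv)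
    exact h1
  left_inv := .of_forall fun p => by simp [rightIso, rightIsoInv, mul_assoc]
  right_inv := .of_forall fun p => by
    change (((p.1⁻¹)⁻¹, p.1⁻¹ * (p.1 * p.2 * p.1⁻¹) * (p.1⁻¹)⁻¹) : G × G) = (p.1, p.2)
    simp [mul_assoc]
  equivariant k := .of_forall fun p => by
    change (((k * p.1)⁻¹, (k * p.1) * p.2 * (k * p.1)⁻¹) : G × G) =
      (1 * p.1⁻¹ * k⁻¹, k * (p.1 * p.2 * p.1⁻¹) * k⁻¹)
    simp [mul_assoc]

theorem isCoupling (hμ : ∀ g : G, μ.map (fun x => g * x * g⁻¹) = μ) :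
    IsCoupling (Ω := ConjProd G) mG mG (mG.prod μ : Measure (G × G)) where
  ne_zero h0 := by
    have h1 : (mG.prod μ) Set.univ = 0 := by
      have : (mG.prod μ : Measure (G × G)) = 0 := h0
      simp [this]
    rw [← Set.univ_prod_univ, Measure.prod_prod, measure_univ (μ := μ), mul_one,
      Measure.measure_univ_eq_zero] at h1
    exact NeZero.ne mG h1
  measurable_action := by
    have h1 : Measurable fun p : (G × G) × (G × G) =>
        (p.1.1 * p.2.1 * p.1.2⁻¹, p.1.2 * p.2.2 * p.1.2⁻¹) := by fun_prop
    exact h1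
  invariant a := by
    have h1 : MeasurePreserving (fun x : G => a.1 * x * a.2⁻¹) mG mG :=
      (measurePreserving_mul_right mG a.2⁻¹).comp (measurePreserving_mul_left mG a.1)
    have h2 : MeasurePreserving (fun x : G => a.2 * x * a.2⁻¹) μ μ :=
      ⟨(measurable_const_mul _).mul_const _, hμ a.2⟩
    exact (h1.prod h2).map_eq
  left := by
    have : PolishSpace G := polishSpace_of_locallyCompact
    exact ⟨G, _, inferInstance, μ, _, _, inferInstance, isFundamentalIso_left⟩
  right := by
    have : PolishSpace G := polishSpace_of_locallyCompact
    exact ⟨G, _, inferInstance, μ, _, _, inferInstance, isFundamentalIso_right hμ⟩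

/-- The cocycles of this coupling are `(g, x) ↦ g`, of constant, hence bounded, word norm. -/
theorem isLpCoupling (p : ℝ≥0∞) {S : Set G} (hS : IsCompactGeneratingSet S)
    (hμ : ∀ g : G, μ.map (fun x => g * x * g⁻¹) = μ) :
    IsLpCoupling (Ω := ConjProd G) p mG mG (mG.prod μ : Measure (G × G)) where
  isCoupling := isCoupling hμ
  left := by
    have : PolishSpace G := polishSpace_of_locallyCompact
    refine ⟨G, _, inferInstance, μ, _, _, fun g _ => g, inferInstance, isFundamentalIso_left,
      ⟨measurable_fst, fun g => .of_forall fun q => ?_⟩,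
      S, hS, .of_forall fun g => (memLp_const _).2⟩
    change 1 * q.1 * g⁻¹ = q.1 * g⁻¹
    rw [one_mul]
  right := by
    have : PolishSpace G := polishSpace_of_locallyCompact
    refine ⟨G, _, inferInstance, μ, _, _, fun g _ => g, inferInstance, isFundamentalIso_right hμ,
      ⟨measurable_fst, fun g => .of_forall fun q => ?_⟩,
      S, hS, .of_forall fun g => (memLp_const _).2⟩
    change (g * q.1⁻¹ * 1⁻¹)⁻¹ = q.1 * g⁻¹
    simp

/-- On `ConjProd G` both `(x, y) ↦ x` and `(x, y) ↦ x y` are tautening maps, so that uniqueness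
forces `μ` to be the point mass at `1`. -/
theorem measure_singleton_one_ne_zero
    (h : IsTautRelative (Ω := ConjProd G) (MonoidHom.id G) (mG.prod μ : Measure (G × G))) :
    μ {1} ≠ 0 := by
  intro h0
  have h1 : IsTauteningMap (Ω := ConjProd G) (MonoidHom.id G) (mG.prod μ : Measure (G × G))
      fun w => w.1 :=
    ⟨(measurable_fst : Measurable fun w : G × G => w.1),
      .of_forall fun w g₁ g₂ => by simp [smul_def]⟩
  have h2 : IsTauteningMap (Ω := ConjProd G) (MonoidHom.id G) (mG.prod μ : Measure (G × G))
      fun w => w.1 * w.2 :=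
    ⟨(measurable_fst.mul measurable_snd : Measurable fun w : G × G => w.1 * w.2),
      .of_forall fun w g₁ g₂ => by simp [smul_def, mul_assoc]⟩
  have h3 : ∀ᵐ w ∂(mG.prod μ), w.1 = w.1 * w.2 := h.2 _ _ h1 h2
  have h4 : ∀ᵐ g ∂mG, False := by
    filter_upwards [Measure.ae_ae_of_ae_prod h3] with g hg
    have h5 : μ ({1}ᶜ : Set G) = 0 := mem_ae_iff.1 (by
      exact hg.mono fun y hy => (mul_eq_left.1 hy.symm :))
    have h6 : μ Set.univ = 0 := by
      rw [← Set.union_compl_self ({1} : Set G)]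
      exact measure_union_null h0 h5
    simp at h6
  obtain ⟨-, hf⟩ := h4.exists
  exact hf

end ConjProd

section ICC

variable {G : Type u} [Group G] [TopologicalSpace G] [IsTopologicalGroup G] [LocallyCompactSpace G]
  [SecondCountableTopology G] [T2Space G] [MeasurableSpace G] [BorelSpace G]
  {mG : Measure G} [mG.IsHaarMeasure] [mG.IsMulRightInvariant]

theorem IsTautGroup.isStronglyICCRelative (hG : IsTautGroup mG) :
    IsStronglyICCRelative (MonoidHom.id G).range := by
  have : PolishSpace G := polishSpace_of_locallyCompact
  rintro ⟨μ, hμ1, hμ0, hμ⟩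
  exact ConjProd.measure_singleton_one_ne_zero
    (hG (ConjProd G) _ (ConjProd.isCoupling fun g => hμ g ⟨g, rfl⟩)) hμ0

theorem IsPTautGroup.isStronglyICCRelative {p : ℝ≥0∞} (hG : IsPTautGroup p mG) {S : Set G}
    (hS : IsCompactGeneratingSet S) : IsStronglyICCRelative (MonoidHom.id G).range := by
  have : PolishSpace G := polishSpace_of_locallyCompact
  rintro ⟨μ, hμ1, hμ0, hμ⟩
  exact ConjProd.measure_singleton_one_ne_zero
    (hG (ConjProd G) _ (ConjProd.isLpCoupling p hS fun g => hμ g ⟨g, rfl⟩)) hμ0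

end ICC

/-! ### Topological models of measurable actions -/

/-- A map into a space of continuous functions is Borel if all its evaluations are. -/
theorem measurable_continuousMap_of_eval {W L E : Type*} [MeasurableSpace W] [TopologicalSpace L]
    [SecondCountableTopology L] [TopologicalSpace E]
    [TopologicalSpace.PseudoMetrizableSpace E] [MeasurableSpace E]
    [BorelSpace E] [SecondCountableTopology C(L, E)] [MeasurableSpace C(L, E)]
    [BorelSpace C(L, E)] {f : W → C(L, E)} (hf : ∀ x, Measurable fun w => f w x) :
    Measurable f := by
  let := TopologicalSpace.pseudoMetrizableSpacePseudoMetric E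
  rw [BorelSpace.measurable_eq (α := C(L, E)),
    borel_eq_generateFrom_of_subbasis (ContinuousMap.compactOpen_eq (X := L) (Y := E))]
  refine measurable_generateFrom ?_
  rintro _ ⟨K, hK, U, hU, rfl⟩
  obtain ⟨D, hDK, hDc, hD⟩ : ∃ D ⊆ K, D.Countable ∧ K ⊆ closure D := by
    obtain ⟨s, hsc, hsd⟩ := TopologicalSpace.exists_countable_dense K
    exact ⟨Subtype.val '' s, Subtype.coe_image_subset K s, hsc.image _, fun x hx =>
      image_closure_subset_closure_image continuous_subtype_val ⟨⟨x, hx⟩, hsd _, rfl⟩⟩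
  -- A compact subset of `U` has a uniform neighbourhood inside `U`, which can be tested on a
  -- countable dense subset of `K`.
  have key : f ⁻¹' {g | Set.MapsTo g K U} =
      ⋃ n : ℕ, ⋂ x ∈ D, {w | f w x ∈ {y | Metric.ball y (1 / (n + 1 : ℝ)) ⊆ U}} := by
    ext w
    simp only [Set.mem_preimage, Set.mem_ofPred_eq, Set.mem_iUnion, Set.mem_iInter]
    constructor
    · intro h
      obtain ⟨δ, hδ, hδU⟩ := (IsCompact.image hK (f w).continuous).exists_thickening_subset_open hU
        h.image_subset
      obtain ⟨n, hn⟩ := exists_nat_one_div_lt hδ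
      refine ⟨n, fun x hx => (Metric.ball_subset_ball hn.le).trans
        ((Metric.ball_subset_thickening (Set.mem_image_of_mem _ (hDK hx)) δ).trans hδU)⟩
    · rintro ⟨n, hn⟩ x hx
      have hpos : (0 : ℝ) < 1 / (n + 1) := Nat.one_div_pos_of_nat
      obtain ⟨y, hy, hyD⟩ := mem_closure_iff.1 (hD hx)
        ((f w) ⁻¹' Metric.ball (f w x) (1 / (n + 1 : ℝ)))
        (Metric.isOpen_ball.preimage (f w).continuous) (Metric.mem_ball_self hpos)
      exact hn y hyD (Metric.mem_ball'.2 hy)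
  rw [key]
  refine MeasurableSet.iUnion fun n => MeasurableSet.biInter hDc fun x _ => ?_
  refine hf x (IsClosed.measurableSet ?_)
  rw [← isOpen_compl_iff]
  have h1 : {y : E | Metric.ball y (1 / (n + 1 : ℝ)) ⊆ U}ᶜ =
      ⋃ z ∈ Uᶜ, Metric.ball z (1 / (n + 1 : ℝ)) := by
    ext y
    simp only [Set.mem_compl_iff, Set.mem_ofPred_eq, Set.not_subset, Set.mem_iUnion]
    exact ⟨fun ⟨z, hz, hzU⟩ => ⟨z, hzU, Metric.mem_ball'.2 hz⟩,
      fun ⟨z, hzU, hz⟩ => ⟨z, Metric.mem_ball'.2 hz, hzU⟩⟩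
  rw [h1]
  exact isOpen_biUnion fun z _ => Metric.isOpen_ball

section Pairing

variable {L : Type*} [MeasurableSpace L] {μ : Measure L}

theorem integrable_mul_of_norm_le_one {F : L → ℝ} (hF : Measurable F) (hF1 : ∀ x, ‖F x‖ ≤ 1)
    (ψ : Lp ℝ 1 μ) : Integrable (fun x => F x * ψ x) μ :=
  (L1.integrable_coeFn ψ).bdd_mul hF.aestronglyMeasurable (.of_forall hF1)

/-- Integration against a bounded measurable function is continuous on `L¹`. -/
theorem continuous_integral_mul {F : L → ℝ} (hF : Measurable F) (hF1 : ∀ x, ‖F x‖ ≤ 1) :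
    Continuous fun ψ : Lp ℝ 1 μ => ∫ x, F x * ψ x ∂μ := by
  refine (LipschitzWith.of_dist_le_mul (K := 1) fun ψ φ => ?_).continuous
  rw [dist_eq_norm, dist_eq_norm, ← integral_sub (integrable_mul_of_norm_le_one hF hF1 ψ)
    (integrable_mul_of_norm_le_one hF hF1 φ), L1.norm_eq_integral_norm, NNReal.coe_one, one_mul]
  refine norm_integral_le_of_norm_le (L1.integrable_coeFn (ψ - φ)).norm ?_
  filter_upwards [Lp.coeFn_sub ψ φ] with x hx
  rw [hx, Pi.sub_apply, ← mul_sub, norm_mul]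
  exact mul_le_of_le_one_left (norm_nonneg _) (hF1 x)

/-- A bounded measurable function is determined by its integrals against a dense subset of `L¹`. -/
theorem ae_eq_of_forall_integral_mul_eq [SigmaFinite μ] {F F' : L → ℝ} (hF : Measurable F)
    (hF1 : ∀ x, ‖F x‖ ≤ 1) (hF' : Measurable F') (hF1' : ∀ x, ‖F' x‖ ≤ 1) {ι : Type*}
    {ψ : ι → Lp ℝ 1 μ} (hψ : DenseRange ψ)
    (h : ∀ n, ∫ x, F x * ψ n x ∂μ = ∫ x, F' x * ψ n x ∂μ) : F =ᵐ[μ] F' := by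
  have hall : (fun φ : Lp ℝ 1 μ => ∫ x, F x * φ x ∂μ) = fun φ => ∫ x, F' x * φ x ∂μ :=
    hψ.equalizer (continuous_integral_mul hF hF1) (continuous_integral_mul hF' hF1') (funext h)
  have hint : ∀ {f : L → ℝ}, Measurable f → (∀ x, ‖f x‖ ≤ 1) → ∀ s : Set L, MeasurableSet s →
      μ s < ∞ → IntegrableOn f s μ := fun hf hf1 s _ hs =>
    Measure.integrableOn_of_bounded hs.ne hf.aestronglyMeasurable (.of_forall hf1)
  have hset : ∀ (f : L → ℝ) (s : Set L) (hs : MeasurableSet s) (hμs : μ s ≠ ∞),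
      ∫ x, f x * indicatorConstLp 1 hs hμs (1 : ℝ) x ∂μ = ∫ x in s, f x ∂μ := by
    intro f s hs hμs
    rw [← integral_indicator hs]
    refine integral_congr_ae ?_
    filter_upwards [indicatorConstLp_coeFn (p := 1) (hs := hs) (hμs := hμs) (c := (1 : ℝ))]
      with x hx
    rw [hx]
    by_cases hxs : x ∈ s <;> simp [hxs]
  refine ae_eq_of_forall_setIntegral_eq_of_sigmaFinite (hint hF hF1) (hint hF' hF1') ?_
  intro s hs hμs
  have h1 := congrFun hall (indicatorConstLp 1 hs hμs.ne (1 : ℝ))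
  simp only [hset] at h1
  exact h1

end Pairing

/-- Let `L` be a locally compact second countable group acting on `W`. A measurable map `r` on `W`
gives rise to a standard Borel `L`-space `Z` and an equivariant measurable map `θ : W → Z` such that
`θ w` depends on the function `l ↦ r (l w)` only, and determines it almost everywhere.

The space `Z` consists of the continuous maps from `L` to `ℝ^ℕ`, with right translation, and `θ w`
is the sequence of the convolutions of `l ↦ r (l w)`, made real valued, with a dense sequence of
integrable functions. -/
theorem exists_equivariant_model {L W E : Type u} [Group L] [TopologicalSpace L]
    [IsTopologicalGroup L] [LocallyCompactSpace L] [SecondCountableTopology L] [T2Space L]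
    [MeasurableSpace L] [BorelSpace L] (mL : Measure L) [mL.IsHaarMeasure]
    [MeasurableSpace W] [MeasurableSpace E] [StandardBorelSpace E]
    {act : L → W → W} (hact : IsMeasurableAction act) {r : W → E} (hr : Measurable r) :
    ∃ (Z : Type u) (_ : MeasurableSpace Z) (_ : StandardBorelSpace Z) (_ : MulAction L Z)
      (θ : W → Z), Measurable (fun p : L × Z => p.1 • p.2) ∧ Measurable θ ∧
      (∀ l w, θ (act l w) = l • θ w) ∧
      (∀ w w', (∀ l, r (act l w) = r (act l w')) → θ w = θ w') ∧
      ∀ w w', θ w = θ w' → ∀ᵐ l ∂mL, r (act l w) = r (act l w') := by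
  have : Fact ((1 : ℝ≥0∞) ≠ ∞) := ⟨ENNReal.one_ne_top⟩
  have : PolishSpace L := polishSpace_of_locallyCompact
  let e : E → ℝ := fun x => ((unitInterval.sigmoid ∘ embeddingReal E) x : ℝ)
  have he : Measurable e :=
    measurable_subtype_coe.comp (measurableEmbedding_sigmoid_comp_embeddingReal E).measurable
  have he1 : ∀ x, ‖e x‖ ≤ 1 := fun x => by
    have hx := ((unitInterval.sigmoid ∘ embeddingReal E) x).2
    rw [Real.norm_eq_abs, abs_le]
    exact ⟨by linarith [hx.1], hx.2⟩
  have heinj : Function.Injective e := fun x y hxy =>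
    (measurableEmbedding_sigmoid_comp_embeddingReal E).injective (Subtype.ext hxy)
  let F : W → L → ℝ := fun w l => e (r (act l⁻¹ w))
  have hF : Measurable fun p : W × L => F p.1 p.2 :=
    he.comp (hr.comp (hact.measurable.comp (measurable_snd.inv.prodMk measurable_fst)))
  have hFw : ∀ w, Measurable (F w) := fun w => hF.comp measurable_prodMk_left
  let ψ : ℕ → Lp ℝ 1 mL := TopologicalSpace.denseSeq _
  have hcont : ∀ w, Continuous fun (k : L) (n : ℕ) => ∫ l, F w (k⁻¹ * l) * ψ n l ∂mL := by
    intro w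
    refine continuous_pi fun n => ?_
    have h1 : ∀ k : L, ∫ l, F w (k⁻¹ * l) * ψ n l ∂mL =
        ∫ l, F w l * (DomMulAct.mk k • ψ n : Lp ℝ 1 mL) l ∂mL := by
      intro k
      rw [← integral_mul_left_eq_self (fun l => F w (k⁻¹ * l) * ψ n l) k]
      refine integral_congr_ae ?_
      filter_upwards [DomMulAct.smul_Lp_ae_eq (DomMulAct.mk k) (ψ n)] with l hl
      rw [hl]
      simp
    simp_rw [h1]
    exact (continuous_integral_mul (hFw w) fun l => he1 _).comp
      ((DomMulAct.continuous_mk).smul continuous_const)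
  let θ : W → C(L, ℕ → ℝ) := fun w => ⟨_, hcont w⟩
  let := borel C(L, ℕ → ℝ)
  have : BorelSpace C(L, ℕ → ℝ) := ⟨rfl⟩
  let : MulAction L C(L, ℕ → ℝ) :=
    { smul := fun l φ => φ.comp ⟨fun k => k * l, continuous_mul_const l⟩
      one_smul := fun φ => by
        ext k
        change φ (k * 1) _ = _
        rw [mul_one]
      mul_smul := fun l l' φ => by
        ext k
        change φ (k * (l * l')) _ = φ (k * l * l') _
        rw [mul_assoc] }
  have hsmul : ∀ (l k : L) (φ : C(L, ℕ → ℝ)), (l • φ) k = φ (k * l) := fun _ _ _ => rfl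
  refine ⟨C(L, ℕ → ℝ), inferInstance, inferInstance, inferInstance, θ, ?_, ?_, ?_, ?_, ?_⟩
  · refine Continuous.measurable (ContinuousMap.continuous_of_continuous_uncurry _ ?_)
    have h1 : Continuous fun q : (L × C(L, ℕ → ℝ)) × L => q.1.2 (q.2 * q.1.1) := by fun_prop
    exact h1
  · refine measurable_continuousMap_of_eval (L := L) (E := ℕ → ℝ) (f := θ) fun k => ?_
    refine measurable_pi_iff.2 fun n => ?_
    have h1 : Measurable fun p : W × L => F p.1 (k⁻¹ * p.2) * ψ n p.2 :=
      (hF.comp (measurable_fst.prodMk (measurable_snd.const_mul _))).mul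
        ((Lp.stronglyMeasurable (ψ n)).measurable.comp measurable_snd)
    exact (h1.stronglyMeasurable.integral_prod_right').measurable
  · intro l w
    ext k n
    rw [hsmul]
    change ∫ x, e (r (act (k⁻¹ * x)⁻¹ (act l w))) * ψ n x ∂mL =
      ∫ x, e (r (act ((k * l)⁻¹ * x)⁻¹ w)) * ψ n x ∂mL
    simp only [← hact.mul, mul_inv_rev, inv_inv, mul_assoc]
  · intro w w' h
    ext k n
    change ∫ x, e (r (act (k⁻¹ * x)⁻¹ w)) * ψ n x ∂mL = ∫ x, e (r (act (k⁻¹ * x)⁻¹ w')) * ψ n x ∂mL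
    simp only [h]
  · intro w w' h
    have h1 : ∀ n, ∫ l, F w l * ψ n l ∂mL = ∫ l, F w' l * ψ n l ∂mL := fun n => by
      have h2 : (θ w) 1 n = (θ w') 1 n := by rw [h]
      change ∫ l, F w (1⁻¹ * l) * ψ n l ∂mL = ∫ l, F w' (1⁻¹ * l) * ψ n l ∂mL at h2
      simpa using h2
    have h3 := ae_eq_of_forall_integral_mul_eq (hFw w) (fun l => he1 _) (hFw w') (fun l => he1 _)
      (TopologicalSpace.denseRange_denseSeq _) h1
    filter_upwards [(quasiMeasurePreserving_inv mL).ae h3] with l hl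
    have h4 := heinj hl
    simpa using h4

/-! ### Strict fundamental domains -/

section Strict

variable {K Y Z : Type u} [Group K] [MeasurableSpace K] [MeasurableSpace Y] [MeasurableSpace Z]

/-- A fundamental isomorphism in strict form: on the invariant conull set `Z₀`, every point `z` is
equal to `k (t y)` with `(k, y) = q z`, and `q` is equivariant without exceptional null sets. -/
structure IsStrictSection (act : K → Z → Z) (mK : Measure K) (ν : Measure Y) (m : Measure Z)
    (t : Y → Z) (q : Z → K × Y) (Z₀ : Set Z) : Prop where
  measurable_section : Measurable t
  measurable_coord : Measurable q
  measurableSet : MeasurableSet Z₀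
  ae_mem : ∀ᵐ z ∂m, z ∈ Z₀
  act_mem : ∀ k z, act k z ∈ Z₀ ↔ z ∈ Z₀
  coord_act : ∀ z ∈ Z₀, ∀ k, q (act k z) = (k * (q z).1, (q z).2)
  act_section : ∀ z ∈ Z₀, act (q z).1 (t (q z).2) = z
  section_mem : ∀ᵐ y ∂ν, t y ∈ Z₀ ∧ q (t y) = (1, y)
  isFundamentalIso : IsFundamentalIso act mK ν m (fun p => act p.1 (t p.2)) q

variable {act : K → Z → Z} {mK : Measure K} {ν : Measure Y} {m : Measure Z}

/-- Any fundamental isomorphism can be made strict on a conull set. -/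
theorem IsFundamentalIso.exists_isStrictSection [StandardBorelSpace K] [MeasurableMul₂ K]
    [MeasurableInv K] [SFinite mK] [NeZero mK] [mK.IsMulLeftInvariant] [mK.IsMulRightInvariant]
    [StandardBorelSpace Y] [SFinite ν] [StandardBorelSpace Z] [Nonempty Z] [SFinite m]
    {i : K × Y → Z} {i' : Z → K × Y}
    (hi : IsFundamentalIso act mK ν m i i') (hact : IsMeasurableAction act) :
    ∃ (t : Y → Z) (q : Z → K × Y) (Z₀ : Set Z), IsStrictSection act mK ν m t q Z₀ ∧
      (∀ᵐ p ∂(mK.prod ν), act p.1 (t p.2) = i p) ∧ ∀ᵐ z ∂m, q z = i' z := by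
  obtain ⟨t, ht, hti, hiso⟩ := hi.exists_section hact (NeZero.ne mK)
  have hU : IsMeasurableAction fun (k : K) (p : K × Y) => (k * p.1, p.2) :=
    ⟨fun p => by simp, fun k l p => by simp [mul_assoc], by fun_prop⟩
  obtain ⟨q, D, hq, hDm, hD, hDinv, hqe, -, hqi⟩ := exists_equivariant_of_ae_equivariant mK
    (NeZero.ne mK) hact hU m hi.measurable_inv hi.ae_inv_act (i' (Classical.arbitrary Z))
  have hmeas : Measurable fun z => act (q z).1 (t (q z).2) :=
    hact.measurable.comp (hq.fst.prodMk (ht.comp hq.snd))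
  let Z₀ : Set Z := D ∩ {z | act (q z).1 (t (q z).2) = z}
  have hZ₀ : ∀ᵐ z ∂m, z ∈ Z₀ := by
    filter_upwards [hD, hqi, hiso.right_inv] with z h1 h2 h3
    refine ⟨h1, ?_⟩
    rw [Set.mem_ofPred_eq, h2]
    exact h3
  have hmem : ∀ k, ∀ z ∈ Z₀, act k z ∈ Z₀ := by
    rintro k z ⟨h1, h2⟩
    refine ⟨(hDinv k z).2 h1, ?_⟩
    rw [Set.mem_ofPred_eq, hqe z h1 k]
    change act (k * (q z).1) (t (q z).2) = act k z
    rw [hact.mul, h2]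
  have hmem' : ∀ k z, act k z ∈ Z₀ ↔ z ∈ Z₀ := fun k z =>
    ⟨fun h => by simpa only [hact.inv_act] using hmem k⁻¹ _ h, hmem k z⟩
  have hleft : ∀ᵐ p ∂(mK.prod ν), act p.1 (t p.2) ∈ Z₀ ∧ q (act p.1 (t p.2)) = p := by
    filter_upwards [hiso.measurePreserving.quasiMeasurePreserving.ae hZ₀,
      hiso.measurePreserving.quasiMeasurePreserving.ae hqi, hiso.left_inv] with p h1 h2 h3
    exact ⟨h1, h2.trans h3⟩
  have hleft' : ∀ᵐ y ∂ν, ∀ᵐ k ∂mK, act k (t y) ∈ Z₀ ∧ q (act k (t y)) = (k, y) :=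
    Measure.ae_ae_of_ae_prod (Measure.measurePreserving_swap.quasiMeasurePreserving.ae hleft)
  refine ⟨t, q, Z₀, ⟨ht, hq, hDm.inter (measurableSet_eq_fun hmeas measurable_id), hZ₀, hmem',
    fun z hz => hqe z hz.1, fun z hz => hz.2, ?_, ⟨hiso.measurePreserving, hq,
    hleft.mono fun p hp => hp.2, hZ₀.mono fun z hz => hz.2, hiso.equivariant⟩⟩, hti, hqi⟩
  filter_upwards [hleft'] with y hy
  obtain ⟨k, hk, hk'⟩ := hy.exists
  have h1 := (hmem' k (t y)).1 hk
  rw [hqe _ h1.1 k] at hk'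
  obtain ⟨h2, h3⟩ := Prod.mk.inj hk'
  exact ⟨h1, Prod.ext (by simpa using h2) h3⟩

namespace IsStrictSection

variable {t : Y → Z} {q : Z → K × Y} {Z₀ : Set Z}

theorem coord_section (h : IsStrictSection act mK ν m t q Z₀) (hact : IsMeasurableAction act)
    {z : Z} (hz : z ∈ Z₀) :
    t (q z).2 = act (q z).1⁻¹ z ∧ t (q z).2 ∈ Z₀ ∧ q (t (q z).2) = (1, (q z).2) := by
  have h1 : t (q z).2 = act (q z).1⁻¹ z := by
    have h2 := hact.inv_act (q z).1 (t (q z).2)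
    rw [h.act_section z hz] at h2
    exact h2.symm
  refine ⟨h1, ?_, ?_⟩
  · rw [h1, h.act_mem]
    exact hz
  · rw [h1, h.coord_act z hz, inv_mul_cancel]

/-- The section meets every invariant conull set almost everywhere. -/
theorem ae_section_mem [SFinite mK] [NeZero mK] [SFinite ν]
    (h : IsStrictSection act mK ν m t q Z₀) {D : Set Z}
    (hD : ∀ᵐ z ∂m, z ∈ D) (hDinv : ∀ k z, act k z ∈ D ↔ z ∈ D) : ∀ᵐ y ∂ν, t y ∈ D := by
  have h1 := h.isFundamentalIso.measurePreserving.quasiMeasurePreserving.ae hD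
  have h2 : ∀ᵐ y ∂ν, ∀ᵐ k ∂mK, act k (t y) ∈ D :=
    Measure.ae_ae_of_ae_prod (Measure.measurePreserving_swap.quasiMeasurePreserving.ae h1)
  filter_upwards [h2] with y hy
  obtain ⟨k, hk⟩ := hy.exists
  exact (hDinv k _).1 hk

end IsStrictSection

end Strict

/-- A conull set that is invariant under `H` only can be replaced by a conull set that is invariant
under `G × H`, at the price of containing only almost every `G`-translate of its points. -/
theorem IsCoupling.exists_invariant_conull {G H Ω : Type u}
    [Group G] [MeasurableSpace G] [MeasurableMul₂ G] [Group H] [MeasurableSpace H]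
    [MeasurableSpace Ω] [MulAction (G × H) Ω] {mG : Measure G} [SFinite mG]
    [mG.IsMulRightInvariant] {mH : Measure H} {m : Measure Ω} [SFinite m]
    (hm : IsCoupling mG mH m) {Ω₀ : Set Ω} (hΩ₀m : MeasurableSet Ω₀) (hΩ₀ : ∀ᵐ ω ∂m, ω ∈ Ω₀)
    (hΩ₀inv : ∀ (h : H) (ω : Ω), ((1 : G), h) • ω ∈ Ω₀ ↔ ω ∈ Ω₀) :
    ∃ D : Set Ω, MeasurableSet D ∧ (∀ᵐ ω ∂m, ω ∈ D) ∧
      (∀ (a : G × H) (ω : Ω), a • ω ∈ D ↔ ω ∈ D) ∧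
      ∀ ω ∈ D, ∀ᵐ g ∂mG, (g, (1 : H)) • ω ∈ Ω₀ := by
  have hmeas : MeasurableSet {p : Ω × G | (p.2, (1 : H)) • p.1 ∉ Ω₀} :=
    (hm.isMeasurableAction_left.measurable.comp measurable_swap) hΩ₀m.compl
  refine ⟨{ω | ∀ᵐ g ∂mG, (g, (1 : H)) • ω ∈ Ω₀}, ?_, ?_, ?_, fun ω hω => hω⟩
  · have h1 : {ω | ∀ᵐ g ∂mG, (g, (1 : H)) • ω ∈ Ω₀} =
        (fun ω => mG (Prod.mk ω ⁻¹' {p : Ω × G | (p.2, (1 : H)) • p.1 ∉ Ω₀})) ⁻¹' {0} := by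
      ext ω
      exact ae_iff
    rw [h1]
    exact measurable_measure_prodMk_left hmeas (measurableSet_singleton 0)
  · exact hm.isMeasurableAction_left.ae_ae_act
      (fun g => hm.measurePreserving_smul (g, 1)) hΩ₀
  · rintro ⟨g, h⟩ ω
    have h1 : ∀ g' : G, (g', (1 : H)) • (g, h) • ω ∈ Ω₀ ↔ (g' * g, (1 : H)) • ω ∈ Ω₀ := by
      intro g'
      rw [← hΩ₀inv h ((g' * g, (1 : H)) • ω), smul_smul, smul_smul]
      simp
    simp only [Set.mem_ofPred_eq, h1]
    have hq := (measurePreserving_mul_right mG g).quasiMeasurePreserving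
    have hq' := (measurePreserving_mul_right mG g⁻¹).quasiMeasurePreserving
    refine ⟨fun hω => ?_, fun hω => hq.ae hω⟩
    have h2 := hq'.ae hω
    simpa using h2

/-- A measurable map between standard Borel spaces that is injective on a measurable set has a
measurable left inverse there. -/
theorem exists_measurable_leftInverse {A B : Type*} [MeasurableSpace A] [StandardBorelSpace A]
    [Nonempty A] [MeasurableSpace B] [StandardBorelSpace B] {f : A → B} (hf : Measurable f)
    {S : Set A} (hS : MeasurableSet S) (hinj : Set.InjOn f S) :
    ∃ g : B → A, Measurable g ∧ ∀ a ∈ S, g (f a) = a := by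
  have := hS.standardBorel
  have h1 : MeasurableEmbedding fun a : S => f a :=
    Measurable.measurableEmbedding (hf.comp measurable_subtype_coe) fun a b hab =>
      Subtype.ext (hinj a.2 b.2 hab)
  obtain ⟨g, hg, hgf⟩ := h1.exists_measurable_extend (g := fun a : S => (a : A))
    measurable_subtype_coe fun _ => inferInstance
  exact ⟨g, hg, fun a ha => congrFun hgf ⟨a, ha⟩⟩

/-! ### Standard Borel models of the composition of couplings -/

theorem IsFundamentalIso.measurePreserving_act {K Y Z : Type u} [Group K] [MeasurableSpace K]
    [MeasurableSpace Y] [MeasurableSpace Z] [MeasurableMul K] {act : K → Z → Z} {mK : Measure K}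
    [SFinite mK] [mK.IsMulLeftInvariant] {ν : Measure Y} [SFinite ν] {m : Measure Z}
    {i : K × Y → Z} {i' : Z → K × Y} (hi : IsFundamentalIso act mK ν m i i') {k : K}
    (hk : Measurable (act k)) : MeasurePreserving (act k) m m := by
  refine ⟨hk, ?_⟩
  have h1 : MeasurePreserving (fun p : K × Y => (k * p.1, p.2)) (mK.prod ν) (mK.prod ν) :=
    (measurePreserving_mul_left mK k).prod (.id ν)
  conv_lhs => rw [← hi.measurePreserving.map_eq]
  rw [Measure.map_map hk hi.measurePreserving.measurable,
    ← (hi.measurePreserving.comp h1).map_eq]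
  exact Measure.map_congr ((hi.equivariant k).mono fun p hp => hp.symm)

theorem smul_comm_of_prod {G H Ω : Type u} [Group G] [Group H] [MulAction (G × H) Ω] (g : G)
    (h : H) (ω : Ω) :
    ((1 : G), h) • (g, (1 : H)) • ω = (g, (1 : H)) • ((1 : G), h) • ω := by
  simp [smul_smul]

/-- The map `θ : Ω × Ω → Z` is a model of the quotient map onto the space of orbits of the diagonal
action of `H`: it is invariant, separates the orbits in `D × D`, where `D` is an invariant conull
set, and intertwines the actions of `G` on the two factors with the actions `A₁`, `A₂` on `Z`. -/
structure IsCompositionModel {G H Ω Z : Type u} [Group G] [Group H] [MeasurableSpace Ω]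
    [MulAction (G × H) Ω] [MeasurableSpace Z] (m : Measure Ω) (D : Set Ω) (A₁ A₂ : G → Z → Z)
    (θ : Ω × Ω → Z) : Prop where
  measurable : Measurable θ
  equivariant_fst : ∀ g w, θ ((g, (1 : H)) • w.1, w.2) = A₁ g (θ w)
  equivariant_snd : ∀ g w, θ (w.1, (g, (1 : H)) • w.2) = A₂ g (θ w)
  invariant : ∀ (h : H) w, θ (((1 : G), h) • w.1, ((1 : G), h) • w.2) = θ w
  measurableSet : MeasurableSet D
  ae_mem : ∀ᵐ ω ∂m, ω ∈ D
  smul_mem : ∀ (a : G × H) ω, a • ω ∈ D ↔ ω ∈ D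
  injective : ∀ w w', w.1 ∈ D → w.2 ∈ D → w'.1 ∈ D → w'.2 ∈ D → θ w = θ w' →
    ∃ h : H, ((1 : G), h) • w.1 = w'.1 ∧ ((1 : G), h) • w.2 = w'.2

section Composition

variable {G H Ω Z X Y : Type u}
  [Group G] [TopologicalSpace G] [IsTopologicalGroup G] [LocallyCompactSpace G]
  [SecondCountableTopology G] [T2Space G] [MeasurableSpace G] [BorelSpace G]
  [Group H] [TopologicalSpace H] [IsTopologicalGroup H] [LocallyCompactSpace H]
  [SecondCountableTopology H] [T2Space H] [MeasurableSpace H] [BorelSpace H]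
  [MeasurableSpace Ω] [StandardBorelSpace Ω] [MulAction (G × H) Ω]
  {mG : Measure G} [mG.IsHaarMeasure] [mG.IsMulRightInvariant]
  {mH : Measure H} [mH.IsHaarMeasure] [mH.IsMulRightInvariant] {m : Measure Ω}
  [MeasurableSpace Z] [StandardBorelSpace Z]

theorem IsCompositionModel.symm {D : Set Ω} {A₁ A₂ : G → Z → Z} {θ : Ω × Ω → Z}
    (hθ : IsCompositionModel (H := H) m D A₁ A₂ θ) :
    IsCompositionModel (H := H) m D A₂ A₁ fun w => θ w.swap where
  measurable := hθ.measurable.comp measurable_swap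
  equivariant_fst g w := hθ.equivariant_snd g w.swap
  equivariant_snd g w := hθ.equivariant_fst g w.swap
  invariant h w := hθ.invariant h w.swap
  measurableSet := hθ.measurableSet
  ae_mem := hθ.ae_mem
  smul_mem := hθ.smul_mem
  injective w w' h1 h2 h3 h4 h := by
    obtain ⟨k, hk, hk'⟩ := hθ.injective w.swap w'.swap h2 h1 h4 h3 h
    exact ⟨k, hk', hk⟩

/-- The map `(g, (y, x)) ↦ [g (t y), s x]`, a fundamental isomorphism for the action of `G` on the
first factor. -/
def compositionIso (H : Type u) [Group H] [MulAction (G × H) Ω] (θ : Ω × Ω → Z) (t : Y → Ω)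
    (s : X → Ω) (p : G × (Y × X)) : Z :=
  θ ((p.1, (1 : H)) • t p.2.1, s p.2.2)

variable [MeasurableSpace X] [StandardBorelSpace X] [MeasurableSpace Y] [StandardBorelSpace Y]
  {ν : Measure Y} [IsFiniteMeasure ν] {μ : Measure X} [IsFiniteMeasure μ]
  {D : Set Ω} {A₁ A₂ : G → Z → Z} {θ : Ω × Ω → Z}
  {t : Y → Ω} {q : Ω → G × Y} {Ω₁ : Set Ω} {s : X → Ω} {r : Ω → H × X} {Ω₀ : Set Ω}

theorem measurable_compositionIso (hm : IsCoupling mG mH m) (hθ : Measurable θ) (ht : Measurable t)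
    (hs : Measurable s) : Measurable (compositionIso H θ t s : G × (Y × X) → Z) :=
  hθ.comp ((hm.isMeasurableAction_left.measurable.comp
    (measurable_fst.prodMk (ht.comp measurable_snd.fst))).prodMk (hs.comp measurable_snd.snd))

/-- The map `compositionIso` is injective over the points where the two sections are strict. -/
theorem exists_compositionIso_leftInverse [Nonempty Y] [Nonempty X] (hm : IsCoupling mG mH m)
    (hθ : IsCompositionModel (H := H) m D A₁ A₂ θ)
    (hS : IsStrictSection (fun (g : G) (ω : Ω) => (g, (1 : H)) • ω) mG ν m t q Ω₁)
    (hT : IsStrictSection (fun (h : H) (ω : Ω) => ((1 : G), h) • ω) mH μ m s r Ω₀) :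
    ∃ i' : Z → G × (Y × X), Measurable i' ∧ ∀ g y x, t y ∈ Ω₁ → q (t y) = (1, y) → t y ∈ D →
      s x ∈ Ω₀ → r (s x) = (1, x) → s x ∈ D →
      i' (compositionIso H θ t s (g, (y, x))) = (g, (y, x)) := by
  have : PolishSpace G := polishSpace_of_locallyCompact
  have : PolishSpace H := polishSpace_of_locallyCompact
  let S : Set (G × (Y × X)) := Prod.snd ⁻¹' ((t ⁻¹' Ω₁ ∩ {y | q (t y) = (1, y)} ∩ t ⁻¹' D) ×ˢ
    (s ⁻¹' Ω₀ ∩ {x | r (s x) = (1, x)} ∩ s ⁻¹' D))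
  have hSm : MeasurableSet S := by
    refine measurable_snd (MeasurableSet.prod ?_ ?_)
    · exact ((hS.measurable_section hS.measurableSet).inter (measurableSet_eq_fun
        (hS.measurable_coord.comp hS.measurable_section)
        (measurable_const.prodMk measurable_id))).inter (hS.measurable_section hθ.measurableSet)
    · exact ((hT.measurable_section hT.measurableSet).inter (measurableSet_eq_fun
        (hT.measurable_coord.comp hT.measurable_section)
        (measurable_const.prodMk measurable_id))).inter (hT.measurable_section hθ.measurableSet)
  have hinj : Set.InjOn (compositionIso H θ t s : G × (Y × X) → Z) S := by
    rintro ⟨g, y, x⟩ ⟨⟨⟨hy1, hy2⟩, hy3⟩, ⟨hx1, hx2⟩, hx3⟩ ⟨g', y', x'⟩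
      ⟨⟨⟨hy1', hy2'⟩, hy3'⟩, ⟨hx1', hx2'⟩, hx3'⟩ heq
    simp only [Set.mem_ofPred_eq, Set.mem_preimage] at hy1 hy2 hy3 hx1 hx2 hx3
    simp only [Set.mem_ofPred_eq, Set.mem_preimage] at hy1' hy2' hy3' hx1' hx2' hx3'
    obtain ⟨h, hh1, hh2⟩ := hθ.injective _ _ ((hθ.smul_mem (g, 1) _).2 hy3) hx3
      ((hθ.smul_mem (g', 1) _).2 hy3') hx3' heq
    dsimp only at hh1 hh2
    have h1 := hT.coord_act (s x) hx1 h
    rw [hh2, hx2, hx2'] at h1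
    obtain ⟨h2, h3⟩ := Prod.mk.inj h1
    have h4 : h = 1 := by simpa using h2.symm
    rw [h4] at hh1
    have h5 : (g, (1 : H)) • t y = (g', (1 : H)) • t y' := by
      rw [← hh1]
      exact (one_smul (G × H) _).symm
    have h6 := hS.coord_act (t y) hy1 g
    rw [h5, hS.coord_act (t y') hy1' g', hy2, hy2'] at h6
    obtain ⟨h7, h8⟩ := Prod.mk.inj h6
    exact Prod.ext (by simpa using h7.symm) (Prod.ext h8.symm h3.symm)
  obtain ⟨i', hi', hleft⟩ := exists_measurable_leftInverse
    (measurable_compositionIso hm hθ.measurable hS.measurable_section hT.measurable_section)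
    hSm hinj
  exact ⟨i', hi', fun g y x h1 h2 h3 h4 h5 h6 =>
    hleft (g, (y, x)) ⟨⟨⟨h1, h2⟩, h3⟩, ⟨h4, h5⟩, h6⟩⟩

theorem ae_section_fst (hθ : IsCompositionModel (H := H) m D A₁ A₂ θ)
    (hS : IsStrictSection (fun (g : G) (ω : Ω) => (g, (1 : H)) • ω) mG ν m t q Ω₁) :
    ∀ᵐ y ∂ν, t y ∈ Ω₁ ∧ q (t y) = (1, y) ∧ t y ∈ D := by
  filter_upwards [hS.section_mem, hS.ae_section_mem hθ.ae_mem fun g => hθ.smul_mem (g, 1)]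
    with y h1 h2
  exact ⟨h1.1, h1.2, h2⟩

theorem ae_section_snd (hθ : IsCompositionModel (H := H) m D A₁ A₂ θ)
    (hT : IsStrictSection (fun (h : H) (ω : Ω) => ((1 : G), h) • ω) mH μ m s r Ω₀) :
    ∀ᵐ x ∂μ, s x ∈ Ω₀ ∧ r (s x) = (1, x) ∧ s x ∈ D := by
  filter_upwards [hT.section_mem, hT.ae_section_mem hθ.ae_mem fun h => hθ.smul_mem (1, h)]
    with x h1 h2
  exact ⟨h1.1, h1.2, h2⟩

theorem isFundamentalIso_compositionIso (hm : IsCoupling mG mH m)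
    (hθ : IsCompositionModel (H := H) m D A₁ A₂ θ)
    (hS : IsStrictSection (fun (g : G) (ω : Ω) => (g, (1 : H)) • ω) mG ν m t q Ω₁)
    (hT : IsStrictSection (fun (h : H) (ω : Ω) => ((1 : G), h) • ω) mH μ m s r Ω₀)
    {i' : Z → G × (Y × X)} (hi' : Measurable i')
    (hleft : ∀ g y x, t y ∈ Ω₁ → q (t y) = (1, y) → t y ∈ D →
      s x ∈ Ω₀ → r (s x) = (1, x) → s x ∈ D →
      i' (compositionIso H θ t s (g, (y, x))) = (g, (y, x))) :
    IsFundamentalIso A₁ mG (ν.prod μ) ((mG.prod (ν.prod μ)).map (compositionIso H θ t s))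
      (compositionIso H θ t s) i' := by
  have : PolishSpace G := polishSpace_of_locallyCompact
  have hmeas : Measurable (compositionIso H θ t s : G × (Y × X) → Z) :=
    measurable_compositionIso hm hθ.measurable hS.measurable_section hT.measurable_section
  have hl : ∀ᵐ p ∂(mG.prod (ν.prod μ)), i' (compositionIso H θ t s p) = p := by
    have hq : Measure.QuasiMeasurePreserving (fun p : G × (Y × X) => p.2)
        (mG.prod (ν.prod μ)) (ν.prod μ) := Measure.quasiMeasurePreserving_snd
    filter_upwards [hq.ae (Measure.quasiMeasurePreserving_fst.ae (ae_section_fst hθ hS)),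
      hq.ae (Measure.quasiMeasurePreserving_snd.ae (ae_section_snd hθ hT))] with p h1 h2
    exact hleft p.1 p.2.1 p.2.2 h1.1 h1.2.1 h1.2.2 h2.1 h2.2.1 h2.2.2
  refine ⟨⟨hmeas, rfl⟩, hi', hl, ?_, fun k => .of_forall fun p => ?_⟩
  · refine (ae_map_iff hmeas.aemeasurable
      (measurableSet_eq_fun (hmeas.comp hi') measurable_id)).2 ?_
    filter_upwards [hl] with p hp
    exact congrArg (compositionIso H θ t s) hp
  · change θ ((k * p.1, (1 : H)) • t p.2.1, s p.2.2) =
      A₁ k (θ ((p.1, (1 : H)) • t p.2.1, s p.2.2))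
    rw [← hθ.equivariant_fst k]
    simp [smul_smul]

/-- Integration over the composition, expressed on `Ω × Ω` by means of a weight for the action of
`H` on the second factor. -/
theorem lintegral_compositionIso (hm : IsCoupling mG mH m)
    (hS : IsStrictSection (fun (g : G) (ω : Ω) => (g, (1 : H)) • ω) mG ν m t q Ω₁)
    (hT : IsStrictSection (fun (h : H) (ω : Ω) => ((1 : G), h) • ω) mH μ m s r Ω₀)
    {κ : H → ℝ≥0∞} (hκ : Measurable κ) (hκ1 : ∫⁻ h, κ h ∂mH = 1) {F : Ω × Ω → ℝ≥0∞}
    (hF : Measurable F)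
    (hFinv : ∀ (h : H) w, F (((1 : G), h) • w.1, ((1 : G), h) • w.2) = F w) :
    ∫⁻ p, F ((p.1, (1 : H)) • t p.2.1, s p.2.2) ∂(mG.prod (ν.prod μ)) =
      ∫⁻ w, F w * κ (r w.2).1 ∂(m.prod m) := by
  have hsf := hm.sFinite
  have hactG := hm.isMeasurableAction_left
  have hactH := hm.isMeasurableAction_right
  let I : X → ℝ≥0∞ := fun x => ∫⁻ ω, F (ω, s x) ∂m
  have hFs : Measurable fun p : Ω × X => F (p.1, s p.2) :=
    hF.comp (measurable_fst.prodMk (hT.measurable_section.comp measurable_snd))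
  have hI : Measurable I := hFs.lintegral_prod_left'
  -- both sides are the integral of `I`
  have h1 : ∫⁻ p, F ((p.1, (1 : H)) • t p.2.1, s p.2.2) ∂(mG.prod (ν.prod μ)) =
      ∫⁻ x, I x ∂μ := by
    have hmp : MeasurePreserving
        (fun p : (G × Y) × X => (((p.1.1, (1 : H)) • t p.1.2, p.2) : Ω × X))
        ((mG.prod ν).prod μ) (m.prod μ) :=
      hS.isFundamentalIso.measurePreserving.prod (.id μ)
    have hassoc := measurePreserving_prodAssoc mG ν μ
    have hmeas : Measurable fun p : G × (Y × X) =>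
        F ((p.1, (1 : H)) • t p.2.1, s p.2.2) :=
      hF.comp ((hactG.measurable.comp (measurable_fst.prodMk
        (hS.measurable_section.comp measurable_snd.fst))).prodMk
        (hT.measurable_section.comp measurable_snd.snd))
    rw [← hassoc.lintegral_comp hmeas]
    have h2 := hmp.lintegral_comp (f := fun p : Ω × X => F (p.1, s p.2)) hFs
    rw [lintegral_prod_symm' (f := fun p : Ω × X => F (p.1, s p.2)) hFs] at h2
    exact h2
  have h3 : ∫⁻ w, F w * κ (r w.2).1 ∂(m.prod m) = ∫⁻ x, I x ∂μ := by
    have hFκ : Measurable fun w : Ω × Ω => F w * κ (r w.2).1 :=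
      hF.mul (hκ.comp (hT.measurable_coord.comp measurable_snd).fst)
    rw [lintegral_prod_symm' (f := fun w : Ω × Ω => F w * κ (r w.2).1) hFκ]
    rw [← hT.isFundamentalIso.measurePreserving.lintegral_comp
      (f := fun ω₂ => ∫⁻ ω₁, F (ω₁, ω₂) * κ (r ω₂).1 ∂m) hFκ.lintegral_prod_left']
    have h4 : ∀ᵐ p ∂(mH.prod μ),
        ∫⁻ ω₁, F (ω₁, ((1 : G), p.1) • s p.2) * κ (r (((1 : G), p.1) • s p.2)).1 ∂m =
          κ p.1 * I p.2 := by
      filter_upwards [hT.isFundamentalIso.left_inv] with p hp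
      rw [hp, lintegral_mul_const (κ p.1) (f := fun ω₁ => F (ω₁, ((1 : G), p.1) • s p.2))
        (hF.comp measurable_prodMk_right), mul_comm]
      congr 1
      have h5 := (hm.measurePreserving_smul (1, p.1)).lintegral_comp
        (f := fun ω₁ => F (ω₁, ((1 : G), p.1) • s p.2)) (hF.comp measurable_prodMk_right)
      rw [← h5]
      exact lintegral_congr fun ω => hFinv p.1 (ω, s p.2)
    rw [lintegral_congr_ae h4, lintegral_prod_mul hκ.aemeasurable hI.aemeasurable, hκ1, one_mul]
  rw [h1, h3]

theorem isWeight_fst_and_isWeight_snd (hm : IsCoupling mG mH m)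
    (hT : IsStrictSection (fun (h : H) (ω : Ω) => ((1 : G), h) • ω) mH μ m s r Ω₀)
    {κ : H → ℝ≥0∞} (hκ : Measurable κ) (hκ1 : ∫⁻ h, κ h ∂mH = 1) :
    IsWeight (fun (h : H) (w : Ω × Ω) => ((((1 : G), h) • w.1, ((1 : G), h) • w.2) : Ω × Ω))
      mH (m.prod m) (fun w => κ (r w.1).1) ∧
    IsWeight (fun (h : H) (w : Ω × Ω) => ((((1 : G), h) • w.1, ((1 : G), h) • w.2) : Ω × Ω))
      mH (m.prod m) (fun w => κ (r w.2).1) := by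
  have hsf := hm.sFinite
  have h1 : ∀ᵐ ω ∂m, ∫⁻ h, κ (r (((1 : G), h) • ω)).1 ∂mH = 1 := by
    filter_upwards [hT.ae_mem] with ω hω
    simp only [hT.coord_act ω hω]
    rw [lintegral_mul_right_eq_self, hκ1]
  have hmeas : Measurable fun ω => κ (r ω).1 := hκ.comp hT.measurable_coord.fst
  exact ⟨⟨hmeas.comp measurable_fst, Measure.quasiMeasurePreserving_fst.ae h1⟩,
    ⟨hmeas.comp measurable_snd, Measure.quasiMeasurePreserving_snd.ae h1⟩⟩

theorem IsCoupling.isMeasurableAction_diag (hm : IsCoupling mG mH m) :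
    IsMeasurableAction fun (h : H) (w : Ω × Ω) =>
      ((((1 : G), h) • w.1, ((1 : G), h) • w.2) : Ω × Ω) where
  one _ := Prod.ext (hm.isMeasurableAction_right.one _) (hm.isMeasurableAction_right.one _)
  mul h k _ := Prod.ext (hm.isMeasurableAction_right.mul h k _)
    (hm.isMeasurableAction_right.mul h k _)
  measurable := (hm.isMeasurableAction_right.measurable.comp
      (measurable_fst.prodMk measurable_snd.fst)).prodMk
    (hm.isMeasurableAction_right.measurable.comp (measurable_fst.prodMk measurable_snd.snd))

/-- The measure on the model does not depend on which of the two factors is used to construct it. -/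
theorem map_compositionIso_swap (hm : IsCoupling mG mH m)
    (hθ : IsCompositionModel (H := H) m D A₁ A₂ θ)
    (hS : IsStrictSection (fun (g : G) (ω : Ω) => (g, (1 : H)) • ω) mG ν m t q Ω₁)
    (hT : IsStrictSection (fun (h : H) (ω : Ω) => ((1 : G), h) • ω) mH μ m s r Ω₀) :
    (mG.prod (ν.prod μ)).map (compositionIso H (fun w => θ w.swap) t s) =
      (mG.prod (ν.prod μ)).map (compositionIso H θ t s) := by
  have hsf := hm.sFinite
  have := isInvInvariant_of_isMulRightInvariant mH
  obtain ⟨κ, hκ, hκ1⟩ := exists_measurable_lintegral_eq_one mH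
  obtain ⟨hw1, hw2⟩ := isWeight_fst_and_isWeight_snd hm hT hκ hκ1
  have hmeas : Measurable (compositionIso H θ t s : G × (Y × X) → Z) :=
    measurable_compositionIso hm hθ.measurable hS.measurable_section hT.measurable_section
  have hmeas' : Measurable (compositionIso H (fun w => θ w.swap) t s : G × (Y × X) → Z) :=
    measurable_compositionIso hm hθ.symm.measurable hS.measurable_section hT.measurable_section
  refine Measure.ext_of_lintegral _ fun φ hφ => ?_
  rw [lintegral_map hφ hmeas, lintegral_map hφ hmeas']
  have e1 := lintegral_compositionIso hm hS hT hκ hκ1 (F := fun w => φ (θ w))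
    (hφ.comp hθ.measurable) fun h _ => congrArg φ (hθ.invariant h _)
  have e2 := lintegral_compositionIso hm hS hT hκ hκ1 (F := fun w => φ (θ w.swap))
    (hφ.comp hθ.symm.measurable) fun h _ => congrArg φ (hθ.symm.invariant h _)
  have e3 : ∫⁻ w, φ (θ w.swap) * κ (r w.2).1 ∂(m.prod m) =
      ∫⁻ w, φ (θ w) * κ (r w.1).1 ∂(m.prod m) :=
    Measure.measurePreserving_swap.lintegral_comp (f := fun w : Ω × Ω => φ (θ w) * κ (r w.1).1)
      ((hφ.comp hθ.measurable).mul hw1.measurable)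
  have e4 := hw1.lintegral_mul_eq hm.isMeasurableAction_diag
    (fun h => (hm.measurePreserving_smul (1, h)).prod (hm.measurePreserving_smul (1, h))) hw2
    (hφ.comp hθ.measurable) fun h => .of_forall fun w => congrArg φ (hθ.invariant h w)
  exact e2.trans (e3.trans (e4.symm.trans e1.symm))

/-- Null sets of the model have null preimages in `Ω × Ω`: integrated against a weight for `H`, the
preimage of a set has the measure of the set. -/
theorem quasiMeasurePreserving_model (hm : IsCoupling mG mH m)
    (hθ : IsCompositionModel (H := H) m D A₁ A₂ θ)
    (hS : IsStrictSection (fun (g : G) (ω : Ω) => (g, (1 : H)) • ω) mG ν m t q Ω₁)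
    (hT : IsStrictSection (fun (h : H) (ω : Ω) => ((1 : G), h) • ω) mH μ m s r Ω₀) :
    Measure.QuasiMeasurePreserving θ (m.prod m)
      ((mG.prod (ν.prod μ)).map (compositionIso H θ t s)) := by
  have hsf := hm.sFinite
  obtain ⟨κ, hκ, hκ1⟩ := exists_measurable_lintegral_eq_one mH
  obtain ⟨-, hw2⟩ := isWeight_fst_and_isWeight_snd hm hT hκ hκ1
  have hmeas : Measurable (compositionIso H θ t s : G × (Y × X) → Z) :=
    measurable_compositionIso hm hθ.measurable hS.measurable_section hT.measurable_section
  refine ⟨hθ.measurable, Measure.AbsolutelyContinuous.mk fun N hN hN0 => ?_⟩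
  have hφ : Measurable (N.indicator (1 : Z → ℝ≥0∞)) := measurable_one.indicator hN
  rw [Measure.map_apply hθ.measurable hN, ← lintegral_indicator_one (hθ.measurable hN)]
  rw [← lintegral_indicator_one hN, lintegral_map hφ hmeas] at hN0
  have e1 := lintegral_compositionIso hm hS hT hκ hκ1
    (F := fun w => N.indicator (1 : Z → ℝ≥0∞) (θ w))
    (hφ.comp hθ.measurable) fun h w => by rw [hθ.invariant h w]
  exact hw2.lintegral_eq_zero hm.isMeasurableAction_diag
    (fun h => (hm.measurePreserving_smul (1, h)).prod (hm.measurePreserving_smul (1, h)))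
    (F := fun w => N.indicator (1 : Z → ℝ≥0∞) (θ w)) (hφ.comp hθ.measurable)
    (fun h => .of_forall fun w => by
      rw [hθ.invariant h w]) (e1.symm.trans hN0)

/-- If `β : H × Y → G` and `α : G × X → H` are the cocycles of a coupling, then that of its
composition with its dual is `(g, (y, x)) ↦ β (α (g, x), y)`. -/
theorem isMECocycle_compositionIso (hm : IsCoupling mG mH m)
    (hθ : IsCompositionModel (H := H) m D A₁ A₂ θ)
    (hS : IsStrictSection (fun (g : G) (ω : Ω) => (g, (1 : H)) • ω) mG ν m t q Ω₁)
    (hT : IsStrictSection (fun (h : H) (ω : Ω) => ((1 : G), h) • ω) mH μ m s r Ω₀)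
    {i' : Z → G × (Y × X)}
    (hleft : ∀ g y x, t y ∈ Ω₁ → q (t y) = (1, y) → t y ∈ D →
      s x ∈ Ω₀ → r (s x) = (1, x) → s x ∈ D →
      i' (compositionIso H θ t s (g, (y, x))) = (g, (y, x)))
    {β : H → Y → G} (hβ : Measurable (Function.uncurry β))
    (hβq : ∀ h, ∀ᵐ y ∂ν, ((1 : G), h) • t y ∈ Ω₁ ∧ (q (((1 : G), h) • t y)).1 = (β h y)⁻¹)
    {α : G → X → H} (hα : Measurable (Function.uncurry α))
    (hαr : ∀ g, ∀ᵐ x ∂μ, (g, (1 : H)) • s x ∈ Ω₀ ∧ (r ((g, (1 : H)) • s x)).1 = (α g x)⁻¹) :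
    IsMECocycle A₂ mG (ν.prod μ) (compositionIso H θ t s) i' fun g p => β (α g p.2) p.1 := by
  have : PolishSpace G := polishSpace_of_locallyCompact
  refine ⟨hβ.comp ((hα.comp (measurable_fst.prodMk measurable_snd.snd)).prodMk
    measurable_snd.fst), fun a => ?_⟩
  have hactH := hm.isMeasurableAction_right
  have hαa : Measurable (α a) := hα.comp measurable_prodMk_left
  have hact : Measurable fun p : X × Y => ((1 : G), α a p.1) • t p.2 :=
    hactH.measurable.comp ((hαa.comp measurable_fst).prodMk
      (hS.measurable_section.comp measurable_snd))
  have hset : MeasurableSet {p : X × Y | ((1 : G), α a p.1) • t p.2 ∈ Ω₁ ∧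
      (q (((1 : G), α a p.1) • t p.2)).1 = (β (α a p.1) p.2)⁻¹} :=
    (hact hS.measurableSet).inter (measurableSet_eq_fun (hS.measurable_coord.comp hact).fst
      (hβ.comp ((hαa.comp measurable_fst).prodMk measurable_snd)).inv)
  have h4 : ∀ᵐ p ∂(ν.prod μ), ((1 : G), α a p.2) • t p.1 ∈ Ω₁ ∧
      (q (((1 : G), α a p.2) • t p.1)).1 = (β (α a p.2) p.1)⁻¹ :=
    Measure.measurePreserving_swap.quasiMeasurePreserving.ae
      ((Measure.ae_prod_iff_ae_ae hset).2 (.of_forall fun x => hβq (α a x)))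
  have hq : Measure.QuasiMeasurePreserving (fun p : G × (Y × X) => p.2)
      (mG.prod (ν.prod μ)) (ν.prod μ) := Measure.quasiMeasurePreserving_snd
  filter_upwards [hq.ae (Measure.quasiMeasurePreserving_fst.ae (ae_section_fst hθ hS)),
    hq.ae (Measure.quasiMeasurePreserving_snd.ae (ae_section_snd hθ hT)),
    hq.ae (Measure.quasiMeasurePreserving_snd.ae (hαr a)), hq.ae h4]
  rintro ⟨g, y, x⟩ ⟨-, -, hyD⟩ ⟨-, -, hxD⟩ ⟨hx, hx'⟩ ⟨hy, hy'⟩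
  dsimp only at hyD hxD hx hx' hy hy' ⊢
  set h := α a x
  -- Translating `[g (t y), a (s x)]` by `h` brings the second coordinate back to the section.
  obtain ⟨hs1, hs2, hs3⟩ := hT.coord_section hactH hx
  obtain ⟨ht1, ht2, ht3⟩ := hS.coord_section hm.isMeasurableAction_left hy
  have ht4 := hS.act_section _ hy
  rw [hx', inv_inv] at hs1
  set x' := (r ((a, (1 : H)) • s x)).2
  set y' := (q (((1 : G), h) • t y)).2
  have hyD' : t y' ∈ D := by
    rw [ht1]
    exact (hθ.smul_mem _ _).2 ((hθ.smul_mem _ _).2 hyD)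
  have hxD' : s x' ∈ D := by
    rw [hs1]
    exact (hθ.smul_mem _ _).2 ((hθ.smul_mem _ _).2 hxD)
  have key : A₂ a (compositionIso H θ t s (g, y, x)) =
      compositionIso H θ t s (g * (β h y)⁻¹, (y', x')) := by
    change A₂ a (θ ((g, (1 : H)) • t y, s x)) =
      θ ((g * (β h y)⁻¹, (1 : H)) • t y', s x')
    rw [← hθ.equivariant_snd a, ← hθ.invariant h]
    dsimp only
    rw [← hs1]
    congr 2
    rw [hy'] at ht4
    have h5 : (g * (β h y)⁻¹, (1 : H)) • t y' =
        (g, (1 : H)) • ((β h y)⁻¹, (1 : H)) • t y' := by simp [smul_smul]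
    rw [h5, ht4]
    simp [smul_smul]
  rw [key, hleft _ _ _ ht2 ht3 hyD' hs2 hs3 hxD']

end Composition

/-- For a strict section, the defining equation of the cocycle holds on the section itself. -/
theorem IsStrictSection.ae_cocycle {A K Y Z : Type u} [MeasurableSpace A] [Group K]
    [MeasurableSpace K] [MeasurableSpace Y] [MeasurableSpace Z] {act : K → Z → Z} {mK : Measure K}
    [SFinite mK] [NeZero mK] {ν : Measure Y} [SFinite ν] {m : Measure Z}
    {t : Y → Z} {q : Z → K × Y} {Z₀ : Set Z} (h : IsStrictSection act mK ν m t q Z₀)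
    {i : K × Y → Z} {i' : Z → K × Y} (hti : ∀ᵐ p ∂(mK.prod ν), act p.1 (t p.2) = i p)
    (hqi : ∀ᵐ z ∂m, q z = i' z) {actA : A → Z → Z} {β : A → Y → K}
    (hβ : IsMECocycle actA mK ν i i' β) (hA : ∀ a, MeasurePreserving (actA a) m m)
    (hcomm : ∀ a k z, actA a (act k z) = act k (actA a z)) (a : A) :
    ∀ᵐ y ∂ν, actA a (t y) ∈ Z₀ ∧ (q (actA a (t y))).1 = (β a y)⁻¹ := by
  have hmp := ((hA a).comp h.isFundamentalIso.measurePreserving).quasiMeasurePreserving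
  have h1 : ∀ᵐ p ∂(mK.prod ν), act p.1 (actA a (t p.2)) ∈ Z₀ ∧
      (q (act p.1 (actA a (t p.2)))).1 = p.1 * (β a p.2)⁻¹ := by
    filter_upwards [hmp.ae h.ae_mem, hmp.ae hqi, hti, hβ.2 a] with p h2 h3 h4 h5
    simp only [Function.comp_apply, hcomm] at h2 h3
    refine ⟨h2, ?_⟩
    rw [h3, ← h5, ← h4, hcomm]
  have h2 : ∀ᵐ y ∂ν, ∀ᵐ k ∂mK, act k (actA a (t y)) ∈ Z₀ ∧
      (q (act k (actA a (t y)))).1 = k * (β a y)⁻¹ :=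
    Measure.ae_ae_of_ae_prod (Measure.measurePreserving_swap.quasiMeasurePreserving.ae h1)
  filter_upwards [h2] with y hy
  obtain ⟨k, hk, hk'⟩ := hy.exists
  have h3 := (h.act_mem k _).1 hk
  rw [h.coord_act _ h3 k] at hk'
  exact ⟨h3, mul_left_cancel hk'⟩

section Model

variable {G H Ω : Type u}
  [Group G] [TopologicalSpace G] [IsTopologicalGroup G] [LocallyCompactSpace G]
  [SecondCountableTopology G] [T2Space G] [MeasurableSpace G] [BorelSpace G]
  [Group H] [TopologicalSpace H] [IsTopologicalGroup H] [LocallyCompactSpace H]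
  [SecondCountableTopology H] [T2Space H] [MeasurableSpace H] [BorelSpace H]
  [MeasurableSpace Ω] [StandardBorelSpace Ω] [MulAction (G × H) Ω]
  {mG : Measure G} [mG.IsHaarMeasure] [mG.IsMulRightInvariant]
  {mH : Measure H} [mH.IsHaarMeasure] [mH.IsMulRightInvariant] {m : Measure Ω}

open Classical in
/-- The space of orbits of the diagonal action of `H` on `Ω × Ω` has a standard Borel model. Moving
the first coordinate into the fundamental domain of `H` parametrizes the orbits by `Ω × Ω`; as the
exceptional null set is not invariant under `G`, this parametrization is made equivariant by
`exists_equivariant_model`. -/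
theorem IsCoupling.exists_isCompositionModel (hm : IsCoupling mG mH m) :
    ∃ (Z : Type u) (_ : MeasurableSpace Z) (_ : StandardBorelSpace Z) (_ : MulAction (G × G) Z)
      (D : Set Ω) (θ : Ω × Ω → Z), Measurable (fun p : (G × G) × Z => p.1 • p.2) ∧
      IsCompositionModel (H := H) m D (fun (g : G) (z : Z) => (g, (1 : G)) • z)
        (fun (g : G) (z : Z) => ((1 : G), g) • z) θ := by
  have : PolishSpace G := polishSpace_of_locallyCompact
  have : PolishSpace H := polishSpace_of_locallyCompact
  have := hm.sFinite
  have hne := hm.nonempty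
  obtain ⟨X, _, _, μ, j, j', _, hj⟩ := hm.right
  obtain ⟨s, r, Ω₀, hT, -, -⟩ := hj.exists_isStrictSection hm.isMeasurableAction_right
  obtain ⟨D, hDm, hD, hDinv, hDΩ₀⟩ :=
    hm.exists_invariant_conull hT.measurableSet hT.ae_mem hT.act_mem
  let w₀ : Ω × Ω := Classical.arbitrary _
  let ret : Ω × Ω → Ω × Ω := fun w => if w.1 ∈ Ω₀ then
    (((1 : G), (r w.1).1⁻¹) • w.1, ((1 : G), (r w.1).1⁻¹) • w.2) else w₀
  have hf : Measurable fun w : Ω × Ω => (r w.1).1⁻¹ :=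
    (hT.measurable_coord.comp measurable_fst).fst.inv
  have hret : Measurable ret := Measurable.ite (measurable_fst hT.measurableSet)
    ((hm.isMeasurableAction_right.measurable.comp (hf.prodMk measurable_fst)).prodMk
      (hm.isMeasurableAction_right.measurable.comp (hf.prodMk measurable_snd))) measurable_const
  have hact : IsMeasurableAction fun (l : G × G) (w : Ω × Ω) =>
      (((l.1, (1 : H)) • w.1, (l.2, (1 : H)) • w.2) : Ω × Ω) :=
    { one := fun w => Prod.ext (hm.isMeasurableAction_left.one _) (hm.isMeasurableAction_left.one _)
      mul := fun l l' w => Prod.ext (hm.isMeasurableAction_left.mul _ _ _)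
        (hm.isMeasurableAction_left.mul _ _ _)
      measurable := (hm.isMeasurableAction_left.measurable.comp
          (measurable_fst.fst.prodMk measurable_snd.fst)).prodMk
        (hm.isMeasurableAction_left.measurable.comp
          (measurable_fst.snd.prodMk measurable_snd.snd)) }
  obtain ⟨Z, _, _, _, θ, hZ, hθ, hθe, hθinv, hθsep⟩ :=
    exists_equivariant_model (mG.prod mG) hact hret
  refine ⟨Z, _, inferInstance, inferInstance, D, θ, hZ, hθ, fun g w => ?_, fun g w => ?_,
    fun h w => ?_, hDm, hD, hDinv, fun w w' h1 _ h1' _ heq => ?_⟩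
  · rw [← hθe]
    congr 2
    exact (hm.isMeasurableAction_left.one _).symm
  · rw [← hθe]
    congr 2
    exact (hm.isMeasurableAction_left.one _).symm
  · refine hθinv _ _ fun l => ?_
    have h1 : (l.1, (1 : H)) • ((1 : G), h) • w.1 ∈ Ω₀ ↔ (l.1, (1 : H)) • w.1 ∈ Ω₀ := by
      rw [← smul_comm_of_prod]
      exact hT.act_mem h _
    by_cases hw : (l.1, (1 : H)) • w.1 ∈ Ω₀
    · simp only [ret]
      rw [if_pos hw, if_pos (h1.2 hw)]
      have h2 := hT.coord_act _ hw h
      rw [← smul_comm_of_prod, h2]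
      simp [smul_smul]
    · simp only [ret]
      rw [if_neg hw, if_neg (mt h1.1 hw)]
  · have hq : Measure.QuasiMeasurePreserving (Prod.fst : G × G → G) (mG.prod mG) mG :=
      Measure.quasiMeasurePreserving_fst
    have hex : ∀ᵐ l ∂(mG.prod mG), ret ((l.1, (1 : H)) • w.1, (l.2, (1 : H)) • w.2) =
        ret ((l.1, (1 : H)) • w'.1, (l.2, (1 : H)) • w'.2) ∧ (l.1, (1 : H)) • w.1 ∈ Ω₀ ∧
        (l.1, (1 : H)) • w'.1 ∈ Ω₀ := by
      filter_upwards [hθsep w w' heq, hq.ae (hDΩ₀ _ h1), hq.ae (hDΩ₀ _ h1')] with l h2 h3 h4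
      exact ⟨h2, h3, h4⟩
    obtain ⟨l, hl, hl1, hl2⟩ := hex.exists
    simp only [ret, if_pos hl1, if_pos hl2] at hl
    obtain ⟨e1, e2⟩ := Prod.mk.inj hl
    set k := (r ((l.1, (1 : H)) • w.1)).1
    set k' := (r ((l.1, (1 : H)) • w'.1)).1
    have hone : ∀ ω : Ω, ((1 : G), (1 : H)) • ω = ω := one_smul (G × H)
    refine ⟨k' * k⁻¹, ?_, ?_⟩
    · have h5 := congrArg (fun ω => (l.1⁻¹, k') • ω) e1
      simpa [smul_smul, hone] using h5
    · have h5 := congrArg (fun ω => (l.2⁻¹, k') • ω) e2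
      simpa [smul_smul, hone] using h5

variable {Z X Y : Type u} [MeasurableSpace Z] [StandardBorelSpace Z] [MulAction (G × G) Z]
  [MeasurableSpace X] [StandardBorelSpace X] [MeasurableSpace Y] [StandardBorelSpace Y]
  {ν : Measure Y} [IsFiniteMeasure ν] {μ : Measure X} [IsFiniteMeasure μ]
  {D : Set Ω} {θ : Ω × Ω → Z}
  {t : Y → Ω} {q : Ω → G × Y} {Ω₁ : Set Ω} {s : X → Ω} {r : Ω → H × X} {Ω₀ : Set Ω}

theorem isCoupling_model (hm : IsCoupling mG mH m)
    (hZ : Measurable fun p : (G × G) × Z => p.1 • p.2)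
    (hθ : IsCompositionModel (H := H) m D (fun (g : G) (z : Z) => (g, (1 : G)) • z)
        (fun (g : G) (z : Z) => ((1 : G), g) • z) θ)
    (hS : IsStrictSection (fun (g : G) (ω : Ω) => (g, (1 : H)) • ω) mG ν m t q Ω₁)
    (hT : IsStrictSection (fun (h : H) (ω : Ω) => ((1 : G), h) • ω) mH μ m s r Ω₀)
    {i' : Z → G × (Y × X)}
    (hi : IsFundamentalIso (fun (g : G) (z : Z) => (g, (1 : G)) • z) mG (ν.prod μ)
      ((mG.prod (ν.prod μ)).map (compositionIso H θ t s)) (compositionIso H θ t s) i')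
    {j' : Z → G × (Y × X)}
    (hj : IsFundamentalIso (fun (g : G) (z : Z) => ((1 : G), g) • z) mG (ν.prod μ)
      ((mG.prod (ν.prod μ)).map (compositionIso H (fun w => θ w.swap) t s))
      (compositionIso H (fun w => θ w.swap) t s) j') :
    IsCoupling mG mG ((mG.prod (ν.prod μ)).map (compositionIso H θ t s)) := by
  have hsf := hm.sFinite
  rw [map_compositionIso_swap hm hθ hS hT] at hj
  have hZa : ∀ a : G × G, Measurable fun z : Z => a • z := fun a => hZ.comp measurable_prodMk_left
  refine ⟨?_, hZ, fun a => ?_, ⟨Y × X, _, inferInstance, ν.prod μ, _, i', inferInstance, hi⟩,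
    ⟨Y × X, _, inferInstance, ν.prod μ, _, j', inferInstance, hj⟩⟩
  · intro h0
    have h1 := (quasiMeasurePreserving_model hm hθ hS hT).absolutelyContinuous
    rw [h0, Measure.absolutelyContinuous_zero_iff,
      Measure.map_eq_zero_iff hθ.measurable.aemeasurable] at h1
    have h2 : (m.prod m) Set.univ = 0 := by simp [h1]
    rw [← Set.univ_prod_univ, Measure.prod_prod, mul_self_eq_zero,
      Measure.measure_univ_eq_zero] at h2
    exact hm.ne_zero h2
  · have h1 := (hi.measurePreserving_act (hZa (a.1, 1))).comp
      (hj.measurePreserving_act (hZa (1, a.2)))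
    have h2 : (fun z : Z => a • z) =
        (fun z : Z => (a.1, (1 : G)) • z) ∘ fun z : Z => ((1 : G), a.2) • z := by
      funext z
      simp [smul_smul]
    rw [h2]
    exact h1.map_eq

/-- A tautening map on the model gives a tautening kernel on `Ω × Ω`. -/
theorem IsTauteningMap.isTauteningKernel_model (hm : IsCoupling mG mH m)
    (hθ : IsCompositionModel (H := H) m D (fun (g : G) (z : Z) => (g, (1 : G)) • z)
        (fun (g : G) (z : Z) => ((1 : G), g) • z) θ)
    (hS : IsStrictSection (fun (g : G) (ω : Ω) => (g, (1 : H)) • ω) mG ν m t q Ω₁)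
    (hT : IsStrictSection (fun (h : H) (ω : Ω) => ((1 : G), h) • ω) mH μ m s r Ω₀)
    {Φ : Z → G}
    (hΦ : IsTauteningMap (MonoidHom.id G)
      ((mG.prod (ν.prod μ)).map (compositionIso H θ t s)) Φ) :
    IsTauteningKernel (H := H) (MonoidHom.id G) m fun w => Φ (θ w) := by
  refine ⟨hΦ.1.comp hθ.measurable, fun g₁ g₂ h => ?_⟩
  filter_upwards [(quasiMeasurePreserving_model hm hθ hS hT).ae hΦ.2] with w hw
  rw [← hw g₁ g₂]
  congr 1
  have h1 := hθ.equivariant_fst g₁ (((1 : G), h) • w.1, (g₂, (1 : H)) • ((1 : G), h) • w.2)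
  have h2 := hθ.equivariant_snd g₂ (((1 : G), h) • w.1, ((1 : G), h) • w.2)
  dsimp only at h1 h2
  rw [h2, hθ.invariant h w] at h1
  simpa [smul_smul] using h1

end Model

/-! ### Integrability of composed cocycles -/

section WordNorm

variable {K : Type u} [Group K] {S : Set K}

theorem wordNorm_le_of_mem_pow {n : ℕ} {k : K} (h : k ∈ S ^ n) : wordNorm S k ≤ n :=
  Nat.sInf_le h

variable [TopologicalSpace K]

theorem IsCompactGeneratingSet.exists_mem_pow (hS : IsCompactGeneratingSet S) (k : K) :
    ∃ n : ℕ, k ∈ S ^ n := by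
  have hk : k ∈ Subgroup.closure S := by
    rw [hS.2.2]
    exact Subgroup.mem_top k
  have hinv : ∀ n : ℕ, (S ^ n)⁻¹ = S ^ n := fun n => by rw [← inv_pow, hS.2.1]
  induction hk using Subgroup.closure_induction with
  | mem x hx => exact ⟨1, by rwa [pow_one]⟩
  | one => exact ⟨0, by simp⟩
  | mul x y _ _ hx hy =>
    obtain ⟨n, hn⟩ := hx
    obtain ⟨l, hl⟩ := hy
    exact ⟨n + l, by rw [pow_add]; exact Set.mul_mem_mul hn hl⟩
  | inv x _ hx =>
    obtain ⟨n, hn⟩ := hx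
    exact ⟨n, by rw [← hinv n]; simpa using hn⟩

theorem IsCompactGeneratingSet.mem_pow_wordNorm (hS : IsCompactGeneratingSet S) (k : K) :
    k ∈ S ^ wordNorm S k :=
  Nat.sInf_mem (s := {n : ℕ | k ∈ S ^ n}) (hS.exists_mem_pow k)

theorem IsCompactGeneratingSet.wordNorm_mul_le (hS : IsCompactGeneratingSet S) (k l : K) :
    wordNorm S (k * l) ≤ wordNorm S k + wordNorm S l := by
  refine wordNorm_le_of_mem_pow ?_
  rw [pow_add]
  exact Set.mul_mem_mul (hS.mem_pow_wordNorm k) (hS.mem_pow_wordNorm l)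

theorem IsCompactGeneratingSet.measurable_wordNorm [IsTopologicalGroup K] [T2Space K]
    [MeasurableSpace K] [BorelSpace K] (hS : IsCompactGeneratingSet S) :
    Measurable (wordNorm S) := by
  refine measurable_of_Iic fun n => ?_
  have h1 : wordNorm S ⁻¹' Set.Iic n = ⋃ l ∈ Set.Iic n, S ^ l := by
    ext k
    simp only [Set.mem_preimage, Set.mem_iUnion, Set.mem_Iic, exists_prop]
    exact ⟨fun h => ⟨_, h, hS.mem_pow_wordNorm k⟩,
      fun ⟨l, hl, hk⟩ => (wordNorm_le_of_mem_pow hk).trans hl⟩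
  rw [h1]
  have hpow : ∀ l : ℕ, IsCompact (S ^ l) := fun l => by
    induction l with
    | zero => simp
    | succ l ih => rw [pow_succ]; exact ih.mul hS.1
  exact MeasurableSet.biUnion (Set.to_countable _) fun l _ => (hpow l).isClosed.measurableSet

end WordNorm

/-- A measurable subadditive function on a group that is finite almost everywhere is bounded on
compact sets, by Steinhaus' theorem, and hence grows at most linearly in the word norm. -/
theorem exists_le_mul_wordNorm {H : Type u} [Group H] [TopologicalSpace H] [IsTopologicalGroup H]
    [LocallyCompactSpace H] [SecondCountableTopology H] [MeasurableSpace H]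
    [BorelSpace H] (mH : Measure H) [mH.IsHaarMeasure] [mH.IsMulRightInvariant] {N : H → ℝ≥0∞}
    (hN : Measurable N)
    (hsub : ∀ h k, N (h * k) ≤ N h + N k) (hfin : ∀ᵐ h ∂mH, N h < ∞) {T : Set H}
    (hT : IsCompactGeneratingSet T) :
    ∃ C : ℝ≥0∞, C ≠ ∞ ∧ ∀ h, N h ≤ C * (wordNorm T h + 1) := by
  have hinvI := isInvInvariant_of_isMulRightInvariant mH
  have hall : ∀ h, N h < ∞ := by
    intro h
    have h1 : ∀ᵐ k ∂mH, N (h * k⁻¹) < ∞ := by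
      have hmp : MeasurePreserving (fun k : H => h * k⁻¹) mH mH :=
        (measurePreserving_mul_left mH h).comp (Measure.measurePreserving_inv mH)
      exact hmp.quasiMeasurePreserving.ae hfin
    obtain ⟨k, hk1, hk2⟩ := (h1.and hfin).exists
    have h2 := hsub (h * k⁻¹) k
    rw [inv_mul_cancel_right] at h2
    exact h2.trans_lt (ENNReal.add_lt_top.2 ⟨hk1, hk2⟩)
  let E : ℕ → Set H := fun n => {h | N h ≤ n ∧ N h⁻¹ ≤ n}
  have hE : ∀ n, MeasurableSet (E n) := fun n =>
    (measurableSet_le hN measurable_const).inter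
      (measurableSet_le (hN.comp measurable_inv) measurable_const)
  have hEU : ⋃ n, E n = Set.univ := by
    refine Set.eq_univ_of_forall fun h => Set.mem_iUnion.2 ?_
    obtain ⟨n, hn⟩ := ENNReal.exists_nat_gt (hall h).ne
    obtain ⟨l, hl⟩ := ENNReal.exists_nat_gt (hall h⁻¹).ne
    refine ⟨max n l, hn.le.trans ?_, hl.le.trans ?_⟩ <;> exact_mod_cast by simp
  obtain ⟨n, hn⟩ : ∃ n, 0 < mH (E n) := by
    refine exists_measure_pos_of_not_measure_iUnion_null ?_
    rw [hEU]
    exact (NeZero.ne (mH Set.univ))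
  have hV : E n / E n ∈ 𝓝 (1 : H) := Measure.div_mem_nhds_one_of_haar_pos mH (E n) (hE n) hn
  have hVN : ∀ v ∈ E n / E n, N v ≤ 2 * n := by
    rintro _ ⟨a, ha, b, hb, rfl⟩
    change N (a / b) ≤ _
    rw [div_eq_mul_inv, two_mul]
    exact (hsub a b⁻¹).trans (add_le_add ha.1 hb.2)
  obtain ⟨C, hC, hCT⟩ : ∃ C : ℝ≥0∞, C ≠ ∞ ∧ ∀ h ∈ T, N h ≤ C := by
    refine hT.1.induction_on (p := fun T => ∃ C : ℝ≥0∞, C ≠ ∞ ∧ ∀ h ∈ T, N h ≤ C)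
      ⟨0, by simp, by simp⟩ ?_ ?_ ?_
    · rintro A B hAB ⟨C, hC, hCB⟩
      exact ⟨C, hC, fun h hh => hCB h (hAB hh)⟩
    · rintro A B ⟨C, hC, hCA⟩ ⟨C', hC', hCB⟩
      refine ⟨max C C', (max_lt hC.lt_top hC'.lt_top).ne, ?_⟩
      rintro h (hh | hh)
      · exact (hCA h hh).trans (le_max_left _ _)
      · exact (hCB h hh).trans (le_max_right _ _)
    · intro x _
      refine ⟨(fun y => x⁻¹ * y) ⁻¹' (E n / E n), mem_nhdsWithin_of_mem_nhds ?_, N x + 2 * n,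
        ENNReal.add_ne_top.2 ⟨(hall x).ne, ENNReal.mul_ne_top (by simp) (by simp)⟩, ?_⟩
      · have hc : ContinuousAt (fun y : H => x⁻¹ * y) x := (continuous_const_mul _).continuousAt
        refine hc ?_
        change _ ∈ 𝓝 (x⁻¹ * x)
        rw [inv_mul_cancel]
        exact hV
      · intro y hy
        have h1 := hsub x (x⁻¹ * y)
        rw [mul_inv_cancel_left] at h1
        exact h1.trans (by gcongr; exact hVN _ hy)
  refine ⟨C + N 1, ENNReal.add_ne_top.2 ⟨hC, (hall 1).ne⟩, fun h => ?_⟩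
  have hpow : ∀ (l : ℕ) (k : H), k ∈ T ^ l → N k ≤ C * l + N 1 := by
    intro l
    induction l with
    | zero =>
      intro k hk
      rw [pow_zero, Set.mem_one] at hk
      simp [hk]
    | succ l ih =>
      intro k hk
      rw [pow_succ] at hk
      obtain ⟨a, ha, b, hb, rfl⟩ := hk
      calc N (a * b) ≤ N a + N b := hsub a b
        _ ≤ (C * l + N 1) + C := add_le_add (ih a ha) (hCT b hb)
        _ = C * (l + 1 : ℕ) + N 1 := by push_cast; ring
  calc N h ≤ C * wordNorm T h + N 1 := hpow _ h (hT.mem_pow_wordNorm h)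
    _ ≤ (C + N 1) * wordNorm T h + (C + N 1) := by
      gcongr <;> simp
    _ = (C + N 1) * (wordNorm T h + 1) := by ring

section LpNorm

variable {H X Y : Type u} [MeasurableSpace H] [MeasurableSpace X] [MeasurableSpace Y]
  {ν : Measure Y} [IsFiniteMeasure ν] {μ : Measure X} [IsFiniteMeasure μ] {p : ℝ≥0∞}
  {c : H → Y → ℝ}

theorem measurable_eLpNorm_of_uncurry (hc : Measurable (Function.uncurry c)) (hp : 1 ≤ p) :
    Measurable fun h => eLpNorm (c h) p ν := by
  have hp0 : p ≠ 0 := (zero_lt_one.trans_le hp).ne'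
  rcases eq_or_ne p ∞ with rfl | hptop
  · refine measurable_of_Iic fun M => ?_
    have hset : MeasurableSet {q : H × Y | M < ‖c q.1 q.2‖ₑ} :=
      measurableSet_lt measurable_const hc.enorm
    have h1 : (fun h => eLpNorm (c h) ∞ ν) ⁻¹' Set.Iic M =
        (fun h => ν (Prod.mk h ⁻¹' {q : H × Y | M < ‖c q.1 q.2‖ₑ})) ⁻¹' {0} := by
      ext h
      simp only [Set.mem_preimage, Set.mem_Iic, Set.mem_singleton_iff, eLpNorm_exponent_top]
      have h2 : ν (Prod.mk h ⁻¹' {q : H × Y | M < ‖c q.1 q.2‖ₑ}) = 0 ↔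
          ∀ᵐ y ∂ν, ‖c h y‖ₑ ≤ M := by
        rw [ae_iff]
        simp only [not_le]
        rfl
      rw [h2]
      refine ⟨fun h3 => ?_, fun h3 => essSup_le_of_ae_le _ h3⟩
      filter_upwards [ae_le_eLpNormEssSup (f := c h) (μ := ν)] with y hy using hy.trans h3
    rw [h1]
    exact measurable_measure_prodMk_left hset (measurableSet_singleton 0)
  · simp only [eLpNorm_eq_lintegral_rpow_enorm_toReal hp0 hptop]
    exact ((hc.enorm.pow_const p.toReal).lintegral_prod_right' (ν := ν)).pow_const _

/-- A function on `Y × X` whose slices over `X` have `L^p`-norms dominated by an `L^p`-function is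
itself in `L^p`. -/
theorem eLpNorm_comp_lt_top (hc : Measurable (Function.uncurry c)) (hp : 1 ≤ p) {a : X → H}
    (ha : Measurable a) {d : X → ℝ} (hd : Measurable d) {C : ℝ≥0∞} (hC : C ≠ ∞)
    (hbound : ∀ x, eLpNorm (c (a x)) p ν ≤ C * ‖d x‖ₑ) (hfin : eLpNorm d p μ < ∞) :
    eLpNorm (fun q : Y × X => c (a q.2) q.1) p (ν.prod μ) < ∞ := by
  have hp0 : p ≠ 0 := (zero_lt_one.trans_le hp).ne'
  have hmeas : Measurable fun q : Y × X => c (a q.2) q.1 :=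
    hc.comp ((ha.comp measurable_snd).prodMk measurable_fst)
  rcases eq_or_ne p ∞ with rfl | hptop
  · simp only [eLpNorm_exponent_top] at hbound hfin ⊢
    have hset : MeasurableSet {q : X × Y | ‖c (a q.1) q.2‖ₑ ≤ C * eLpNormEssSup d μ} :=
      measurableSet_le (hmeas.comp measurable_swap).enorm measurable_const
    have h1 : ∀ᵐ q ∂(μ.prod ν), ‖c (a q.1) q.2‖ₑ ≤ C * eLpNormEssSup d μ := by
      refine (Measure.ae_prod_iff_ae_ae hset).2 ?_
      filter_upwards [ae_le_eLpNormEssSup (f := d) (μ := μ)] with x hx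
      filter_upwards [ae_le_eLpNormEssSup (f := c (a x)) (μ := ν)] with y hy
      exact hy.trans ((hbound x).trans (by gcongr))
    have h2 : ∀ᵐ q ∂(ν.prod μ), ‖c (a q.2) q.1‖ₑ ≤ C * eLpNormEssSup d μ :=
      Measure.measurePreserving_swap.quasiMeasurePreserving.ae h1
    exact (essSup_le_of_ae_le _ h2).trans_lt (ENNReal.mul_lt_top hC.lt_top hfin)
  · have hp' : 0 < p.toReal := ENNReal.toReal_pos hp0 hptop
    rw [eLpNorm_lt_top_iff_lintegral_rpow_enorm_lt_top hp0 hptop] at hfin ⊢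
    rw [lintegral_prod_symm' (f := fun q : Y × X => ‖c (a q.2) q.1‖ₑ ^ p.toReal)
      (hmeas.enorm.pow_const _)]
    have h1 : ∀ x, ∫⁻ y, ‖c (a x) y‖ₑ ^ p.toReal ∂ν ≤ C ^ p.toReal * ‖d x‖ₑ ^ p.toReal := by
      intro x
      have h2 := hbound x
      rw [eLpNorm_eq_lintegral_rpow_enorm_toReal hp0 hptop, one_div,
        ENNReal.rpow_inv_le_iff hp', ENNReal.mul_rpow_of_nonneg _ _ hp'.le] at h2
      exact h2
    refine (lintegral_mono h1).trans_lt ?_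
    rw [lintegral_const_mul _ (hd.enorm.pow_const _)]
    exact ENNReal.mul_lt_top (ENNReal.rpow_lt_top_of_nonneg hp'.le hC) hfin

end LpNorm

section Base

variable {A K Y Z : Type u} [Group A] [MeasurableSpace A] [Group K]
  [MeasurableSpace K] [MeasurableMul₂ K] [MeasurableInv K] [MeasurableSpace Y]
  [MeasurableSpace Z] {act : K → Z → Z} {mK : Measure K}
  [SFinite mK] [NeZero mK] [mK.IsMulLeftInvariant] [mK.IsMulRightInvariant] [mK.IsInvInvariant]
  {ν : Measure Y} [SFinite ν] {m : Measure Z} [SFinite m]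
  {t : Y → Z} {q : Z → K × Y} {Z₀ : Set Z} {actA : A → Z → Z}

/-- The action induced on the base of a strict section preserves the measure. -/
theorem IsStrictSection.measurePreserving_base (h : IsStrictSection act mK ν m t q Z₀)
    (hact : IsMeasurableAction act) (hinv : ∀ k, MeasurePreserving (act k) m m)
    (hactA : IsMeasurableAction actA) (hA : ∀ a, MeasurePreserving (actA a) m m)
    (hcomm : ∀ a k z, actA a (act k z) = act k (actA a z)) {κ : K → ℝ≥0∞} (hκ : Measurable κ)
    (hκ1 : ∫⁻ k, κ k ∂mK = 1) (a : A) :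
    MeasurePreserving (fun y => (q (actA a (t y))).2) ν ν := by
  have hmeas : Measurable fun y => (q (actA a (t y))).2 :=
    (h.measurable_coord.comp ((hA a).measurable.comp h.measurable_section)).snd
  have hw : ∀ {v : Z → Z}, MeasurePreserving v m m → (∀ k z, v (act k z) = act k (v z)) →
      IsWeight act mK m fun z => κ (q (v z)).1 := fun {v} hv hvc =>
    ⟨hκ.comp (h.measurable_coord.comp hv.measurable).fst, by
      filter_upwards [hv.quasiMeasurePreserving.ae h.ae_mem] with z hz
      simp only [hvc, h.coord_act _ hz]
      rw [lintegral_mul_right_eq_self, hκ1]⟩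
  refine ⟨hmeas, Measure.ext_of_lintegral _ fun F hF => ?_⟩
  rw [lintegral_map hF hmeas]
  have e1 := h.isFundamentalIso.lintegral_weight hκ hκ1
    (F := fun y => F (q (actA a (t y))).2) (hF.comp hmeas)
  have e2 : ∀ᵐ z ∂m, F (q (actA a (t (q z).2))).2 * κ (q z).1 =
      F (q (actA a z)).2 * κ (q (actA a⁻¹ (actA a z))).1 := by
    filter_upwards [h.ae_mem, (hA a).quasiMeasurePreserving.ae h.ae_mem] with z hz hz'
    rw [(h.coord_section hact hz).1, hcomm, h.coord_act _ hz', hactA.inv_act]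
  have hF' : Measurable fun z => F (q z).2 := hF.comp h.measurable_coord.snd
  have hw1 := hw (hA a⁻¹) (hcomm a⁻¹)
  have hw0 := hw (.id m) fun _ _ => rfl
  have e3 := (hA a).lintegral_comp (f := fun z => F (q z).2 * κ (q (actA a⁻¹ z)).1)
    (hF'.mul hw1.measurable)
  have e4 := hw0.lintegral_mul_eq hact hinv hw1 hF' fun k => by
    filter_upwards [h.ae_mem] with z hz
    rw [h.coord_act z hz]
  rw [← e1, lintegral_congr_ae e2]
  exact e3.trans (e4.trans (h.isFundamentalIso.lintegral_weight hκ hκ1 hF))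

/-- The cocycle identity `β (a b, y) = β (a, b y) β (b, y)`. -/
theorem IsStrictSection.ae_cocycle_mul (h : IsStrictSection act mK ν m t q Z₀)
    (hactA : IsMeasurableAction actA) (hcomm : ∀ a k z, actA a (act k z) = act k (actA a z))
    (hbase : ∀ a, MeasurePreserving (fun y => (q (actA a (t y))).2) ν ν) {β : A → Y → K}
    (hβ : ∀ a, ∀ᵐ y ∂ν, actA a (t y) ∈ Z₀ ∧ (q (actA a (t y))).1 = (β a y)⁻¹) (a b : A) :
    ∀ᵐ y ∂ν, β (a * b) y = β a (q (actA b (t y))).2 * β b y := by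
  filter_upwards [hβ (a * b), hβ b, (hbase b).quasiMeasurePreserving.ae (hβ a)]
    with y h1 h2 h3
  have h4 := h.act_section _ h2.1
  have h5 : actA (a * b) (t y) =
      act (β b y)⁻¹ (actA a (t (q (actA b (t y))).2)) := by
    rw [hactA.mul, ← hcomm, ← h2.2, h4]
  have h6 := h1.2
  rw [h5, h.coord_act _ h3.1] at h6
  dsimp only at h6
  rw [h3.2, ← mul_inv_rev, inv_inj] at h6
  exact h6.symm

end Base

/-! ### Taut groups and compact extensions of subgroups of finite covolume -/

section TautExtension

variable {G H : Type u}
  [Group G] [TopologicalSpace G] [IsTopologicalGroup G] [LocallyCompactSpace G]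
  [SecondCountableTopology G] [T2Space G] [MeasurableSpace G] [BorelSpace G]
  [Group H] [TopologicalSpace H] [IsTopologicalGroup H] [LocallyCompactSpace H]
  [SecondCountableTopology H] [T2Space H] [MeasurableSpace H] [BorelSpace H]
  {mG : Measure G} [mG.IsHaarMeasure] [mG.IsMulRightInvariant]
  {mH : Measure H} [mH.IsHaarMeasure] [mH.IsMulRightInvariant]

section Integrable

variable {Ω X Y : Type u} [MeasurableSpace Ω] [StandardBorelSpace Ω] [MulAction (G × H) Ω]
  {m : Measure Ω} [MeasurableSpace X] [StandardBorelSpace X] [MeasurableSpace Y]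
  [StandardBorelSpace Y] {ν : Measure Y} [IsFiniteMeasure ν] {μ : Measure X} [IsFiniteMeasure μ]
  {t : Y → Ω} {q : Ω → G × Y} {Ω₁ : Set Ω}

/-- The composition of `L^p`-integrable cocycles is `L^p`-integrable: by the cocycle identity the
`L^p`-norm of `β (h, ·)` is subadditive in `h`, hence grows at most linearly in the word norm. -/
theorem IsLpIntegrableCocycle.comp (hm : IsCoupling mG mH m)
    (hS : IsStrictSection (fun (g : G) (ω : Ω) => (g, (1 : H)) • ω) mG ν m t q Ω₁)
    {β : H → Y → G} (hβ : Measurable (Function.uncurry β))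
    (hβq : ∀ h, ∀ᵐ y ∂ν, ((1 : G), h) • t y ∈ Ω₁ ∧ (q (((1 : G), h) • t y)).1 = (β h y)⁻¹)
    {α : G → X → H} (hα : Measurable (Function.uncurry α)) {p : ℝ≥0∞} (hp : 1 ≤ p)
    (hβp : IsLpIntegrableCocycle p mH ν β) (hαp : IsLpIntegrableCocycle p mG μ α) :
    IsLpIntegrableCocycle p mG (ν.prod μ) fun g z => β (α g z.2) z.1 := by
  have hsf := hm.sFinite
  have := isInvInvariant_of_isMulRightInvariant mG
  obtain ⟨κ, hκ, hκ1⟩ := exists_measurable_lintegral_eq_one mG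
  obtain ⟨S, hSgen, hSfin⟩ := hβp
  obtain ⟨T, hTgen, hTfin⟩ := hαp
  let c : H → Y → ℝ := fun h y => wordNorm S (β h y)
  have hc : Measurable (Function.uncurry c) :=
    (measurable_from_nat (f := fun n : ℕ => (n : ℝ))).comp (hSgen.measurable_wordNorm.comp hβ)
  have hch : ∀ h, AEStronglyMeasurable (c h) ν := fun h =>
    (hc.comp measurable_prodMk_left).aestronglyMeasurable
  have hcomm : ∀ (h : H) (g : G) (ω : Ω),
      ((1 : G), h) • (g, (1 : H)) • ω = (g, (1 : H)) • ((1 : G), h) • ω :=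
    fun h g ω => smul_comm_of_prod g h ω
  have hbase := hS.measurePreserving_base hm.isMeasurableAction_left
    (fun g => hm.measurePreserving_smul (g, 1)) hm.isMeasurableAction_right
    (fun h => hm.measurePreserving_smul (1, h)) hcomm hκ hκ1
  have hsub : ∀ h k, eLpNorm (c (h * k)) p ν ≤ eLpNorm (c h) p ν + eLpNorm (c k) p ν := by
    intro h k
    have hle : ∀ᵐ y ∂ν, ‖c (h * k) y‖ ≤
        (c h ∘ (fun y => (q (((1 : G), k) • t y)).2) + c k) y := by
      filter_upwards [hS.ae_cocycle_mul hm.isMeasurableAction_right hcomm hbase hβq h k] with y hy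
      simp only [c, Pi.add_apply, Function.comp_apply, hy]
      rw [Real.norm_of_nonneg (Nat.cast_nonneg _)]
      exact_mod_cast hSgen.wordNorm_mul_le _ _
    refine (eLpNorm_mono_ae_real hle).trans ((eLpNorm_add_le
      ((hch h).comp_measurePreserving (hbase k)) (hch k) hp).trans ?_)
    rw [eLpNorm_comp_measurePreserving (hch h) (hbase k)]
  obtain ⟨C, hC, hCN⟩ := exists_le_mul_wordNorm mH (measurable_eLpNorm_of_uncurry hc hp) hsub hSfin
    hTgen
  refine ⟨S, hSgen, ?_⟩
  filter_upwards [hTfin] with g hg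
  have hαg : Measurable (α g) := hα.comp measurable_prodMk_left
  have hd : Measurable fun x => (wordNorm T (α g x) : ℝ) :=
    (measurable_from_nat (f := fun n : ℕ => (n : ℝ))).comp (hTgen.measurable_wordNorm.comp hαg)
  refine eLpNorm_comp_lt_top hc hp hαg (hd.add_const 1) hC (fun x => (hCN _).trans_eq ?_) ?_
  · congr 1
    rw [Real.enorm_of_nonneg (by positivity), ENNReal.ofReal_add (by positivity) zero_le_one]
    simp
  · exact (MemLp.add ⟨hd.aestronglyMeasurable, hg⟩ (memLp_const (1 : ℝ))).2

end Integrable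

/-- The composition of a coupling with its dual as a coupling on a standard Borel space, together
with its cocycles and the tautening kernel that results if it is taut. -/
theorem IsCoupling.exists_composition_model {Ω X Y : Type u} [MeasurableSpace Ω]
    [StandardBorelSpace Ω] [MulAction (G × H) Ω] {m : Measure Ω} [MeasurableSpace X]
    [StandardBorelSpace X] [MeasurableSpace Y] [StandardBorelSpace Y]
    {ν : Measure Y} [IsFiniteMeasure ν] {μ : Measure X} [IsFiniteMeasure μ]
    {t : Y → Ω} {q : Ω → G × Y} {Ω₁ : Set Ω} {s : X → Ω} {r : Ω → H × X} {Ω₀ : Set Ω}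
    (hm : IsCoupling mG mH m)
    (hS : IsStrictSection (fun (g : G) (ω : Ω) => (g, (1 : H)) • ω) mG ν m t q Ω₁)
    (hT : IsStrictSection (fun (h : H) (ω : Ω) => ((1 : G), h) • ω) mH μ m s r Ω₀) :
    ∃ (Z : Type u) (_ : MeasurableSpace Z) (_ : StandardBorelSpace Z) (_ : MulAction (G × G) Z)
      (mZ : Measure Z) (i : G × (Y × X) → Z) (i' : Z → G × (Y × X)) (j : G × (Y × X) → Z)
      (j' : Z → G × (Y × X)), IsCoupling mG mG mZ ∧
      IsFundamentalIso (fun (g : G) (z : Z) => (g, (1 : G)) • z) mG (ν.prod μ) mZ i i' ∧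
      IsFundamentalIso (fun (g : G) (z : Z) => ((1 : G), g) • z) mG (ν.prod μ) mZ j j' ∧
      (IsTautRelative (MonoidHom.id G) mZ →
        ∃ Φ : Ω × Ω → G, IsTauteningKernel (H := H) (MonoidHom.id G) m Φ) ∧
      ∀ (β : H → Y → G) (α : G → X → H), Measurable (Function.uncurry β) →
        (∀ h, ∀ᵐ y ∂ν, ((1 : G), h) • t y ∈ Ω₁ ∧ (q (((1 : G), h) • t y)).1 = (β h y)⁻¹) →
        Measurable (Function.uncurry α) →
        (∀ g, ∀ᵐ x ∂μ, (g, (1 : H)) • s x ∈ Ω₀ ∧ (r ((g, (1 : H)) • s x)).1 = (α g x)⁻¹) →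
        IsMECocycle (fun (g : G) (z : Z) => ((1 : G), g) • z) mG (ν.prod μ) i i'
          (fun g z => β (α g z.2) z.1) ∧
        IsMECocycle (fun (g : G) (z : Z) => (g, (1 : G)) • z) mG (ν.prod μ) j j'
          (fun g z => β (α g z.2) z.1) := by
  have hne := hm.nonempty
  have : Nonempty Y := hne.map fun ω => (q ω).2
  have : Nonempty X := hne.map fun ω => (r ω).2
  obtain ⟨Z, _, _, _, D, θ, hZ, hθ⟩ := hm.exists_isCompositionModel
  obtain ⟨i', hi', hil⟩ := exists_compositionIso_leftInverse hm hθ hS hT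
  obtain ⟨j', hj', hjl⟩ := exists_compositionIso_leftInverse hm hθ.symm hS hT
  have hi := isFundamentalIso_compositionIso hm hθ hS hT hi' hil
  have hj := isFundamentalIso_compositionIso hm hθ.symm hS hT hj' hjl
  have hcoup := isCoupling_model hm hZ hθ hS hT hi hj
  rw [map_compositionIso_swap hm hθ hS hT] at hj
  exact ⟨Z, _, inferInstance, inferInstance, _, _, i', _, j', hcoup, hi, hj,
    fun ⟨⟨Φ, hΦ⟩, _⟩ => ⟨_, hΦ.isTauteningKernel_model hm hθ hS hT⟩,
    fun β α hβ hβq hα hαr => ⟨isMECocycle_compositionIso hm hθ hS hT hil hβ hβq hα hαr,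
      isMECocycle_compositionIso hm hθ.symm hS hT hjl hβ hβq hα hαr⟩⟩

theorem IsTautGroup.isCompactExtensionOfFiniteCovolume (hG : IsTautGroup mG)
    (h : MeasureEquivalent mG mH) : IsCompactExtensionOfFiniteCovolume G H := by
  have : PolishSpace G := polishSpace_of_locallyCompact
  have : PolishSpace H := polishSpace_of_locallyCompact
  obtain ⟨Ω, _, _, _, m, hm⟩ := h
  have hsf := hm.sFinite
  have hne := hm.nonempty
  obtain ⟨Y, _, _, ν, i, i', _, hi⟩ := hm.left
  obtain ⟨X, _, _, μ, j, j', _, hj⟩ := hm.right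
  obtain ⟨t, q, Ω₁, hS, -, -⟩ := hi.exists_isStrictSection hm.isMeasurableAction_left
  obtain ⟨s, r, Ω₀, hT, -, -⟩ := hj.exists_isStrictSection hm.isMeasurableAction_right
  obtain ⟨Z, _, _, _, mZ, -, -, -, -, hZ, -, -, hker, -⟩ := hm.exists_composition_model hS hT
  obtain ⟨Φ, hΦ⟩ := hker (hG Z mZ hZ)
  exact hΦ.isCompactExtensionOfFiniteCovolume hm hG.isStronglyICCRelative

theorem IsPTautGroup.isCompactExtensionOfFiniteCovolume {p : ℝ≥0∞} (hp : 1 ≤ p)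
    (hG : IsPTautGroup p mG) (h : LpMeasureEquivalent p mG mH) :
    IsCompactExtensionOfFiniteCovolume G H := by
  have : PolishSpace G := polishSpace_of_locallyCompact
  have : PolishSpace H := polishSpace_of_locallyCompact
  obtain ⟨Ω, _, _, _, m, hm⟩ := h
  have hmc := hm.isCoupling
  have hsf := hmc.sFinite
  have hne := hmc.nonempty
  obtain ⟨Y, _, _, ν, i, i', β, _, hi, hβ, hβp⟩ := hm.left
  obtain ⟨X, _, _, μ, j, j', α, _, hj, hα, hαp⟩ := hm.right
  obtain ⟨t, q, Ω₁, hS, hti, hqi⟩ := hi.exists_isStrictSection hmc.isMeasurableAction_left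
  obtain ⟨s, r, Ω₀, hT, hsj, hrj⟩ := hj.exists_isStrictSection hmc.isMeasurableAction_right
  have hβq := hS.ae_cocycle hti hqi hβ (fun h => hmc.measurePreserving_smul (1, h))
    fun h g ω => smul_comm_of_prod g h ω
  have hαr := hT.ae_cocycle hsj hrj hα (fun g => hmc.measurePreserving_smul (g, 1))
    fun g h ω => (smul_comm_of_prod g h ω).symm
  obtain ⟨Z, _, _, _, mZ, iZ, iZ', jZ, jZ', hZ, hiZ, hjZ, hker, hcoc⟩ :=
    hmc.exists_composition_model hS hT
  obtain ⟨hγ₂, hγ₁⟩ := hcoc β α hβ.1 hβq hα.1 hαr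
  have hγp : IsLpIntegrableCocycle p mG (ν.prod μ) fun g z => β (α g z.2) z.1 :=
    hβp.comp hmc hS hβ.1 hβq hα.1 hp hαp
  have hZp : IsLpCoupling p mG mG mZ :=
    ⟨hZ, ⟨Y × X, _, inferInstance, ν.prod μ, iZ, iZ', _, inferInstance, hiZ, hγ₂, hγp⟩,
      ⟨Y × X, _, inferInstance, ν.prod μ, jZ, jZ', _, inferInstance, hjZ, hγ₁, hγp⟩⟩
  obtain ⟨Φ, hΦ⟩ := hker (hG Z mZ hZp)
  obtain ⟨S, hSgen, -⟩ := hβp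
  exact hΦ.isCompactExtensionOfFiniteCovolume hmc (hG.isStronglyICCRelative hSgen)

end TautExtension

theorem theorem2p1 {G H : Type u}
    [Group G] [TopologicalSpace G] [IsTopologicalGroup G] [LocallyCompactSpace G]
    [SecondCountableTopology G] [T2Space G] [MeasurableSpace G] [BorelSpace G]
    [Group H] [TopologicalSpace H] [IsTopologicalGroup H] [LocallyCompactSpace H]
    [SecondCountableTopology H] [T2Space H] [MeasurableSpace H] [BorelSpace H]
    (mG : Measure G) [mG.IsHaarMeasure] [mG.IsMulRightInvariant]
    (mH : Measure H) [mH.IsHaarMeasure] [mH.IsMulRightInvariant] :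
    (IsTautGroup mG → MeasureEquivalent mG mH → IsCompactExtensionOfFiniteCovolume G H) ∧
    (∀ p : ℝ≥0∞, 1 ≤ p → IsPTautGroup p mG → LpMeasureEquivalent p mG mH →
      IsCompactExtensionOfFiniteCovolume G H) ∧
    (∀ (Ω : Type u) [MeasurableSpace Ω] [StandardBorelSpace Ω] [MulAction (G × H) Ω]
      (m : Measure Ω)
      (P : Type u) [Group P] [TopologicalSpace P] [IsTopologicalGroup P] [PolishSpace P]
      [MeasurableSpace P] [BorelSpace P] (π : G →ₜ* P),
      IsCoupling mG mH m →
      IsStronglyICCRelative (π : G →* P).range →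
      IsTautRelative (π : G →* P) (compositionMeasure G G H mH m m) →
      ∃ (ρ : H →ₜ* P) (Ψ : Ω → P),
        -- equivariance of `Ψ`
        (Measurable Ψ ∧
          ∀ᵐ ω ∂m, ∀ (g : G) (h : H), Ψ ((g, h) • ω) = π g * Ψ ω * (ρ h)⁻¹) ∧
        -- the tautening map is given by `Ψ`
        (∀ Φ : CouplingComp G G H Ω Ω → P,
          IsTauteningMap (π : G →* P) (compositionMeasure G G H mH m m) Φ →
          ∀ᵐ w ∂(m.prod m), Φ (CouplingComp.mk G G H w) = Ψ w.1 * (Ψ w.2)⁻¹) ∧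
        -- uniqueness up to conjugation
        (∀ (ρ' : H →ₜ* P) (Ψ' : Ω → P), Measurable Ψ' →
          (∀ (g : G) (h : H), ∀ᵐ ω ∂m, Ψ' ((g, h) • ω) = π g * Ψ' ω * (ρ' h)⁻¹) →
          ∃ x : P, (∀ᵐ ω ∂m, Ψ' ω = Ψ ω * x⁻¹) ∧ ∀ h : H, ρ' h = x * ρ h * x⁻¹) ∧
        -- the case where `π` has compact kernel and closed image
        (IsCompact ((π : G →* P).ker : Set G) → IsClosed ((π : G →* P).range : Set P) →
          IsCompact ((ρ : H →* P).ker : Set H) ∧ IsClosed ((ρ : H →* P).range : Set P) ∧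
          ∃ (mGbar : Measure (π : G →* P).range) (mHbar : Measure (ρ : H →* P).range)
            (mbar : Measure P),
            -- the images are unimodular lcsc groups with Haar measures pushed forward from `G`, `H`
            LocallyCompactSpace (π : G →* P).range ∧ LocallyCompactSpace (ρ : H →* P).range ∧
            MeasurePreserving (π : G →* P).rangeRestrict mG mGbar ∧
            MeasurePreserving (ρ : H →* P).rangeRestrict mH mHbar ∧
            mGbar.IsHaarMeasure ∧ mGbar.IsMulRightInvariant ∧
            mHbar.IsHaarMeasure ∧ mHbar.IsMulRightInvariant ∧
            -- invariance
            (∀ (g : G) (h : H), mbar.map (fun x => π g * x * ρ h) = mbar) ∧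
            -- finite quotient measures on the two coset spaces
            (∃ ν : Measure (Quotient (QuotientGroup.rightRel (π : G →* P).range)),
              IsFiniteMeasure ν ∧
              IsQuotientMeasure (QuotientGroup.rightRel (π : G →* P).range)
                (fun (k : (π : G →* P).range) (x : P) => (k : P) * x) mGbar mbar ν) ∧
            (∃ μ : Measure (Quotient (QuotientGroup.leftRel (ρ : H →* P).range)),
              IsFiniteMeasure μ ∧
              IsQuotientMeasure (QuotientGroup.leftRel (ρ : H →* P).range)
                (fun (k : (ρ : H →* P).range) (x : P) => x * (k : P)) mHbar mbar μ) ∧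
            -- `(P, mbar)` is a coupling of the images
            IsCoupling (act := biMulAction (π : G →* P).range (ρ : H →* P).range)
              mGbar mHbar mbar ∧
            -- it is a quotient of the orbit space of the kernels on `Ω`
            ∃ F : Quotient (MulAction.orbitRel
                ((π : G →* P).ker.prod (ρ : H →* P).ker) Ω) → P,
              MeasurePreserving F (m.map (Quotient.mk _)) mbar ∧
              ∀ᵐ ω ∂m, ∀ (g : G) (h : H),
                F (Quotient.mk _ ((g, h) • ω)) = π g * F (Quotient.mk _ ω) * (ρ h)⁻¹)) := by

  refine ⟨IsTautGroup.isCompactExtensionOfFiniteCovolume,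
    fun p hp => IsPTautGroup.isCompactExtensionOfFiniteCovolume hp, ?_⟩
  intro Ω _ _ _ m P _ _ _ _ _ _ π hm hICC ⟨⟨Φ₀, hΦ₀⟩, huniq⟩
  have hsf := hm.sFinite
  obtain ⟨ρ, Ψ, D, hΨ, -, hD, hDinv, hΨe, hΨ1, hΦΨ⟩ :=
    (hΦ₀.isTauteningKernel hm).exists_hom hm hICC
  have he : ∀ (g : G) (h : H), ∀ᵐ ω ∂m, Ψ ((g, h) • ω) = π g * Ψ ω * (ρ h)⁻¹ := fun g h => by
    filter_upwards [hD] with ω hω using hΨe ω hω g h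
  refine ⟨ρ, Ψ, ⟨hΨ, hD.mono fun ω hω => hΨe ω hω⟩, fun Φ hΦ => ?_, fun ρ' Ψ' hΨ' he' => ?_,
    fun hπk hπr => ?_⟩
  · filter_upwards [hΦΨ, hm.quasiMeasurePreserving_mk.ae (huniq Φ Φ₀ hΦ hΦ₀)] with w h1 h2
    rw [h2, h1]
  · exact IsTauteningKernel.unique_hom (ρ := (ρ : H →* P)) (ρ' := (ρ' : H →* P)) hm hICC
      hΨ hΨ' he he'
  · obtain ⟨hρk, hρr⟩ := isCompact_ker_and_isClosed_range_of_coupling hm hΨ he hπk hπr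
    have hπcont : Measurable (π : G →* P).rangeRestrict :=
      π.continuous_toFun.measurable.subtype_mk
    have hρcont : Measurable (ρ : H →* P).rangeRestrict :=
      ρ.continuous_toFun.measurable.subtype_mk
    obtain ⟨hinv, hν, hμ, hcoup⟩ := exists_image_coupling hm hΨ he hπk hπr hρk hρr
    exact ⟨hρk, hρr, mG.map (π : G →* P).rangeRestrict, mH.map (ρ : H →* P).rangeRestrict,
      m.map Ψ, π.locallyCompactSpace_range hπr, ρ.locallyCompactSpace_range hρr,
      hπcont.measurePreserving mG, hρcont.measurePreserving mH,
      π.isHaarMeasure_map_rangeRestrict mG hπk hπr, π.isMulRightInvariant_map_rangeRestrict mG,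
      ρ.isHaarMeasure_map_rangeRestrict mH hρk hρr, ρ.isMulRightInvariant_map_rangeRestrict mH,
      hinv, hν, hμ, hcoup, exists_factor_map hΨ hD hDinv hΨe hΨ1⟩
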